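/- Let $H_d=\{0,1\}^d\subset\mathbb Z^d$. For $h\in H_d$ let $\mathcal P(h)$ be the set of unit vectors $v\in\mathbb Z^d$ (i.e. $\sum_i|v_i|=1$) with $h+v\in H_d$. Let $G\subset H_d$, let $\mathbf q=(q_h)_{h\in G}$ be a valid parameter set ($q_h>0$ for all $h\in G$, $\sum_{h\in G}q_h<1$) and put $p=1-\sum_{h\in G}q_h$. Let $\nu$ be the probability measure on $G\cup\{\star\}$ with $\nu(h)=q_h$ and $\nu(\star)=p$, and let $\mu=\nu^{\otimes\mathbb Z^d}$ on $\Omega=(G\cup\{\star\})^{\mathbb Z^d}$. The $G$-MCEM (multicolour East model) on $\mathbb Z^d$ is the Markov process on $\Omega$ whose generator acts on local functions (those depending on finitely many vertices) by $$\mathcal L f(\omega)=\sum_{h\in G}\sum_{x\in\mathbb Z^d}c_x^h(\omega)\,\bigl[\mathbf 1_{\omega_x=\star}\,q_h+\mathbf 1_{\omega_x=h}\,p\bigr]\,\nabla_x^{(h)}f(\omega),$$ where $c_x^h(\omega)=1$ if $\omega_{x-v}=h$ for some $v\in\mathcal P(h)$ and $c_x^h(\omega)=0$ otherwise, and $\nabla_x^{(h)}f(\omega)$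 is the change of $f$ when $\omega_x$ is changed from $\star$ to $h$ (if $\omega_x=\star$) or from $h$ to $\star$ (if $\omega_x=h$), and is $0$ if $\omega_x\notin\{\star,h\}$. Write $\mathcal L$ also for the closure of this operator in $L^2(\mu)$, let $\mathcal D(f)=\mu(-f\mathcal Lf)$, and let the spectral gap be $\gamma=\inf\{\mathcal D(f)/\operatorname{Var}_\mu(f): f\in\operatorname{Dom}(\mathcal L),\ f\text{ not }\mu\text{-a.s. constant}\}$ (with $\inf\emptyset=+\infty$). The process is called ergodic if, started from $\mu$, every event of path space that is invariant (up to null sets) under time shifts has probability $0$ or $1$. **Theorem 1.** The following holds for every $d$ and every valid parameter set. (A) If $G=H_d$, then the $G$-MCEM is not ergodic, and $0$ is not a simple eigenvalue of $\mathcal L$ in $L^2(\mu)$. More precisely, if $\mathcal A$ is the event that $\omega_{(1,\dots,1)-h}=h$ for all $h\in H_d$, then $\mathbf 1_{\mathcal A}$ is local, is not $\mu$-a.s. constant, and $\mathcal D(\mathbf 1_{\mathcal A})=0$. (B) If $G\subsetneq H_d$ and either (B.i) there is a coordinate $i$ with $h_i=h'_i$ for all $h,h'\in G$, or (B.ii)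 there is $G'$ with $G\subset G'\subsetneq H_d$ such that the graph induced on $G'$ by the nearest-neighbour graph of $\mathbb Z^d$ is isomorphic to a star graph (one centre joined to $n\ge 0$ leaves, no other edges), then $\gamma>0$. In particular, for $d=2$: if $|G|\le 3$ then $\gamma>0$; if $|G|=4$ then the $G$-MCEM is not ergodic (and $0$ is not a simple eigenvalue of $\mathcal L$). -/

import Mathlib

open MeasureTheory ProbabilityTheory Filter Topology
open scoped NNReal ENNReal symmDiff

universe u

noncomputable section

namespace MCEM

/-! ### The lattice, the hypercube and the propagation directions -/

/-- The vertices of `ℤ^d`. -/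
abbrev Lattice (d : ℕ) : Type := Fin d → ℤ

/-- The hypercube `H_d = {0,1}^d ⊆ ℤ^d`, which is also the set of all vacancy types. -/
def hypercube (d : ℕ) : Finset (Lattice d) := Fintype.piFinset fun _ => {0, 1}

/-- `v` is a propagation direction of the `h`-vacancy: a unit vector of `ℤ^d` with `h + v ∈ H_d`. -/
def IsPropagation {d : ℕ} (h v : Lattice d) : Prop :=
  ∑ i, |v i| = 1 ∧ h + v ∈ hypercube d

/-- The nearest-neighbour graph of `ℤ^d`. -/
def latticeGraph (d : ℕ) : SimpleGraph (Lattice d) where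
  Adj x y := ∑ i, |x i - y i| = 1
  symm := ⟨fun x y h => by simpa only [abs_sub_comm] using h⟩
  loopless := ⟨fun x h => by simp at h⟩

/-- The graph that `G` inherits from `ℤ^d` is isomorphic to a star graph
(one centre and `n ≥ 0` leaves). -/
def IsStar {d : ℕ} (G : Finset (Lattice d)) : Prop :=
  ∃ n : ℕ, Nonempty ((latticeGraph d).induce (G : Set (Lattice d)) ≃g
    SimpleGraph.starGraph (0 : Fin (n + 1)))

/-! ### State space and equilibrium measure -/

/-- The vertex state space `S(G)`: the vacancy types in `G` and the neutral state. -/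
def State {d : ℕ} (G : Finset (Lattice d)) : Type := Option G

/-- The neutral state. -/
def neutral {d : ℕ} {G : Finset (Lattice d)} : State G := (none : Option G)

/-- The state "`h`-vacancy". -/
def vacancy {d : ℕ} {G : Finset (Lattice d)} (h : G) : State G := (some h : Option G)

instance {d : ℕ} (G : Finset (Lattice d)) : Fintype (State G) := inferInstanceAs (Fintype (Option G))
instance {d : ℕ} (G : Finset (Lattice d)) : DecidableEq (State G) :=
  inferInstanceAs (DecidableEq (Option G))
instance {d : ℕ} (G : Finset (Lattice d)) : MeasurableSpace (State G) := ⊤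

/-- Configurations, with the product sigma-algebra. -/
abbrev Config {d : ℕ} (G : Finset (Lattice d)) : Type := Lattice d → State G

/-- Valid parameter sets: `q_h > 0` for `h ∈ G` and `∑ q_h < 1`. -/
structure ParameterSet {d : ℕ} (G : Finset (Lattice d)) where
  /-- the equilibrium densities of the vacancies -/
  q : G → ℝ
  q_pos : ∀ h, 0 < q h
  sum_q_lt_one : ∑ h, q h < 1

variable {d : ℕ} {G : Finset (Lattice d)}

/-- The equilibrium density of the neutral state. -/
def ParameterSet.p (Q : ParameterSet G) : ℝ := 1 - ∑ h, Q.q h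

lemma ParameterSet.p_pos (Q : ParameterSet G) : 0 < Q.p := by
  have := Q.sum_q_lt_one
  unfold ParameterSet.p
  linarith

/-- The single-vertex equilibrium measure on `S(G)`. -/
def ParameterSet.nu (Q : ParameterSet G) : Measure (State G) :=
  ENNReal.ofReal Q.p • Measure.dirac neutral +
    ∑ h, ENNReal.ofReal (Q.q h) • Measure.dirac (vacancy h)

instance (Q : ParameterSet G) : IsProbabilityMeasure Q.nu := by
  constructor
  simp only [ParameterSet.nu, Measure.coe_add, Measure.coe_finsetSum, Pi.add_apply,
    Finset.sum_apply, Measure.smul_apply, measure_univ, smul_eq_mul, mul_one]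
  rw [← ENNReal.ofReal_sum_of_nonneg fun h _ => (Q.q_pos h).le,
    ← ENNReal.ofReal_add Q.p_pos.le (Finset.sum_nonneg fun h _ => (Q.q_pos h).le)]
  simp [ParameterSet.p]

/-- The equilibrium measure: the product over `ℤ^d` of the single-vertex measure. -/
def ParameterSet.mu (Q : ParameterSet G) : Measure (Config G) :=
  Measure.infinitePi fun _ : Lattice d => Q.nu

/-! ### The generator -/

/-- `f` depends on the state of finitely many vertices only. -/
def IsLocal (f : Config G → ℝ) : Prop :=
  ∃ Λ : Finset (Lattice d), DependsOn f (Λ : Set (Lattice d))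

open Classical in
/-- The constraint: one if there is a propagation direction `v` of `h` such that there is an
`h`-vacancy on `x - v`, and zero otherwise. -/
def constraint (h : G) (x : Lattice d) (ω : Config G) : ℝ :=
  if ∃ v : Lattice d, IsPropagation (h : Lattice d) v ∧ ω (x - v) = vacancy h then 1 else 0

/-- The difference operator that exchanges `h` and the neutral state at `x`. -/
def grad (h : G) (x : Lattice d) (f : Config G → ℝ) (ω : Config G) : ℝ :=
  if ω x = neutral then f (Function.update ω x (vacancy h)) - f ω
  else if ω x = vacancy h then f (Function.update ω x neutral) - f ω
  else 0

/-- The generator on local functions (for local `f` only finitely many `x` contribute). -/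
def generator (Q : ParameterSet G) (f : Config G → ℝ) (ω : Config G) : ℝ :=
  ∑ h : G, ∑' x : Lattice d, constraint h x ω *
    ((if ω x = neutral then Q.q h else 0) + (if ω x = vacancy h then Q.p else 0)) * grad h x f ω

/-- The generator in `L²(μ)`, i.e. the closure of its action on local functions:
`f ∈ Dom(L)` with `L f = g` (as elements of `L²(μ)`). -/
structure GeneratorPair (Q : ParameterSet G) (f g : Config G → ℝ) : Prop where
  memLp_left : MemLp f 2 Q.mu
  memLp_right : MemLp g 2 Q.mu
  approx : ∃ F : ℕ → Config G → ℝ, (∀ n, IsLocal (F n)) ∧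
    Tendsto (fun n => eLpNorm (F n - f) 2 Q.mu) atTop (𝓝 0) ∧
    Tendsto (fun n => eLpNorm (generator Q (F n) - g) 2 Q.mu) atTop (𝓝 0)

/-- `f` is constant as an element of `L²(μ)`. -/
def IsConst (Q : ParameterSet G) (f : Config G → ℝ) : Prop :=
  ∃ c : ℝ, f =ᵐ[Q.mu] fun _ => c

/-- The Dirichlet form `μ(-f L f)`, where `g = L f`. -/
def dirichlet (Q : ParameterSet G) (f g : Config G → ℝ) : ℝ := ∫ ω, -(f ω * g ω) ∂Q.mu

/-- The spectral gap: the infimum of `D(f) / Var(f)` over the non-constant `f ∈ Dom(L)`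
(the infimum of the empty set is `+∞`). -/
def spectralGap (Q : ParameterSet G) : EReal :=
  ⨅ (f : Config G → ℝ) (g : Config G → ℝ) (_ : GeneratorPair Q f g) (_ : ¬ IsConst Q f),
    ((dirichlet Q f g / variance f Q.mu : ℝ) : EReal)

/-- `0` is a simple eigenvalue of the generator in `L²(μ)`: its eigenfunctions are constant. -/
def ZeroIsSimpleEigenvalue (Q : ParameterSet G) : Prop :=
  ∀ f g : Config G → ℝ, GeneratorPair Q f g → g =ᵐ[Q.mu] 0 → IsConst Q f

/-! ### The process and its ergodicity -/

/-- The filtration generated by a process. -/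
def past {S E : Type*} [mS : MeasurableSpace S] [mE : MeasurableSpace E] (X : ℝ≥0 → S → E)
    (hX : ∀ t, Measurable (X t)) : Filtration ℝ≥0 mS where
  seq t := ⨆ s ≤ t, mE.comap (X s)
  mono' _ _ hst := biSup_mono fun _ hr => hr.trans hst
  le' _ := iSup₂_le fun s _ => (hX s).comap_le

/-- `X` is a `G`-MCEM process started from its equilibrium measure: a process with right-continuous
paths with left limits (for the discrete topology on the finite set `S(G)` and the product topology
on configurations) and initial law `μ` that solves the martingale problem of the generator on local
functions. -/
structure IsProcess (Q : ParameterSet G) {S : Type*} [MeasurableSpace S] (P : Measure S)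
    (X : ℝ≥0 → S → Config G) : Prop where
  measurable : ∀ t, Measurable (X t)
  right_continuous : ∀ s x t, ∀ᶠ r in 𝓝[>] t, X r s x = X t s x
  left_limits : ∀ s x t, ∃ a : State G, ∀ᶠ r in 𝓝[<] t, X r s x = a
  initial_law : P.map (X 0) = Q.mu
  martingale : ∀ f : Config G → ℝ, IsLocal f →
    Martingale (fun (t : ℝ≥0) s =>
      f (X t s) - f (X 0 s) - ∫ r in (0 : ℝ)..t, generator Q f (X r.toNNReal s))
      (past X measurable) P

/-- Ergodicity under time shifts: every event of path space that is invariant, up to null sets,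
under all time shifts has probability zero or one. -/
def IsTimeErgodic {S E : Type*} [MeasurableSpace S] [MeasurableSpace E] (P : Measure S)
    (X : ℝ≥0 → S → E) : Prop :=
  ∀ A : Set (ℝ≥0 → E), MeasurableSet A →
    (∀ t : ℝ≥0, P ({s | (fun r => X r s) ∈ A} ∆ {s | (fun r => X (r + t) s) ∈ A}) = 0) →
    P {s | (fun r => X r s) ∈ A} = 0 ∨ P {s | (fun r => X r s) ∉ A} = 0

/-- The equilibrium `G`-MCEM process is ergodic. Its law is determined by `IsProcess`, so that it
does not matter which realisation of the process is taken. -/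
def IsErgodic.{v} (Q : ParameterSet G) : Prop :=
  ∃ (S : Type v) (_ : MeasurableSpace S) (P : Measure S) (_ : IsProbabilityMeasure P)
    (X : ℝ≥0 → S → Config G), IsProcess Q P X ∧ IsTimeErgodic P X

/-- The blocked configurations: for every vacancy type `h`, the vertex `(1,…,1) - h` of the unit
hypercube is in state `h`. -/
def blocked (G : Finset (Lattice d)) : Set (Config G) :=
  {ω | ∀ h : G, ω (1 - (h : Lattice d)) = vacancy h}

end MCEM

end

/-!
**Blocked configurations.** If `G = H_d`, then in a blocked configuration the vertex `(1,…,1) - h`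
of the unit hypercube carries an `h`-vacancy, and its neighbours in the propagation directions of
`h` carry vacancies of other types. So no vertex of this hypercube can be updated, and no transition
can enter or leave the event (`update_mem_blocked`). The generator vanishes on its indicator
(`generator_blocked`), which is a nonconstant eigenfunction for the eigenvalue `0` and, by the
martingale problem, almost surely constant along the process.

**From legal paths to a spectral gap.** The gap is bounded below by the constant of a Poincaré
inequality for local functions (`spectralGap_pos_of_poincare`). Order the sites by a linear level
function. Suppose that for each `x` there is a very likely event that depends on a bounded part of
the past of `x`, and on which the state of `x` can be changed by legal transitions in a bounded box.
The *constrained Poincaré inequality* (`constrained_poincare`) bounds the variance by the mean of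
the single-site variances restricted to these events: the variance splits into martingale
increments, and the contribution of the failure of the constraint at `x` is at most `ε` times the
increments in the support of the constraint, so that it can be absorbed. A single-site variance on
the event is bounded by the Dirichlet form along a legal path (`sq_sub_siteAvg_le`). Together this
is `spectralGap_pos_of_reach`. The very likely event asks that in each of polynomially many families
of at least `M` independent local events, of probability bounded below, some event occurs
(`spectralGap_pos_of_events`).

**Clearing a region.** All legal paths come from one lemma, `reach_update_of_supply`. Rank the sites
of a finite region. If each vacancy of the region can be supplied, through sites of smaller rank and
from a source outside of the region, with a vacancy of its own type next to it, then the region can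
be made neutral in the order of the ranks, and then the state of the site on top can be changed. As
sources serve the corners of a cube that is otherwise neutral (`SourcePattern`): an `h`-vacancy at
the corner opposite to the propagation directions of `h` can be moved along the edges of the cube.

**A common direction.** If a coordinate is the same for all `h ∈ G`, then all vacancies propagate in
a common direction, and a line that leaves a source pattern in this direction can be cleared
(`SourcePattern.reach_line`).

**Stars.** If no coordinate is constant on `G` and `G` is in the ball of radius one around `c`, then
in two signed axes, those in which `c` propagates, there is one exceptional type each: all types but
`a` propagate along the first axis and all types but `b` along the second one (`Crossing`). In the
plane of these axes, consider a source pattern and the quadrant in front of it. Types other than `a`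
and `b` are supplied by monotone paths from the source. An `a`-vacancy moves only to the left and
upwards, so that the source can supply it only to the first column. Further to the right the
`a`-vacancies of the environment are used as sources: on each line choose the first `a`-vacancy
beyond the one chosen on the preceding line, and freeze it. The frozen vacancies form a staircase
(`Staircase`), and by the choice each `a`-vacancy to the left of the staircase either is directly
above a frozen one, or lies on a line such that the preceding line is still to the left of the
staircase there. In the latter case an `a`-vacancy can be brought below it, from a frozen one on its
right or from the first column (`Crossing.supply_below`). With the mirror image of this construction
for `b`, the region enclosed by both staircases can be cleared along its diagonal
(`Crossing.reach_of_staircases`). The staircases have to pass the position `n` of `x` on the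
diagonal, and to end before position `2 n`. For this the environment needs, on each line but the
last `M` before `x`, an `a`-vacancy beyond position `n` at a distance less than that of the line
from `x`, and, on each of `M` successive segments of `M` lines, a site without `a`-vacancy on a
shifted diagonal: it pushes the staircase away from the diagonal by one, so that the staircase is
ahead by `M` when the last `M` lines start (`exists_staircase`). All of these events are in the past
of `x` with respect to the sum of the two coordinates.
-/

noncomputable section

namespace MCEM

/-! ### Averaging operators on product spaces -/

section Averaging

variable {ι S : Type*} [DecidableEq ι] [Fintype S]

/-- Resampling of the coordinate `y` from the weights `w`, as a linear operator on functions of the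
configuration. -/
def siteAvg (w : S → ℝ) (y : ι) : Module.End ℝ ((ι → S) → ℝ) where
  toFun f ω := ∑ s, w s * f (Function.update ω y s)
  map_add' f g := by
    funext ω
    simp [mul_add, Finset.sum_add_distrib]
  map_smul' c f := by
    funext ω
    simp only [Pi.smul_apply, smul_eq_mul, RingHom.id_apply, Finset.mul_sum]
    exact Finset.sum_congr rfl fun s _ => by ring

lemma siteAvg_apply (w : S → ℝ) (y : ι) (f : (ι → S) → ℝ) (ω : ι → S) :
    siteAvg w y f ω = ∑ s, w s * f (Function.update ω y s) := rfl

lemma siteAvg_commute (w : S → ℝ) (x y : ι) : Commute (siteAvg w x) (siteAvg w y) := by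
  rcases eq_or_ne x y with rfl | hxy
  · exact Commute.refl _
  refine LinearMap.ext fun f => funext fun ω => ?_
  simp only [Module.End.mul_apply, siteAvg_apply, Finset.mul_sum]
  rw [Finset.sum_comm]
  refine Finset.sum_congr rfl fun s _ => Finset.sum_congr rfl fun t _ => ?_
  rw [Function.update_comm hxy]
  ring

/-- Resampling of all coordinates in a finite set. -/
def setAvg (w : S → ℝ) (A : Finset ι) : Module.End ℝ ((ι → S) → ℝ) :=
  A.noncommProd (siteAvg w) fun x _ y _ _ => siteAvg_commute w x y

@[simp] lemma setAvg_empty (w : S → ℝ) (f : (ι → S) → ℝ) : setAvg w ∅ f = f := rfl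

lemma setAvg_insert (w : S → ℝ) {A : Finset ι} {y : ι} (hy : y ∉ A) (f : (ι → S) → ℝ) :
    setAvg w (insert y A) f = siteAvg w y (setAvg w A f) :=
  LinearMap.congr_fun (Finset.noncommProd_insert_of_notMem A y (siteAvg w)
    (fun x _ z _ _ => siteAvg_commute w x z) hy) f

lemma siteAvg_setAvg_comm (w : S → ℝ) (A : Finset ι) (y : ι) (f : (ι → S) → ℝ) :
    siteAvg w y (setAvg w A f) = setAvg w A (siteAvg w y f) :=
  LinearMap.congr_fun
    (Finset.noncommProd_commute A (siteAvg w) _ _ fun x _ => siteAvg_commute w y x).eq f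

lemma setAvg_union (w : S → ℝ) {A B : Finset ι} (h : Disjoint A B) (f : (ι → S) → ℝ) :
    setAvg w (A ∪ B) f = setAvg w A (setAvg w B f) := by
  induction A using Finset.induction_on with
  | empty => simp
  | insert y A hy ih =>
    rw [Finset.disjoint_insert_left] at h
    rw [Finset.insert_union, setAvg_insert w (by simp [hy, h.1]), setAvg_insert w hy, ih h.2]

lemma dependsOn_siteAvg {w : S → ℝ} {y : ι} {f : (ι → S) → ℝ} {T : Set ι} (hf : DependsOn f T) :
    DependsOn (siteAvg w y f) (T \ {y}) := by
  intro ω η h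
  simp only [siteAvg_apply]
  refine Finset.sum_congr rfl fun s _ => ?_
  rw [hf]
  intro i hi
  rcases eq_or_ne i y with rfl | hiy
  · simp
  · simp [hiy, h i ⟨hi, hiy⟩]

lemma dependsOn_setAvg {w : S → ℝ} {A : Finset ι} {f : (ι → S) → ℝ} {T : Set ι}
    (hf : DependsOn f T) : DependsOn (setAvg w A f) (T \ A) := by
  induction A using Finset.induction_on with
  | empty => simpa
  | insert y A hy ih =>
    rw [setAvg_insert w hy]
    refine (dependsOn_siteAvg ih).mono fun i hi => ?_
    simp only [Set.mem_sdiff, Set.mem_singleton_iff, Finset.coe_insert, Set.mem_insert_iff,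
      Finset.mem_coe] at hi ⊢
    tauto

lemma dependsOn_setAvg_compl {w : S → ℝ} {A : Finset ι} (f : (ι → S) → ℝ) :
    DependsOn (setAvg w A f) (A : Set ι)ᶜ := by
  simpa [Set.compl_eq_univ_sdiff] using dependsOn_setAvg (w := w) (A := A) (dependsOn_univ f)

lemma siteAvg_mul_right {w : S → ℝ} {y : ι} {f g : (ι → S) → ℝ} (hg : DependsOn g {y}ᶜ) :
    siteAvg w y (f * g) = siteAvg w y f * g := by
  funext ω
  simp only [siteAvg_apply, Pi.mul_apply, Finset.sum_mul]
  refine Finset.sum_congr rfl fun s _ => ?_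
  rw [hg (x := Function.update ω y s) (y := ω) fun i hi => by
    rw [Function.update_of_ne]; exact hi]
  ring

lemma setAvg_mul_right {w : S → ℝ} {A : Finset ι} {f g : (ι → S) → ℝ}
    (hg : DependsOn g (A : Set ι)ᶜ) : setAvg w A (f * g) = setAvg w A f * g := by
  induction A using Finset.induction_on with
  | empty => simp
  | insert y A hy ih =>
    rw [setAvg_insert w hy, setAvg_insert w hy, ih (hg.mono (by simp)),
      siteAvg_mul_right (hg.mono (by simp))]

variable {w : S → ℝ}

lemma siteAvg_mono (hw : ∀ s, 0 ≤ w s) (y : ι) {f g : (ι → S) → ℝ} (h : f ≤ g) :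
    siteAvg w y f ≤ siteAvg w y g :=
  fun _ => Finset.sum_le_sum fun s _ => mul_le_mul_of_nonneg_left (h _) (hw s)

lemma setAvg_mono (hw : ∀ s, 0 ≤ w s) (A : Finset ι) {f g : (ι → S) → ℝ} (h : f ≤ g) :
    setAvg w A f ≤ setAvg w A g := by
  induction A using Finset.induction_on with
  | empty => simpa
  | insert y A hy ih =>
    rw [setAvg_insert w hy, setAvg_insert w hy]
    exact siteAvg_mono hw y ih

lemma setAvg_nonneg (hw : ∀ s, 0 ≤ w s) (A : Finset ι) {f : (ι → S) → ℝ} (h : 0 ≤ f) :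
    0 ≤ setAvg w A f := by
  simpa using setAvg_mono hw A h

lemma siteAvg_one (hw1 : ∑ s, w s = 1) (y : ι) : siteAvg w y (1 : (ι → S) → ℝ) = 1 := by
  funext ω
  simp [siteAvg_apply, hw1]

lemma setAvg_one (hw1 : ∑ s, w s = 1) (A : Finset ι) : setAvg w A (1 : (ι → S) → ℝ) = 1 := by
  induction A using Finset.induction_on with
  | empty => simp
  | insert y A hy ih => rw [setAvg_insert w hy, ih, siteAvg_one hw1]

lemma setAvg_eq_self (hw1 : ∑ s, w s = 1) {A : Finset ι} {f : (ι → S) → ℝ}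
    (hf : DependsOn f (A : Set ι)ᶜ) : setAvg w A f = f := by
  simpa [setAvg_one hw1] using setAvg_mul_right (w := w) (f := 1) hf

lemma siteAvg_eq_self (hw1 : ∑ s, w s = 1) {y : ι} {f : (ι → S) → ℝ}
    (hf : DependsOn f {y}ᶜ) : siteAvg w y f = f := by
  simpa [siteAvg_one hw1] using siteAvg_mul_right (w := w) (f := 1) hf

lemma dependsOn_siteAvg_compl (y : ι) (f : (ι → S) → ℝ) : DependsOn (siteAvg w y f) {y}ᶜ := by
  simpa [Set.compl_eq_univ_sdiff] using dependsOn_siteAvg (w := w) (y := y) (dependsOn_univ f)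

lemma setAvg_setAvg_of_subset (hw1 : ∑ s, w s = 1) {A B : Finset ι} (h : A ⊆ B)
    (f : (ι → S) → ℝ) : setAvg w B (setAvg w A f) = setAvg w B f := by
  have hB : B = (B \ A) ∪ A := (Finset.sdiff_union_of_subset h).symm
  rw [hB, setAvg_union w Finset.sdiff_disjoint, setAvg_union w Finset.sdiff_disjoint,
    setAvg_eq_self hw1 (dependsOn_setAvg_compl f)]

lemma setAvg_siteAvg_of_mem (hw1 : ∑ s, w s = 1) {B : Finset ι} {y : ι} (h : y ∈ B)
    (f : (ι → S) → ℝ) : setAvg w B (siteAvg w y f) = setAvg w B f := by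
  have := setAvg_setAvg_of_subset hw1 (Finset.singleton_subset_iff.2 h) f
  rwa [show ({y} : Finset ι) = insert y ∅ by simp, setAvg_insert w (by simp), setAvg_empty] at this

/-- Cauchy–Schwarz for the positive operators `setAvg`. -/
lemma setAvg_mul_sq_le (hw : ∀ s, 0 ≤ w s) (A : Finset ι) (f g : (ι → S) → ℝ) (ω : ι → S) :
    (setAvg w A (f * g) ω) ^ 2 ≤ setAvg w A (f ^ 2) ω * setAvg w A (g ^ 2) ω := by
  have key : ∀ t : ℝ, 0 ≤ setAvg w A (g ^ 2) ω * (t * t) + (2 * setAvg w A (f * g) ω) * t +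
      setAvg w A (f ^ 2) ω := by
    intro t
    have h := setAvg_nonneg hw A (f := (f + t • g) ^ 2) (fun η => sq_nonneg _) ω
    have e : (f + t • g) ^ 2 = f ^ 2 + (2 * t) • (f * g) + (t * t) • g ^ 2 := by
      funext η
      simp only [Pi.pow_apply, Pi.add_apply, Pi.smul_apply, smul_eq_mul, Pi.mul_apply]
      ring
    rw [e, map_add, map_add, map_smul, map_smul] at h
    simp only [Pi.add_apply, Pi.smul_apply, smul_eq_mul, Pi.zero_apply] at h
    linarith
  have := discrim_le_zero key
  rw [discrim] at this
  nlinarith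

/-- Jensen's inequality for the averaging operators. -/
lemma setAvg_sq_le (hw : ∀ s, 0 ≤ w s) (hw1 : ∑ s, w s = 1) (A : Finset ι) (f : (ι → S) → ℝ) :
    (setAvg w A f) ^ 2 ≤ setAvg w A (f ^ 2) := by
  intro ω
  have := setAvg_mul_sq_le hw A 1 f ω
  simpa [setAvg_one hw1] using this

/-- A finite-volume average of a nonnegative function dominates each of its values on the
configurations that agree outside the volume, up to the minimal weight. -/
lemma le_setAvg_of_eqOn_compl {δ : ℝ} (hδ : 0 ≤ δ) (hw : ∀ s, δ ≤ w s) (A : Finset ι)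
    {f : (ι → S) → ℝ} (hf : 0 ≤ f) {ω η : ι → S} (h : ∀ i ∉ A, η i = ω i) :
    δ ^ A.card * f η ≤ setAvg w A f ω := by
  have hw0 : ∀ s, 0 ≤ w s := fun s => hδ.trans (hw s)
  induction A using Finset.induction_on generalizing ω with
  | empty => simp [show η = ω from funext fun i => h i (by simp)]
  | insert y A hy ih =>
    rw [setAvg_insert w hy, siteAvg_apply, Finset.card_insert_of_notMem hy, pow_succ']
    have h1 : δ ^ A.card * f η ≤ setAvg w A f (Function.update ω y (η y)) := by
      refine ih fun i hi => ?_
      rcases eq_or_ne i y with rfl | hiy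
      · simp
      · simp [hiy, h i (by simp [hiy, hi])]
    calc δ * δ ^ A.card * f η = δ * (δ ^ A.card * f η) := by ring
      _ ≤ w (η y) * setAvg w A f (Function.update ω y (η y)) :=
        mul_le_mul (hw _) h1 (mul_nonneg (pow_nonneg hδ _) (hf _)) (hw0 _)
      _ ≤ _ := Finset.single_le_sum
        (f := fun s => w s * setAvg w A f (Function.update ω y s))
        (fun s _ => mul_nonneg (hw0 s) (setAvg_nonneg hw0 A hf _)) (Finset.mem_univ (η y))

/-- The probability that none of a family of independent local events occurs: each event `E t`
depends on the sites in `D t` and can be enforced by changing at most `k` sites. -/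
lemma setAvg_prod_not_le {δ : ℝ} (hδ : 0 ≤ δ) (hδ1 : δ ≤ 1) (hw : ∀ s, δ ≤ w s)
    (hw1 : ∑ s, w s = 1) {τ : Type*} [DecidableEq τ] (I : Finset τ) (D : τ → Finset ι)
    (E : τ → (ι → S) → ℝ) (k : ℕ) (A : Finset ι)
    (hA : ∀ t ∈ I, D t ⊆ A) (hD : ∀ t ∈ I, ∀ t' ∈ I, t ≠ t' → Disjoint (D t) (D t'))
    (hE : ∀ t ∈ I, DependsOn (E t) (D t : Set ι)) (hk : ∀ t ∈ I, (D t).card ≤ k)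
    (hE0 : ∀ t ∈ I, 0 ≤ E t) (hE1 : ∀ t ∈ I, E t ≤ 1)
    (hex : ∀ t ∈ I, ∀ ω : ι → S, ∃ η : ι → S, (∀ i ∉ D t, η i = ω i) ∧ E t η = 1) :
    setAvg w A (∏ t ∈ I, (1 - E t)) ≤ fun _ => (1 - δ ^ k) ^ I.card := by
  have hw0 : ∀ s, 0 ≤ w s := fun s => hδ.trans (hw s)
  have hρ : 0 ≤ 1 - δ ^ k := sub_nonneg.2 (pow_le_one₀ hδ hδ1)
  induction I using Finset.induction_on with
  | empty => simp [setAvg_one hw1]; exact le_rfl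
  | insert t I ht ih =>
    have ih' := ih (fun s hs => hA s (by simp [hs]))
      (fun s hs s' hs' => hD s (by simp [hs]) s' (by simp [hs']))
      (fun s hs => hE s (by simp [hs])) (fun s hs => hk s (by simp [hs]))
      (fun s hs => hE0 s (by simp [hs])) (fun s hs => hE1 s (by simp [hs]))
      (fun s hs => hex s (by simp [hs]))
    have htm : t ∈ insert t I := by simp
    set F := ∏ s ∈ I, (1 - E s) with hF
    have hF0 : 0 ≤ F := by
      rw [hF]
      exact Finset.prod_nonneg fun s hs => sub_nonneg.2 (hE1 s (by simp [hs]))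
    have hFdep : DependsOn F (D t : Set ι)ᶜ := by
      intro ω η h
      simp only [hF, Finset.prod_apply, Pi.sub_apply, Pi.one_apply]
      refine Finset.prod_congr rfl fun s hs => ?_
      rw [hE s (by simp [hs]) fun i hi => h i ?_]
      intro hi'
      exact Finset.disjoint_left.1 (hD s (by simp [hs]) t htm (by rintro rfl; exact ht hs)) hi hi'
    have h1 : setAvg w (D t) (1 - E t) ≤ fun _ => 1 - δ ^ k := by
      intro ω
      obtain ⟨η, hη, hη1⟩ := hex t htm ω
      have := le_setAvg_of_eqOn_compl hδ hw (D t) (hE0 t htm) hη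
      rw [hη1, mul_one] at this
      have h2 : δ ^ k ≤ δ ^ (D t).card := pow_le_pow_of_le_one hδ hδ1 (hk t htm)
      rw [map_sub, setAvg_one hw1]
      simp only [Pi.sub_apply, Pi.one_apply]
      linarith
    have h2 : setAvg w (D t) ((1 - E t) * F) ≤ (1 - δ ^ k) • F := by
      rw [setAvg_mul_right hFdep]
      intro ω
      exact mul_le_mul_of_nonneg_right (h1 ω) (hF0 ω)
    rw [Finset.prod_insert ht, ← setAvg_setAvg_of_subset hw1 (hA t htm)]
    refine (setAvg_mono hw0 A h2).trans ?_
    rw [map_smul, Finset.card_insert_of_notMem ht, pow_succ']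
    intro ω
    exact mul_le_mul_of_nonneg_left (ih' ω) hρ

end Averaging

/-! ### The constrained Poincaré inequality -/

section ConstrainedPoincare

variable {ι S : Type*} [DecidableEq ι] [Fintype S] {w : S → ℝ}

lemma setAvg_mul_siteAvg (hw1 : ∑ s, w s = 1) {B : Finset ι} {y : ι} (hy : y ∈ B)
    (f g : (ι → S) → ℝ) :
    setAvg w B (f * siteAvg w y g) = setAvg w B (siteAvg w y f * siteAvg w y g) := by
  rw [← setAvg_siteAvg_of_mem hw1 hy (f * siteAvg w y g),
    siteAvg_mul_right (dependsOn_siteAvg_compl y g)]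

/-- Pythagoras for the orthogonal projection `siteAvg`. -/
lemma setAvg_sub_siteAvg_sq (hw1 : ∑ s, w s = 1) {B : Finset ι} {y : ι} (hy : y ∈ B)
    (f : (ι → S) → ℝ) :
    setAvg w B ((f - siteAvg w y f) ^ 2) =
      setAvg w B (f ^ 2) - setAvg w B ((siteAvg w y f) ^ 2) := by
  have e : (f - siteAvg w y f) ^ 2 =
      f ^ 2 - (2 : ℝ) • (f * siteAvg w y f) + (siteAvg w y f) ^ 2 := by
    funext η
    simp only [Pi.pow_apply, Pi.sub_apply, Pi.add_apply, Pi.smul_apply, smul_eq_mul, Pi.mul_apply]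
    ring
  rw [e, map_add, map_sub, map_smul, setAvg_mul_siteAvg hw1 hy, ← pow_two, two_smul]
  abel

lemma setAvg_sq_setAvg_le (hw : ∀ s, 0 ≤ w s) (hw1 : ∑ s, w s = 1) {A B : Finset ι} (h : A ⊆ B)
    (f : (ι → S) → ℝ) : setAvg w B ((setAvg w A f) ^ 2) ≤ setAvg w B (f ^ 2) := by
  rw [← setAvg_setAvg_of_subset hw1 h (f ^ 2)]
  exact setAvg_mono hw B (setAvg_sq_le hw hw1 A f)

lemma setAvg_sub_siteAvg_sq_le (hw : ∀ s, 0 ≤ w s) (hw1 : ∑ s, w s = 1) {B : Finset ι} {y : ι}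
    (hy : y ∈ B) (f : (ι → S) → ℝ) :
    setAvg w B ((f - siteAvg w y f) ^ 2) ≤ setAvg w B (f ^ 2) := by
  rw [setAvg_sub_siteAvg_sq hw1 hy]
  exact sub_le_self _ (setAvg_nonneg hw B fun η => sq_nonneg _)

/-- The more coordinates have been averaged out, the smaller is the remaining variance at `y`. -/
lemma setAvg_variance_anti (hw : ∀ s, 0 ≤ w s) (hw1 : ∑ s, w s = 1) {T T' B : Finset ι} {y : ι}
    (hT : T ⊆ T') (hB : T' ⊆ B) (f : (ι → S) → ℝ) :
    setAvg w B ((setAvg w T' f - siteAvg w y (setAvg w T' f)) ^ 2) ≤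
      setAvg w B ((setAvg w T f - siteAvg w y (setAvg w T f)) ^ 2) := by
  have e : setAvg w T' f - siteAvg w y (setAvg w T' f) =
      setAvg w (T' \ T) (setAvg w T f - siteAvg w y (setAvg w T f)) := by
    rw [map_sub, ← siteAvg_setAvg_comm, ← setAvg_union w Finset.sdiff_disjoint,
      Finset.sdiff_union_of_subset hT]
  rw [e]
  exact setAvg_sq_setAvg_le hw hw1 (Finset.sdiff_subset.trans hB) _

variable {α : Type*} [LinearOrder α] {r : ι → α}

/-- The martingale decomposition of the variance, revealing the sites in decreasing order. -/
lemma setAvg_variance_eq_sum (hw1 : ∑ s, w s = 1) (hr : Function.Injective r) {A B : Finset ι}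
    (h : A ⊆ B) (f : (ι → S) → ℝ) :
    setAvg w B (f ^ 2) - setAvg w B ((setAvg w A f) ^ 2) =
      ∑ y ∈ A, setAvg w B ((setAvg w (A.filter fun z => r z < r y) f -
        siteAvg w y (setAvg w (A.filter fun z => r z < r y) f)) ^ 2) := by
  induction A using Finset.induction_on_max_value r with
  | empty => simp
  | insert m A hm hmax ih =>
    have hlt : ∀ z ∈ A, r z < r m := fun z hz =>
      lt_of_le_of_ne (hmax z hz) fun e => hm (hr e ▸ hz)
    have h1 : (insert m A).filter (fun z => r z < r m) = A := by
      ext z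
      simp only [Finset.mem_filter, Finset.mem_insert]
      constructor
      · rintro ⟨rfl | hz, hz'⟩
        · exact absurd hz' (lt_irrefl _)
        · exact hz
      · exact fun hz => ⟨Or.inr hz, hlt z hz⟩
    have h2 : ∀ y ∈ A, (insert m A).filter (fun z => r z < r y) =
        A.filter fun z => r z < r y := by
      intro y hy
      rw [Finset.filter_insert, if_neg (not_lt.2 (hmax y hy))]
    rw [Finset.sum_insert hm, h1, setAvg_insert w hm,
      setAvg_sub_siteAvg_sq hw1 (h (Finset.mem_insert_self _ _)),
      Finset.sum_congr rfl fun y hy => by rw [h2 y hy],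
      ← ih ((Finset.subset_insert _ _).trans h)]
    abel

/-- **Constrained Poincaré inequality.** For every site `x` let `c x` be the indicator of an event
that depends on the finite set `Δ x` of sites preceding `x`, and that fails with probability at most
`ε`. If `ε` is small compared with the number of sites in `Δ x`, then the variance is bounded by the
sum of the local variances on the events. -/
theorem constrained_poincare (hw : ∀ s, 0 ≤ w s) (hw1 : ∑ s, w s = 1)
    (hr : Function.Injective r) (Λ B : Finset ι) (hΛ : Λ ⊆ B) (f : (ι → S) → ℝ)
    (hf : DependsOn f (Λ : Set ι)) (Δ : ι → Finset ι) (hΔr : ∀ x, ∀ y ∈ Δ x, r y < r x)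
    (hΔB : ∀ x ∈ Λ, Δ x ⊆ B) (c : ι → (ι → S) → ℝ) (hc01 : ∀ x ω, c x ω = 0 ∨ c x ω = 1)
    (hc : ∀ x, DependsOn (c x) (Δ x : Set ι)) (ε : ℝ)
    (hε : ∀ x, setAvg w (Δ x) (1 - c x) ≤ fun _ => ε) (N : ℕ)
    (hN : ∀ y, (Λ.filter fun x => y ∈ insert x (Δ x)).card ≤ N) (hεN : 4 * ε * N ≤ 1)
    (o : ι → S) :
    setAvg w B (f ^ 2) o - (setAvg w B f o) ^ 2 ≤
      4 * ∑ x ∈ Λ, setAvg w B (c x * (f - siteAvg w x f) ^ 2) o := by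
  -- `V y` is the mean square of the martingale increment at `y`, and `P y` is the past of `y`
  set P : ι → Finset ι := fun x => B.filter fun z => r z < r x with hP
  set V : ι → ℝ := fun y => setAvg w B ((setAvg w (P y) f - siteAvg w y (setAvg w (P y) f)) ^ 2) o
    with hV
  have hVnn : ∀ y, 0 ≤ V y := fun y => setAvg_nonneg hw B (fun η => sq_nonneg _) o
  have hPB : ∀ y, P y ⊆ B := fun y => Finset.filter_subset _ _
  have hε0 : 0 ≤ ε ∨ Λ = ∅ := by
    rcases Λ.eq_empty_or_nonempty with h | ⟨x, -⟩
    · exact Or.inr h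
    · refine Or.inl ((setAvg_nonneg hw (Δ x) (f := 1 - c x) ?_ o).trans (hε x o))
      intro η
      rcases hc01 x η with h | h <;> simp [h]
  -- the variance is the sum of the `V y`
  have hvar : setAvg w B (f ^ 2) o - (setAvg w B f o) ^ 2 = ∑ y ∈ Λ, V y := by
    have h1 := congrFun (setAvg_variance_eq_sum (w := w) hw1 hr (Finset.Subset.refl B) f) o
    have h2 : setAvg w B ((setAvg w B f) ^ 2) = (setAvg w B f) ^ 2 := by
      refine setAvg_eq_self hw1 ?_
      intro ω η h
      simp only [Pi.pow_apply]
      rw [dependsOn_setAvg_compl f h]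
    rw [h2] at h1
    simp only [Pi.sub_apply, Pi.pow_apply, Finset.sum_apply] at h1
    rw [h1]
    refine (Finset.sum_subset hΛ fun y _ hyΛ => ?_).symm
    have h3 : siteAvg w y f = f := siteAvg_eq_self hw1 (hf.mono fun i hi => by
      rintro rfl
      exact hyΛ hi)
    simp only [siteAvg_setAvg_comm, h3, sub_self, zero_pow two_ne_zero, map_zero, Pi.zero_apply]
  have hsumV : ∀ x ∈ Λ, V x ≤ 2 * setAvg w B (c x * (f - siteAvg w x f) ^ 2) o +
      2 * (ε * ∑ y ∈ insert x (Δ x), V y) := by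
    intro x hx
    have hxB := hΛ hx
    have hε0 : 0 ≤ ε := hε0.resolve_right (Finset.ne_empty_of_mem hx)
    have hΔP : Δ x ⊆ P x := fun y hy => Finset.mem_filter.2 ⟨hΔB x hx hy, hΔr x y hy⟩
    have hxΔ : x ∉ Δ x := fun h => lt_irrefl _ (hΔr x x h)
    set R := P x \ Δ x with hR
    have hRB : R ⊆ B := Finset.sdiff_subset.trans (hPB x)
    have hxR : x ∉ R := fun h => lt_irrefl _ (Finset.mem_filter.1 (Finset.sdiff_subset h)).2
    have hPR : P x = Δ x ∪ R := (Finset.union_sdiff_of_subset hΔP).symm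
    have hcx : DependsOn (c x) ({x} : Set ι)ᶜ := (hc x).mono fun i hi => by
      rintro rfl
      exact hxΔ hi
    set g := setAvg w R f with hg
    set k := setAvg w (insert x (Δ x)) g with hk
    -- on the complement of the event the averages over `R` pass through the indicator
    have hR1 : setAvg w R ((1 - c x) * f) = (1 - c x) * g := by
      rw [mul_comm, setAvg_mul_right, mul_comm]
      intro ω η h
      simp only [Pi.sub_apply, Pi.one_apply]
      rw [hc x fun i hi => h i fun hi' => (Finset.mem_sdiff.1 hi').2 hi]
    have hkdep : DependsOn k (↑(insert x (Δ x)) : Set ι)ᶜ := dependsOn_setAvg_compl g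
    have hk0 : setAvg w (Δ x) ((1 - c x) * k) -
        siteAvg w x (setAvg w (Δ x) ((1 - c x) * k)) = 0 := by
      rw [setAvg_mul_right (hkdep.mono (by simp)), siteAvg_eq_self hw1, sub_self]
      intro ω η h
      simp only [Pi.mul_apply]
      have h1 : DependsOn (1 - c x) ({x} : Set ι)ᶜ := fun ω η h => by
        simp only [Pi.sub_apply, Pi.one_apply]
        rw [hcx h]
      rw [(dependsOn_setAvg (A := Δ x) (w := w) h1).mono Set.sdiff_subset h,
        hkdep fun i hi => h i ?_]
      simp only [Finset.coe_insert, Set.mem_compl_iff, Set.mem_insert_iff, not_or] at hi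
      exact hi.1
    -- split the increment at `x` into the parts on the event and on its complement; since `c x`
    -- does not depend on `x`, one may subtract from `g` its average `k` over `x` and `Δ x` in the
    -- latter
    have hsplit : setAvg w (P x) f - siteAvg w x (setAvg w (P x) f) =
        setAvg w (P x) (c x * (f - siteAvg w x f)) +
        (setAvg w (Δ x) ((1 - c x) * (g - k)) -
          siteAvg w x (setAvg w (Δ x) ((1 - c x) * (g - k)))) := by
      have e1 : setAvg w (Δ x) ((1 - c x) * (g - k)) -
          siteAvg w x (setAvg w (Δ x) ((1 - c x) * (g - k))) =
          setAvg w (P x) ((1 - c x) * f) - siteAvg w x (setAvg w (P x) ((1 - c x) * f)) := by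
        rw [mul_sub, map_sub, map_sub, sub_sub_sub_comm, hk0, sub_zero, ← hR1, hPR,
          setAvg_union w Finset.disjoint_sdiff]
      have e2 : c x * (f - siteAvg w x f) = c x * f - siteAvg w x (c x * f) := by
        rw [mul_comm (c x) f, siteAvg_mul_right hcx]
        ring
      have e3 : setAvg w (P x) f = setAvg w (P x) (c x * f) + setAvg w (P x) ((1 - c x) * f) := by
        rw [← map_add]
        congr 1
        ring
      rw [e1, e2, map_sub, ← siteAvg_setAvg_comm, e3, map_add]
      abel
    have hsq : V x ≤ 2 * setAvg w B ((setAvg w (P x) (c x * (f - siteAvg w x f))) ^ 2) o +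
        2 * setAvg w B ((setAvg w (Δ x) ((1 - c x) * (g - k)) -
          siteAvg w x (setAvg w (Δ x) ((1 - c x) * (g - k)))) ^ 2) o := by
      have := setAvg_mono hw B (f := (setAvg w (P x) f - siteAvg w x (setAvg w (P x) f)) ^ 2)
        (g := (2 : ℝ) • (setAvg w (P x) (c x * (f - siteAvg w x f))) ^ 2 +
          (2 : ℝ) • (setAvg w (Δ x) ((1 - c x) * (g - k)) -
          siteAvg w x (setAvg w (Δ x) ((1 - c x) * (g - k)))) ^ 2) (by
          rw [hsplit]
          intro η
          simp only [Pi.pow_apply, Pi.add_apply, Pi.smul_apply, smul_eq_mul]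
          nlinarith [sq_nonneg ((setAvg w (P x) (c x * (f - siteAvg w x f))) η -
            (setAvg w (Δ x) ((1 - c x) * (g - k)) -
            siteAvg w x (setAvg w (Δ x) ((1 - c x) * (g - k)))) η)]) o
      rw [map_add, map_smul, map_smul] at this
      exact this
    have hfirst : setAvg w B ((setAvg w (P x) (c x * (f - siteAvg w x f))) ^ 2) o ≤
        setAvg w B (c x * (f - siteAvg w x f) ^ 2) o := by
      have e : (c x * (f - siteAvg w x f)) ^ 2 = c x * (f - siteAvg w x f) ^ 2 := by
        funext η
        rcases hc01 x η with h | h <;> simp [h]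
      rw [← e]
      exact setAvg_sq_setAvg_le hw hw1 (hPB x) _ o
    -- by Cauchy–Schwarz, the failure of the event only contributes a factor `ε`
    have hsecond : setAvg w B ((setAvg w (Δ x) ((1 - c x) * (g - k)) -
          siteAvg w x (setAvg w (Δ x) ((1 - c x) * (g - k)))) ^ 2) o ≤
        ε * ∑ y ∈ insert x (Δ x), V y := by
      have h1 : setAvg w B ((setAvg w (Δ x) ((1 - c x) * (g - k))) ^ 2) o ≤
          ε * setAvg w B ((g - k) ^ 2) o := by
        have h2 : (setAvg w (Δ x) ((1 - c x) * (g - k))) ^ 2 ≤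
            ε • setAvg w (Δ x) ((g - k) ^ 2) := by
          intro η
          refine (setAvg_mul_sq_le hw (Δ x) (1 - c x) (g - k) η).trans ?_
          have e : (1 - c x) ^ 2 = 1 - c x := by
            funext ξ
            rcases hc01 x ξ with h | h <;> simp [h]
          rw [e]
          exact mul_le_mul_of_nonneg_right (hε x η)
            (setAvg_nonneg hw _ (fun ξ => sq_nonneg _) η)
        have h3 := setAvg_mono hw B h2 o
        rwa [map_smul, setAvg_setAvg_of_subset hw1 (hΔB x hx)] at h3
      refine (setAvg_sub_siteAvg_sq_le hw hw1 hxB _ o).trans (h1.trans ?_)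
      refine mul_le_mul_of_nonneg_left ?_ hε0
      have hIB : insert x (Δ x) ⊆ B := Finset.insert_subset hxB (hΔB x hx)
      -- the variance of `g` in `x` and `Δ x` splits again into martingale increments
      have e4 : setAvg w B ((g - k) ^ 2) =
          setAvg w B (g ^ 2) - setAvg w B (k ^ 2) := by
        have h5 : setAvg w B (g * k) = setAvg w B (k ^ 2) := by
          rw [← setAvg_setAvg_of_subset hw1 hIB (g * k), setAvg_mul_right hkdep, ← hk, pow_two]
        have e : (g - k) ^ 2 = g ^ 2 - (2 : ℝ) • (g * k) + k ^ 2 := by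
          funext η
          simp only [Pi.pow_apply, Pi.sub_apply, Pi.add_apply, Pi.smul_apply, smul_eq_mul,
            Pi.mul_apply]
          ring
        rw [e, map_add, map_sub, map_smul, h5, two_smul]
        abel
      rw [e4, hk, setAvg_variance_eq_sum hw1 hr hIB g, Finset.sum_apply]
      refine Finset.sum_le_sum fun y hy => ?_
      set T := (insert x (Δ x)).filter fun z => r z < r y with hT
      have hyx : r y ≤ r x := by
        rcases Finset.mem_insert.1 hy with rfl | hy
        · exact le_rfl
        · exact (hΔr x y hy).le
      have hTΔ : T ⊆ Δ x := by
        intro z hz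
        obtain ⟨hz1, hz2⟩ := Finset.mem_filter.1 hz
        rcases Finset.mem_insert.1 hz1 with rfl | h
        · exact absurd hyx (not_le.2 hz2)
        · exact h
      have hdisj : Disjoint T R :=
        Finset.disjoint_left.2 fun z hz hz' => (Finset.mem_sdiff.1 hz').2 (hTΔ hz)
      rw [hg, ← setAvg_union w hdisj]
      refine setAvg_variance_anti hw hw1 ?_ ?_ f o
      · intro z hz
        obtain ⟨hzB, hzy⟩ := Finset.mem_filter.1 hz
        have hzx : z ∈ P x := Finset.mem_filter.2 ⟨hzB, hzy.trans_le hyx⟩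
        by_cases hzΔ : z ∈ Δ x
        · exact Finset.mem_union_left _ (Finset.mem_filter.2 ⟨Finset.mem_insert_of_mem hzΔ, hzy⟩)
        · exact Finset.mem_union_right _ (Finset.mem_sdiff.2 ⟨hzx, hzΔ⟩)
      · exact Finset.union_subset (hTΔ.trans (hΔB x hx)) hRB
    linarith
  -- every `V y` is counted at most `N` times
  have hcount : ∑ x ∈ Λ, ∑ y ∈ insert x (Δ x), V y ≤ N * ∑ y ∈ Λ, V y := by
    have hVΛ : ∀ y, y ∉ Λ → V y = 0 := by
      intro y hyΛ
      have h3 : siteAvg w y f = f := siteAvg_eq_self hw1 (hf.mono fun i hi => by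
        rintro rfl
        exact hyΛ hi)
      simp only [hV, siteAvg_setAvg_comm, h3, sub_self, zero_pow two_ne_zero, map_zero,
        Pi.zero_apply]
    calc ∑ x ∈ Λ, ∑ y ∈ insert x (Δ x), V y
        = ∑ x ∈ Λ, ∑ y ∈ Λ, if y ∈ insert x (Δ x) then V y else 0 := by
          refine Finset.sum_congr rfl fun x _ => ?_
          rw [← Finset.sum_filter, Finset.filter_mem_eq_inter, Finset.inter_comm,
            ← Finset.filter_mem_eq_inter, Finset.sum_filter]
          refine Finset.sum_congr rfl fun y _ => ?_
          split_ifs with h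
          · rfl
          · exact hVΛ y h
      _ = ∑ y ∈ Λ, ((Λ.filter fun x => y ∈ insert x (Δ x)).card : ℝ) * V y := by
          rw [Finset.sum_comm]
          refine Finset.sum_congr rfl fun y _ => ?_
          rw [← Finset.sum_filter, Finset.sum_const, nsmul_eq_mul]
      _ ≤ ∑ y ∈ Λ, (N : ℝ) * V y := Finset.sum_le_sum fun y _ =>
          mul_le_mul_of_nonneg_right (by exact_mod_cast hN y) (hVnn y)
      _ = _ := by rw [Finset.mul_sum]
  rw [hvar]
  rcases hε0 with hε0 | rfl
  swap
  · simp
  have h1 := Finset.sum_le_sum hsumV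
  rw [Finset.sum_add_distrib, ← Finset.mul_sum, ← Finset.mul_sum, ← Finset.mul_sum] at h1
  have h2 : ε * ∑ x ∈ Λ, ∑ y ∈ insert x (Δ x), V y ≤ ε * (N * ∑ y ∈ Λ, V y) :=
    mul_le_mul_of_nonneg_left hcount hε0
  have h3 : 0 ≤ ∑ y ∈ Λ, V y := Finset.sum_nonneg fun y _ => hVnn y
  nlinarith

end ConstrainedPoincare

/-! ### Local functions and the equilibrium measure -/

section Equilibrium

variable {d : ℕ} {G : Finset (Lattice d)}

/-- The equilibrium density of a vertex state. -/
def ParameterSet.weight (Q : ParameterSet G) (s : State G) : ℝ := Option.elim s Q.p Q.q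

@[simp] lemma ParameterSet.weight_neutral (Q : ParameterSet G) : Q.weight neutral = Q.p := rfl

@[simp] lemma ParameterSet.weight_vacancy (Q : ParameterSet G) (h : G) :
    Q.weight (vacancy h) = Q.q h := rfl

lemma State.cases (s : State G) : s = neutral ∨ ∃ h, s = vacancy h := by
  cases s with
  | none => exact Or.inl rfl
  | some h => exact Or.inr ⟨h, rfl⟩

@[simp] lemma vacancy_ne_neutral (h : G) : vacancy h ≠ (neutral : State G) := Option.some_ne_none h

@[simp] lemma neutral_ne_vacancy (h : G) : (neutral : State G) ≠ vacancy h :=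
  (vacancy_ne_neutral h).symm

@[simp] lemma vacancy_inj {h h' : G} : (vacancy h : State G) = vacancy h' ↔ h = h' :=
  Option.some_inj

lemma sum_state (φ : State G → ℝ) : ∑ s, φ s = φ neutral + ∑ h, φ (vacancy h) :=
  Fintype.sum_option φ

lemma ParameterSet.weight_pos (Q : ParameterSet G) (s : State G) : 0 < Q.weight s := by
  rcases s.cases with rfl | ⟨h, rfl⟩
  · exact Q.p_pos
  · exact Q.q_pos h

lemma ParameterSet.weight_nonneg (Q : ParameterSet G) (s : State G) : 0 ≤ Q.weight s :=
  (Q.weight_pos s).le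

lemma ParameterSet.sum_weight (Q : ParameterSet G) : ∑ s, Q.weight s = 1 := by
  rw [sum_state]
  simp [ParameterSet.p]

lemma ParameterSet.integral_nu (Q : ParameterSet G) (φ : State G → ℝ) :
    ∫ s, φ s ∂Q.nu = ∑ s, Q.weight s * φ s := by
  have hint : ∀ (m : Measure (State G)) [IsFiniteMeasure m], Integrable φ m := fun m _ =>
    Integrable.of_finite
  have : ∀ x : State G, ∀ c : ℝ, IsFiniteMeasure (ENNReal.ofReal c • Measure.dirac x) :=
    fun x c => Measure.smul_finite _ ENNReal.ofReal_ne_top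
  rw [ParameterSet.nu, integral_add_measure (hint _)
    (integrable_finsetSum_measure.2 fun h _ => hint _),
    integral_finsetSum_measure fun h _ => hint _, sum_state]
  simp only [integral_smul_measure, integral_dirac, smul_eq_mul, weight_neutral, weight_vacancy,
    ENNReal.toReal_ofReal Q.p_pos.le, ENNReal.toReal_ofReal (Q.q_pos _).le]

instance (Q : ParameterSet G) : IsProbabilityMeasure Q.mu := by
  unfold ParameterSet.mu
  infer_instance

instance : MeasurableSingletonClass (State G) := ⟨fun _ => trivial⟩

lemma IsLocal.exists_comp_restrict {f : Config G → ℝ} (hf : IsLocal f) :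
    ∃ (Λ : Finset (Lattice d)) (g : (Λ → State G) → ℝ), f = g ∘ Λ.restrict := by
  obtain ⟨Λ, hΛ⟩ := hf
  refine ⟨Λ, fun σ => f fun i => if h : i ∈ Λ then σ ⟨i, h⟩ else neutral, ?_⟩
  funext ω
  refine hΛ fun i hi => ?_
  rw [dif_pos (by simpa using hi)]
  rfl

lemma IsLocal.measurable {f : Config G → ℝ} (hf : IsLocal f) : Measurable f := by
  obtain ⟨Λ, g, rfl⟩ := hf.exists_comp_restrict
  exact (measurable_of_finite g).comp (Finset.measurable_restrict Λ)

lemma IsLocal.bounded {f : Config G → ℝ} (hf : IsLocal f) : ∃ C, ∀ ω, ‖f ω‖ ≤ C := by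
  obtain ⟨Λ, g, rfl⟩ := hf.exists_comp_restrict
  obtain ⟨C, hC⟩ := (Set.finite_range fun σ => ‖g σ‖).bddAbove
  exact ⟨C, fun ω => hC ⟨_, rfl⟩⟩

lemma IsLocal.memLp {f : Config G → ℝ} (hf : IsLocal f) (Q : ParameterSet G) (p : ℝ≥0∞) :
    MemLp f p Q.mu := by
  obtain ⟨C, hC⟩ := hf.bounded
  exact MemLp.of_bound hf.measurable.aestronglyMeasurable C (Eventually.of_forall hC)

lemma IsLocal.integrable {f : Config G → ℝ} (hf : IsLocal f) (Q : ParameterSet G) :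
    Integrable f Q.mu := memLp_one_iff_integrable.1 (hf.memLp Q 1)

lemma measurable_update_prod (y : Lattice d) :
    Measurable fun z : State G × Config G => Function.update z.2 y z.1 := by
  refine measurable_pi_lambda _ fun i => ?_
  rcases eq_or_ne i y with rfl | hi
  · simpa using measurable_fst
  · simp only [Function.update_of_ne hi]
    exact (measurable_pi_apply i).comp measurable_snd

/-- The equilibrium measure is invariant under the resampling of a vertex. -/
lemma ParameterSet.map_update_mu (Q : ParameterSet G) (y : Lattice d) :
    (Q.nu.prod Q.mu).map (fun z : State G × Config G => Function.update z.2 y z.1) = Q.mu := by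
  have hm := measurable_update_prod (G := G) y
  refine Measure.eq_infinitePi _ fun s t ht => ?_
  rw [Measure.map_apply hm (MeasurableSet.pi s.countable_toSet fun i _ => ht i)]
  have e : (fun z : State G × Config G => Function.update z.2 y z.1) ⁻¹' (Set.pi s t) =
      (if y ∈ s then t y else Set.univ) ×ˢ (Set.pi (s.erase y) t) := by
    ext ⟨a, ω⟩
    simp only [Set.mem_preimage, Set.mem_pi, Finset.mem_coe, Set.mem_prod, Finset.mem_erase]
    constructor
    · intro h
      constructor
      · split_ifs with hy
        · simpa using h y hy
        · trivial
      · intro i hi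
        simpa [hi.1] using h i hi.2
    · rintro ⟨h1, h2⟩ i hi
      rcases eq_or_ne i y with rfl | hiy
      · simpa [hi] using h1
      · simpa [hiy] using h2 i ⟨hiy, hi⟩
  rw [e, Measure.prod_prod, ParameterSet.mu, Measure.infinitePi_pi _ fun i _ => ht i]
  split_ifs with hy
  · rw [Finset.mul_prod_erase s (fun i => Q.nu (t i)) hy]
  · rw [measure_univ, one_mul, Finset.erase_eq_of_notMem hy]

lemma ParameterSet.integral_siteAvg (Q : ParameterSet G) (y : Lattice d) {f : Config G → ℝ}
    (hf : IsLocal f) : ∫ ω, siteAvg Q.weight y f ω ∂Q.mu = ∫ ω, f ω ∂Q.mu := by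
  have hm := measurable_update_prod (G := G) y
  obtain ⟨C, hC⟩ := hf.bounded
  have hint : Integrable (fun z : State G × Config G => f (Function.update z.2 y z.1))
      (Q.nu.prod Q.mu) :=
    Integrable.of_bound (hf.measurable.comp hm).aestronglyMeasurable C
      (Eventually.of_forall fun z => hC _)
  nth_rewrite 2 [← Q.map_update_mu y]
  rw [integral_map hm.aemeasurable hf.measurable.aestronglyMeasurable,
    integral_prod_symm _ hint]
  refine integral_congr_ae (Eventually.of_forall fun ω => ?_)
  simp only [Q.integral_nu, siteAvg_apply]

lemma isLocal_setAvg {w : State G → ℝ} {A : Finset (Lattice d)} {f : Config G → ℝ}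
    (hf : IsLocal f) : IsLocal (setAvg w A f) := by
  obtain ⟨Λ, hΛ⟩ := hf
  exact ⟨Λ, (dependsOn_setAvg hΛ).mono Set.sdiff_subset⟩

lemma ParameterSet.integral_setAvg (Q : ParameterSet G) (A : Finset (Lattice d))
    {f : Config G → ℝ} (hf : IsLocal f) :
    ∫ ω, setAvg Q.weight A f ω ∂Q.mu = ∫ ω, f ω ∂Q.mu := by
  induction A using Finset.induction_on with
  | empty => simp
  | insert y A hy ih =>
    rw [setAvg_insert _ hy, Q.integral_siteAvg y (isLocal_setAvg hf), ih]

/-- Equilibrium expectations of local functions are finite-volume averages. -/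
lemma ParameterSet.setAvg_eq_integral (Q : ParameterSet G) {A : Finset (Lattice d)}
    {f : Config G → ℝ} (hf : DependsOn f (A : Set (Lattice d))) (ω : Config G) :
    setAvg Q.weight A f ω = ∫ η, f η ∂Q.mu := by
  rw [← Q.integral_setAvg A ⟨A, hf⟩]
  have h : ∀ η, setAvg Q.weight A f η = setAvg Q.weight A f ω := fun η =>
    dependsOn_setAvg hf fun i hi => absurd hi.1 hi.2
  simp [h]

/-- The smallest weight of a vertex state. -/
lemma ParameterSet.exists_weight_le (Q : ParameterSet G) :
    ∃ δ : ℝ, 0 < δ ∧ δ ≤ 1 ∧ ∀ s, δ ≤ Q.weight s := by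
  have : Nonempty (State G) := ⟨neutral⟩
  obtain ⟨s, hs⟩ := Finite.exists_min Q.weight
  refine ⟨Q.weight s, Q.weight_pos s, ?_, hs⟩
  rw [← Q.sum_weight]
  exact Finset.single_le_sum (f := Q.weight) (fun t _ => Q.weight_nonneg t) (Finset.mem_univ s)

end Equilibrium

/-! ### The generator on local functions -/

section Generator

variable {d : ℕ} {G : Finset (Lattice d)}

/-- The contribution to the Dirichlet form of the exchange of `h` and the neutral state at `x`. -/
def edgeEnergy (Q : ParameterSet G) (h : G) (x : Lattice d) (f : Config G → ℝ) (ω : Config G) : ℝ :=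
  constraint h x ω * (Q.p * Q.q h *
    (f (Function.update ω x (vacancy h)) - f (Function.update ω x neutral)) ^ 2)

lemma constraint_nonneg (h : G) (x : Lattice d) (ω : Config G) : 0 ≤ constraint h x ω := by
  unfold constraint
  split_ifs <;> norm_num

lemma edgeEnergy_nonneg (Q : ParameterSet G) (h : G) (x : Lattice d) (f : Config G → ℝ)
    (ω : Config G) : 0 ≤ edgeEnergy Q h x f ω :=
  mul_nonneg (constraint_nonneg _ _ _)
    (mul_nonneg (mul_nonneg Q.p_pos.le (Q.q_pos h).le) (sq_nonneg _))

lemma IsPropagation.abs_le_one {h v : Lattice d} (hv : IsPropagation h v) (i : Fin d) :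
    |v i| ≤ 1 := by
  rw [← hv.1]
  exact Finset.single_le_sum (f := fun i => |v i|) (fun i _ => abs_nonneg _) (Finset.mem_univ i)

lemma IsPropagation.ne_zero {h v : Lattice d} (hv : IsPropagation h v) : v ≠ 0 := by
  rintro rfl
  simpa using hv.1

lemma IsPropagation.sub_ne {h v : Lattice d} (hv : IsPropagation h v) (x : Lattice d) :
    x - v ≠ x := by
  simpa using hv.ne_zero

/-- The constraint at `x` depends on neighbours of `x` only. -/
lemma dependsOn_constraint (h : G) (x : Lattice d) :
    DependsOn (constraint h x) ((Finset.Icc (x - 1) (x + 1)).erase x : Set (Lattice d)) := by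
  intro ω η hωη
  have key : ∀ v, IsPropagation (h : Lattice d) v → ω (x - v) = η (x - v) := by
    intro v hv
    refine hωη _ ?_
    rw [Finset.coe_erase]
    refine ⟨?_, by simpa using hv.ne_zero⟩
    rw [Finset.coe_Icc]
    constructor <;> intro i <;> have := abs_le.1 (hv.abs_le_one i) <;>
      simp only [Pi.sub_apply, Pi.add_apply, Pi.one_apply] <;> linarith
  have e : (∃ v, IsPropagation (h : Lattice d) v ∧ ω (x - v) = vacancy h) ↔
      ∃ v, IsPropagation (h : Lattice d) v ∧ η (x - v) = vacancy h :=
    exists_congr fun v => and_congr_right fun hv => by rw [key v hv]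
  unfold constraint
  by_cases hc : ∃ v, IsPropagation (h : Lattice d) v ∧ ω (x - v) = vacancy h
  · rw [if_pos hc, if_pos (e.1 hc)]
  · rw [if_neg hc, if_neg fun hc' => hc (e.2 hc')]

lemma constraint_update (h : G) (x : Lattice d) (ω : Config G) (s : State G) :
    constraint h x (Function.update ω x s) = constraint h x ω :=
  dependsOn_constraint h x fun i hi => by
    rw [Function.update_of_ne]
    rw [Finset.coe_erase] at hi
    exact hi.2

lemma grad_eq_zero {f : Config G → ℝ} {Λ : Set (Lattice d)} (hf : DependsOn f Λ)
    (h : G) {x : Lattice d} (hx : x ∉ Λ) (ω : Config G) : grad h x f ω = 0 := by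
  have key : ∀ s, f (Function.update ω x s) = f ω := fun s => hf fun i hi => by
    rw [Function.update_of_ne]
    rintro rfl
    exact hx hi
  simp [grad, key]

lemma edgeEnergy_eq_zero (Q : ParameterSet G) {f : Config G → ℝ} {Λ : Set (Lattice d)}
    (hf : DependsOn f Λ) (h : G) {x : Lattice d} (hx : x ∉ Λ) : edgeEnergy Q h x f = 0 := by
  funext ω
  have key : ∀ s, f (Function.update ω x s) = f ω := fun s => hf fun i hi => by
    rw [Function.update_of_ne]
    rintro rfl
    exact hx hi
  simp [edgeEnergy, key]

lemma dependsOn_edgeEnergy (Q : ParameterSet G) {f : Config G → ℝ} {Λ : Set (Lattice d)}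
    (hf : DependsOn f Λ) (h : G) (x : Lattice d) :
    DependsOn (edgeEnergy Q h x f) (Λ ∪ Set.Icc (x - 1) (x + 1)) := by
  intro ω η hωη
  have key : ∀ s, f (Function.update ω x s) = f (Function.update η x s) := fun s =>
    hf fun i hi => by
      rcases eq_or_ne i x with rfl | hix
      · simp
      · simp [hix, hωη i (Or.inl hi)]
  unfold edgeEnergy
  rw [key, key, dependsOn_constraint h x fun i hi => hωη i (Or.inr ?_)]
  rw [Finset.coe_erase, Finset.coe_Icc] at hi
  exact hi.1

/-- One summand of the generator. -/
def generatorTerm (Q : ParameterSet G) (h : G) (x : Lattice d) (f : Config G → ℝ)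
    (ω : Config G) : ℝ :=
  constraint h x ω *
    ((if ω x = neutral then Q.q h else 0) + (if ω x = vacancy h then Q.p else 0)) * grad h x f ω

lemma generator_eq_sum (Q : ParameterSet G) {f : Config G → ℝ} {Λ : Finset (Lattice d)}
    (hf : DependsOn f (Λ : Set (Lattice d))) (ω : Config G) :
    generator Q f ω = ∑ h : G, ∑ x ∈ Λ, generatorTerm Q h x f ω := by
  unfold generator
  refine Finset.sum_congr rfl fun h _ => tsum_eq_sum fun x hx => ?_
  rw [grad_eq_zero hf h hx, mul_zero]

lemma dependsOn_generatorTerm (Q : ParameterSet G) {f : Config G → ℝ} {Λ : Set (Lattice d)}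
    (hf : DependsOn f Λ) (h : G) (x : Lattice d) :
    DependsOn (generatorTerm Q h x f) (Λ ∪ Set.Icc (x - 1) (x + 1)) := by
  intro ω η hωη
  have key : ∀ s, f (Function.update ω x s) = f (Function.update η x s) := fun s =>
    hf fun i hi => by
      rcases eq_or_ne i x with rfl | hix
      · simp
      · simp [hix, hωη i (Or.inl hi)]
  have hfx : f ω = f η := hf fun i hi => hωη i (Or.inl hi)
  have hx : ω x = η x := hωη x (Or.inr ⟨by simp, by simp⟩)
  unfold generatorTerm grad
  rw [key, key, hx, hfx, dependsOn_constraint h x fun i hi => hωη i (Or.inr ?_)]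
  rw [Finset.coe_erase, Finset.coe_Icc] at hi
  exact hi.1

lemma isLocal_generatorTerm (Q : ParameterSet G) {f : Config G → ℝ} (hf : IsLocal f)
    (h : G) (x : Lattice d) : IsLocal (generatorTerm Q h x f) := by
  obtain ⟨Λ, hΛ⟩ := hf
  refine ⟨Λ ∪ Finset.Icc (x - 1) (x + 1), ?_⟩
  simpa using dependsOn_generatorTerm Q hΛ h x

lemma IsLocal.comp₂ {f g : Config G → ℝ} (hf : IsLocal f) (hg : IsLocal g) (φ : ℝ → ℝ → ℝ) :
    IsLocal fun ω => φ (f ω) (g ω) := by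
  obtain ⟨Λ, hΛ⟩ := hf
  obtain ⟨Λ', hΛ'⟩ := hg
  refine ⟨Λ ∪ Λ', fun ω η h => ?_⟩
  simp only
  rw [hΛ fun i hi => h i (by simp only [Finset.coe_union]; exact Or.inl hi),
    hΛ' fun i hi => h i (by simp only [Finset.coe_union]; exact Or.inr hi)]

lemma isLocal_const (c : ℝ) : IsLocal (fun _ : Config G => c) := ⟨∅, fun _ _ _ => rfl⟩

lemma isLocal_sum {τ : Type*} (s : Finset τ) {f : τ → Config G → ℝ} (hf : ∀ t, IsLocal (f t)) :
    IsLocal fun ω => ∑ t ∈ s, f t ω := by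
  classical
  induction s using Finset.induction_on with
  | empty => simpa using isLocal_const 0
  | insert t s ht ih =>
    simp only [Finset.sum_insert ht]
    exact (hf t).comp₂ ih (· + ·)

lemma isLocal_generator (Q : ParameterSet G) {f : Config G → ℝ} (hf : IsLocal f) :
    IsLocal (generator Q f) := by
  obtain ⟨Λ, hΛ⟩ := id hf
  have : generator Q f = fun ω => ∑ h : G, ∑ x ∈ Λ, generatorTerm Q h x f ω :=
    funext fun ω => generator_eq_sum Q hΛ ω
  rw [this]
  exact isLocal_sum _ fun h => isLocal_sum _ fun x => isLocal_generatorTerm Q hf h x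

/-- Reversibility, one edge at a time. -/
lemma siteAvg_mul_generatorTerm (Q : ParameterSet G) (h : G) (x : Lattice d)
    (f : Config G → ℝ) :
    siteAvg Q.weight x (fun ω => -(f ω * generatorTerm Q h x f ω)) = edgeEnergy Q h x f := by
  classical
  funext ω
  rw [siteAvg_apply, sum_state, Finset.sum_eq_single h]
  · simp only [generatorTerm, grad, edgeEnergy, constraint_update, Function.update_self,
      Function.update_idem, ParameterSet.weight_neutral, ParameterSet.weight_vacancy, if_true,
      vacancy_ne_neutral, neutral_ne_vacancy, if_false]
    ring
  · intro h' _ hne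
    simp [generatorTerm, hne]
  · simp

lemma dirichlet_generator_eq (Q : ParameterSet G) {f : Config G → ℝ} {Λ : Finset (Lattice d)}
    (hf : DependsOn f (Λ : Set (Lattice d))) :
    dirichlet Q f (generator Q f) = ∑ h : G, ∑ x ∈ Λ, ∫ ω, edgeEnergy Q h x f ω ∂Q.mu := by
  have hloc : IsLocal f := ⟨Λ, hf⟩
  have hterm : ∀ h x, IsLocal fun ω => -(f ω * generatorTerm Q h x f ω) := fun h x =>
    hloc.comp₂ (isLocal_generatorTerm Q hloc h x) fun a b => -(a * b)
  have e : ∀ ω, -(f ω * generator Q f ω) =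
      ∑ h : G, ∑ x ∈ Λ, -(f ω * generatorTerm Q h x f ω) := by
    intro ω
    rw [generator_eq_sum Q hf, Finset.mul_sum, ← Finset.sum_neg_distrib]
    refine Finset.sum_congr rfl fun h _ => ?_
    rw [Finset.mul_sum, ← Finset.sum_neg_distrib]
  unfold dirichlet
  simp only [e]
  rw [integral_finsetSum _ fun h _ => (isLocal_sum Λ (hterm h)).integrable Q]
  refine Finset.sum_congr rfl fun h _ => ?_
  rw [integral_finsetSum _ fun x _ => (hterm h x).integrable Q]
  refine Finset.sum_congr rfl fun x _ => ?_
  rw [← siteAvg_mul_generatorTerm, Q.integral_siteAvg x (hterm h x)]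

/-- A Poincaré inequality for local functions extends to the domain of the closed generator, and so
bounds the spectral gap from below. -/
lemma spectralGap_pos_of_poincare (Q : ParameterSet G) {C : ℝ} (hC : 0 < C)
    (hP : ∀ f, IsLocal f → variance f Q.mu ≤ C * dirichlet Q f (generator Q f)) :
    0 < spectralGap Q := by
  have key : ∀ f g, GeneratorPair Q f g → variance f Q.mu ≤ C * dirichlet Q f g := by
    intro f g hfg
    obtain ⟨F, hF, hFf, hFg⟩ := hfg.approx
    have hF2 : ∀ n, MemLp (F n) 2 Q.mu := fun n => (hF n).memLp Q 2
    have hL2 : ∀ n, MemLp (generator Q (F n)) 2 Q.mu := fun n =>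
      (isLocal_generator Q (hF n)).memLp Q 2
    have t1 : Tendsto (fun n => (hF2 n).toLp (F n)) atTop (𝓝 (hfg.memLp_left.toLp f)) :=
      (Lp.tendsto_Lp_iff_tendsto_eLpNorm'' _ hF2 _ hfg.memLp_left).2 hFf
    have t2 : Tendsto (fun n => (hL2 n).toLp (generator Q (F n))) atTop
        (𝓝 (hfg.memLp_right.toLp g)) :=
      (Lp.tendsto_Lp_iff_tendsto_eLpNorm'' _ hL2 _ hfg.memLp_right).2 hFg
    have hone : MemLp (fun _ : Config G => (1 : ℝ)) 2 Q.mu := memLp_const 1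
    have hinner : ∀ (a b : Config G → ℝ) (ha : MemLp a 2 Q.mu) (hb : MemLp b 2 Q.mu),
        inner ℝ (ha.toLp a) (hb.toLp b) = ∫ ω, a ω * b ω ∂Q.mu := by
      intro a b ha hb
      rw [L2.inner_def]
      refine integral_congr_ae ?_
      filter_upwards [ha.coeFn_toLp, hb.coeFn_toLp] with ω h1 h2
      rw [h1, h2]
      simp [mul_comm]
    have hvar : ∀ (a : Config G → ℝ) (ha : MemLp a 2 Q.mu), variance a Q.mu =
        inner ℝ (ha.toLp a) (ha.toLp a) - (inner ℝ (ha.toLp a) (hone.toLp _)) ^ 2 := by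
      intro a ha
      rw [variance_eq_sub ha, hinner, hinner]
      simp [pow_two]
    have hdir : ∀ (a b : Config G → ℝ) (ha : MemLp a 2 Q.mu) (hb : MemLp b 2 Q.mu),
        dirichlet Q a b = - inner ℝ (ha.toLp a) (hb.toLp b) := by
      intro a b ha hb
      rw [hinner, dirichlet, integral_neg]
    rw [hvar f hfg.memLp_left, hdir f g hfg.memLp_left hfg.memLp_right]
    refine le_of_tendsto_of_tendsto' ((t1.inner t1).sub ((t1.inner tendsto_const_nhds).pow 2))
      ((t1.inner t2).neg.const_mul C) fun n => ?_
    rw [← hvar, ← hdir]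
    exact hP _ (hF n)
  have hle : ((1 / C : ℝ) : EReal) ≤ spectralGap Q := by
    refine le_iInf fun f => le_iInf fun g => le_iInf fun hfg => le_iInf fun hconst => ?_
    have hvpos : 0 < variance f Q.mu := by
      refine lt_of_le_of_ne (variance_nonneg _ _) fun h0 => hconst ?_
      have h1 := ae_eq_integral_of_variance_eq_zero hfg.memLp_left h0.symm
      exact ⟨_, h1⟩
    rw [EReal.coe_le_coe_iff, div_le_div_iff₀ hC hvpos, one_mul, mul_comm]
    exact key f g hfg
  exact lt_of_lt_of_le (by exact_mod_cast one_div_pos.2 hC) hle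

end Generator

/-! ### Legal paths -/

section Paths

variable {d : ℕ} {G : Finset (Lattice d)}

/-- The transitions of the `G`-MCEM at the sites of `U`: creation or destruction of an `h`-vacancy
at a site whose constraint for `h` is satisfied. -/
inductive LegalStep (U : Set (Lattice d)) : Config G → Config G → Prop
  | create {ω : Config G} {x v : Lattice d} {h : G} (hx : x ∈ U)
      (hv : IsPropagation (h : Lattice d) v) (hs : ω (x - v) = vacancy h) (h0 : ω x = neutral) :
      LegalStep U ω (Function.update ω x (vacancy h))
  | destroy {ω : Config G} {x v : Lattice d} {h : G} (hx : x ∈ U)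
      (hv : IsPropagation (h : Lattice d) v) (hs : ω (x - v) = vacancy h) (h0 : ω x = vacancy h) :
      LegalStep U ω (Function.update ω x neutral)

/-- `η` can be reached from `ω` by legal transitions at the sites of `U`. -/
def Reach (U : Set (Lattice d)) : Config G → Config G → Prop := Relation.ReflTransGen (LegalStep U)

lemma LegalStep.symm {U : Set (Lattice d)} {ω η : Config G} (h : LegalStep U ω η) :
    LegalStep U η ω := by
  cases h with
  | @create x v h hx hv hs h0 =>
    have := LegalStep.destroy (ω := Function.update ω x (vacancy h)) hx hv
      (by rw [Function.update_of_ne (hv.sub_ne x), hs]) (by simp)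
    rwa [Function.update_idem, ← h0, Function.update_eq_self] at this
  | @destroy x v h hx hv hs h0 =>
    have := LegalStep.create (ω := Function.update ω x neutral) hx hv
      (by rw [Function.update_of_ne (hv.sub_ne x), hs]) (by simp)
    rwa [Function.update_idem, ← h0, Function.update_eq_self] at this

lemma LegalStep.mono {U V : Set (Lattice d)} (hUV : U ⊆ V) {ω η : Config G}
    (h : LegalStep U ω η) : LegalStep V ω η := by
  cases h with
  | create hx hv hs h0 => exact .create (hUV hx) hv hs h0
  | destroy hx hv hs h0 => exact .destroy (hUV hx) hv hs h0

lemma LegalStep.eq_of_notMem {U : Set (Lattice d)} {ω η : Config G} (h : LegalStep U ω η)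
    {i : Lattice d} (hi : i ∉ U) : η i = ω i := by
  cases h with
  | create hx hv hs h0 => exact Function.update_of_ne (fun e => hi (by rwa [e])) _ _
  | destroy hx hv hs h0 => exact Function.update_of_ne (fun e => hi (by rwa [e])) _ _

lemma Reach.refl {U : Set (Lattice d)} (ω : Config G) : Reach U ω ω := Relation.ReflTransGen.refl

lemma Reach.trans {U : Set (Lattice d)} {ω η ξ : Config G} (h : Reach U ω η) (h' : Reach U η ξ) :
    Reach U ω ξ := Relation.ReflTransGen.trans h h'

lemma Reach.symm {U : Set (Lattice d)} {ω η : Config G} (h : Reach U ω η) : Reach U η ω := by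
  induction h with
  | refl => exact Reach.refl _
  | tail _ h ih => exact Relation.ReflTransGen.head h.symm ih

lemma Reach.mono {U V : Set (Lattice d)} (hUV : U ⊆ V) {ω η : Config G} (h : Reach U ω η) :
    Reach V ω η := by
  induction h with
  | refl => exact Reach.refl _
  | tail _ h ih => exact Relation.ReflTransGen.tail ih (h.mono hUV)

lemma LegalStep.reach {U : Set (Lattice d)} {ω η : Config G} (h : LegalStep U ω η) :
    Reach U ω η := Relation.ReflTransGen.single h

/-- A function that changes by at most `D` along each legal transition in a finite volume changes by
a bounded multiple of `D` along legal paths. -/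
lemma Reach.abs_sub_le {U : Finset (Lattice d)} {ω η : Config G}
    (h : Reach (U : Set (Lattice d)) ω η) (f : Config G → ℝ) {D : ℝ} (hD : 0 ≤ D)
    (hf : ∀ ξ ξ' : Config G, (∀ i ∉ U, ξ i = ω i) → LegalStep (U : Set (Lattice d)) ξ ξ' →
      |f ξ - f ξ'| ≤ D) :
    |f ω - f η| ≤ (Fintype.card (State G) : ℝ) ^ U.card * D := by
  classical
  let V := {ξ : Config G // ∀ i ∉ U, ξ i = ω i}
  let e : V → (U → State G) := fun ξ => U.restrict ξ.1
  have he : Function.Injective e := by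
    intro ξ ξ' hξ
    refine Subtype.ext (funext fun i => ?_)
    by_cases hi : i ∈ U
    · exact congrFun hξ ⟨i, hi⟩
    · rw [ξ.2 i hi, ξ'.2 i hi]
  have : Finite V := Finite.of_injective e he
  let _ : Fintype V := Fintype.ofFinite V
  have hcard : Fintype.card V ≤ Fintype.card (State G) ^ U.card := by
    refine (Fintype.card_le_of_injective e he).trans_eq ?_
    simp
  -- the graph of legal transitions in the finite volume
  let Γ : SimpleGraph V :=
    { Adj := fun ξ ξ' => ξ ≠ ξ' ∧ LegalStep (U : Set (Lattice d)) ξ.1 ξ'.1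
      symm := ⟨fun _ _ h => ⟨h.1.symm, h.2.symm⟩⟩
      loopless := ⟨fun _ h => h.1 rfl⟩ }
  have hreach : ∃ hη : ∀ i ∉ U, η i = ω i, Γ.Reachable ⟨ω, fun _ _ => rfl⟩ ⟨η, hη⟩ := by
    induction h with
    | refl => exact ⟨fun _ _ => rfl, SimpleGraph.Reachable.refl _⟩
    | @tail ξ ξ' _ hstep ih =>
      obtain ⟨hξ, hr⟩ := ih
      have hξ' : ∀ i ∉ U, ξ' i = ω i := fun i hi => by
        rw [hstep.eq_of_notMem (by simpa using hi), hξ i hi]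
      refine ⟨hξ', ?_⟩
      by_cases heq : ξ = ξ'
      · subst heq
        exact hr
      · refine hr.trans (SimpleGraph.Adj.reachable ?_)
        exact ⟨fun h => heq (congrArg Subtype.val h), hstep⟩
  have hwalk : ∀ (a b : V) (p : Γ.Walk a b), |f a.1 - f b.1| ≤ p.length * D := by
    intro a b p
    induction p with
    | nil => simp
    | @cons a b c hab p ih =>
      have h1 := hf a.1 b.1 a.2 hab.2
      have h2 := _root_.abs_sub_le (f a.1) (f b.1) (f c.1)
      rw [SimpleGraph.Walk.length_cons]
      push_cast
      linarith
  obtain ⟨hη, ⟨p⟩⟩ := hreach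
  refine (hwalk _ _ p.toPath.1).trans ?_
  refine mul_le_mul_of_nonneg_right ?_ hD
  exact_mod_cast (p.toPath.2.length_lt.le.trans hcard)

/-- If every state of `x` can be reached by legal transitions in `U`, then the local fluctuation at
`x` is controlled by the Dirichlet form in `U`. -/
lemma sq_sub_siteAvg_le (Q : ParameterSet G) {δ : ℝ} (hδ : 0 < δ) (hw : ∀ s, δ ≤ Q.weight s)
    {U : Finset (Lattice d)} {x : Lattice d} {ω : Config G} (f : Config G → ℝ)
    (hr : ∀ s, Reach (U : Set (Lattice d)) ω (Function.update ω x s)) :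
    (f ω - siteAvg Q.weight x f ω) ^ 2 ≤
      ((Fintype.card (State G) : ℝ) ^ U.card) ^ 2 / δ ^ (U.card + 2) *
        setAvg Q.weight U (∑ y ∈ U, ∑ h : G, edgeEnergy Q h y f) ω := by
  set T := setAvg Q.weight U (∑ y ∈ U, ∑ h : G, edgeEnergy Q h y f) ω with hT
  have hΓ0 : 0 ≤ ∑ y ∈ U, ∑ h : G, edgeEnergy Q h y f :=
    Finset.sum_nonneg fun y _ => Finset.sum_nonneg fun h _ => edgeEnergy_nonneg Q h y f
  have hT0 : 0 ≤ T := setAvg_nonneg Q.weight_nonneg U hΓ0 ω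
  set D := Real.sqrt (T / δ ^ (U.card + 2)) with hD
  have hcreate : ∀ ξ : Config G, (∀ i ∉ U, ξ i = ω i) → ∀ y ∈ U, ∀ (h : G) (v : Lattice d),
      IsPropagation (h : Lattice d) v → ξ (y - v) = vacancy h →
      |f (Function.update ξ y (vacancy h)) - f (Function.update ξ y neutral)| ≤ D := by
    intro ξ hξ y hy h v hv hs
    refine Real.le_sqrt_of_sq_le ?_
    rw [sq_abs, le_div_iff₀ (pow_pos hδ _)]
    have h1 : edgeEnergy Q h y f ξ ≤ (∑ y ∈ U, ∑ h : G, edgeEnergy Q h y f) ξ := by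
      simp only [Finset.sum_apply]
      refine le_trans ?_ (Finset.single_le_sum
        (f := fun y => ∑ h : G, edgeEnergy Q h y f ξ)
        (fun y _ => Finset.sum_nonneg fun h _ => edgeEnergy_nonneg Q h y f ξ) hy)
      exact Finset.single_le_sum (f := fun h => edgeEnergy Q h y f ξ)
        (fun h _ => edgeEnergy_nonneg Q h y f ξ) (Finset.mem_univ h)
    have h2 := le_setAvg_of_eqOn_compl hδ.le hw U hΓ0 hξ
    rw [← hT] at h2
    have h3 : constraint h y ξ = 1 := by
      unfold constraint
      exact if_pos ⟨v, hv, hs⟩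
    have h4 : δ * δ ≤ Q.p * Q.q h :=
      mul_le_mul (hw neutral) (hw (vacancy h)) hδ.le Q.p_pos.le
    have h5 : δ * δ * (f (Function.update ξ y (vacancy h)) -
        f (Function.update ξ y neutral)) ^ 2 ≤ edgeEnergy Q h y f ξ := by
      rw [edgeEnergy, h3, one_mul]
      exact mul_le_mul_of_nonneg_right h4 (sq_nonneg _)
    calc (f (Function.update ξ y (vacancy h)) - f (Function.update ξ y neutral)) ^ 2 *
          δ ^ (U.card + 2)
        = δ ^ U.card * (δ * δ * (f (Function.update ξ y (vacancy h)) -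
          f (Function.update ξ y neutral)) ^ 2) := by ring
      _ ≤ δ ^ U.card * (∑ y ∈ U, ∑ h : G, edgeEnergy Q h y f) ξ :=
        mul_le_mul_of_nonneg_left (h5.trans h1) (pow_nonneg hδ.le _)
      _ ≤ T := h2
  have hstep : ∀ ξ ξ' : Config G, (∀ i ∉ U, ξ i = ω i) →
      LegalStep (U : Set (Lattice d)) ξ ξ' → |f ξ - f ξ'| ≤ D := by
    intro ξ ξ' hξ hst
    cases hst with
    | @create y v h hy hv hs h0 =>
      have := hcreate ξ hξ y hy h v hv hs
      rwa [← h0, Function.update_eq_self, abs_sub_comm] at this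
    | @destroy y v h hy hv hs h0 =>
      have := hcreate ξ hξ y hy h v hv hs
      rwa [← h0, Function.update_eq_self] at this
  have hdiff : |f ω - siteAvg Q.weight x f ω| ≤ (Fintype.card (State G) : ℝ) ^ U.card * D := by
    have e : f ω - siteAvg Q.weight x f ω =
        ∑ s, Q.weight s * (f ω - f (Function.update ω x s)) := by
      simp only [mul_sub, Finset.sum_sub_distrib, ← Finset.sum_mul, Q.sum_weight, one_mul,
        siteAvg_apply]
    rw [e]
    calc |∑ s, Q.weight s * (f ω - f (Function.update ω x s))|
        ≤ ∑ s, |Q.weight s * (f ω - f (Function.update ω x s))| := Finset.abs_sum_le_sum_abs _ _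
      _ ≤ ∑ s, Q.weight s * ((Fintype.card (State G) : ℝ) ^ U.card * D) := by
        refine Finset.sum_le_sum fun s _ => ?_
        rw [abs_mul, abs_of_pos (Q.weight_pos s)]
        exact mul_le_mul_of_nonneg_left ((hr s).abs_sub_le f (Real.sqrt_nonneg _) hstep)
          (Q.weight_nonneg s)
      _ = _ := by rw [← Finset.sum_mul, Q.sum_weight, one_mul]
  rw [← sq_abs]
  refine (pow_le_pow_left₀ (abs_nonneg _) hdiff 2).trans_eq ?_
  rw [mul_pow, hD, Real.sq_sqrt (div_nonneg hT0 (pow_nonneg hδ.le _))]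
  ring

/-- The cube of side `2 R + 1` around `x`. -/
def box (R : ℕ) (x : Lattice d) : Finset (Lattice d) :=
  Finset.Icc (fun i => x i - R) (fun i => x i + R)

lemma mem_box {R : ℕ} {x y : Lattice d} : y ∈ box R x ↔ ∀ i, |y i - x i| ≤ R := by
  simp only [box, Finset.mem_Icc, Pi.le_def, abs_le, ← forall_and]
  exact forall_congr' fun i => by constructor <;> rintro ⟨h1, h2⟩ <;> constructor <;> linarith

lemma mem_box_comm {R : ℕ} {x y : Lattice d} : y ∈ box R x ↔ x ∈ box R y := by
  simp only [mem_box, abs_sub_comm]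

lemma self_mem_box (R : ℕ) (x : Lattice d) : x ∈ box R x := by simp [mem_box]

lemma card_box (R : ℕ) (x : Lattice d) : (box R x).card = (2 * R + 1) ^ d := by
  rw [box, Pi.card_Icc]
  rw [Finset.prod_congr rfl fun i _ => show (Finset.Icc (x i - R) (x i + R)).card = 2 * R + 1 by
    rw [Int.card_Icc]; omega]
  simp

/-- The sites of the cube around `x` that precede `x` with respect to the level function `ℓ`. -/
def pastBox (ℓ : Lattice d → ℤ) (R : ℕ) (x : Lattice d) : Finset (Lattice d) :=
  (box R x).filter fun y => ℓ y < ℓ x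

/-- If, for each site `x`, a very likely event that depends on the past of `x` in a bounded
neighbourhood allows to change the state of `x` by legal transitions in this neighbourhood, then the
spectral gap is positive. -/
theorem spectralGap_pos_of_reach (Q : ParameterSet G) (ℓ : Lattice d → ℤ) (R : ℕ)
    (A : Lattice d → Set (Config G))
    (hA : ∀ x ω η, (∀ y ∈ pastBox ℓ R x, ω y = η y) → (ω ∈ A x ↔ η ∈ A x)) (ε : ℝ)
    (hε : ∀ x, setAvg Q.weight (pastBox ℓ R x) ((A x)ᶜ.indicator 1) ≤ fun _ => ε)
    (hεR : 4 * ε * (2 * R + 1) ^ d ≤ 1)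
    (hr : ∀ x, ∀ ω ∈ A x, ∀ s, Reach (box R x : Set (Lattice d)) ω (Function.update ω x s)) :
    0 < spectralGap Q := by
  classical
  obtain ⟨δ, hδ, -, hw⟩ := Q.exists_weight_le
  set n := (2 * R + 1) ^ d with hn
  set K : ℝ := ((Fintype.card (State G) : ℝ) ^ n) ^ 2 / δ ^ (n + 2) with hK
  have hS : 0 < Fintype.card (State G) := Fintype.card_pos_iff.2 ⟨neutral⟩
  have hK0 : 0 < K := by positivity
  have hn0 : 0 < n := by positivity
  refine spectralGap_pos_of_poincare Q (C := 4 * (K * n)) (by positivity) fun f hf => ?_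
  obtain ⟨Λ, hΛ⟩ := id hf
  set B := Λ ∪ Λ.biUnion (box (R + 1)) with hB
  have hboxB : ∀ x ∈ Λ, box R x ⊆ B := fun x hx y hy => by
    refine Finset.mem_union_right _ (Finset.mem_biUnion.2 ⟨x, hx, ?_⟩)
    rw [mem_box] at hy ⊢
    intro i
    push_cast
    linarith [hy i]
  have hΛB : Λ ⊆ B := Finset.subset_union_left
  set o : Config G := fun _ => neutral
  let c : Lattice d → Config G → ℝ := fun x => (A x).indicator 1
  have hc1 : ∀ x, 1 - c x = (A x)ᶜ.indicator 1 := fun x => (Set.indicator_compl (A x) 1).symm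
  let r : Lattice d → ℤ ×ₗ Lex (Fin d → ℤ) := fun x => toLex (ℓ x, toLex x)
  have hrinj : Function.Injective r := fun x y hxy =>
    congrArg (fun z : ℤ ×ₗ Lex (Fin d → ℤ) => ofLex (ofLex z).2) hxy
  have hcp := constrained_poincare (w := Q.weight) Q.weight_nonneg Q.sum_weight hrinj Λ B hΛB f hΛ
    (pastBox ℓ R) (fun x y hy => Prod.Lex.toLex_lt_toLex.2 (Or.inl (Finset.mem_filter.1 hy).2))
    (fun x hx => (Finset.filter_subset _ _).trans (hboxB x hx)) c
    (fun x ω => by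
      by_cases h : ω ∈ A x
      · exact Or.inr (Set.indicator_of_mem h _)
      · exact Or.inl (Set.indicator_of_notMem h _))
    (fun x ω η h => by
      have := hA x ω η h
      by_cases h' : ω ∈ A x
      · simp [c, h', this.1 h']
      · have h'' : η ∉ A x := fun h'' => h' (this.2 h'')
        simp [c, h', h''])
    ε (fun x => by rw [hc1]; exact hε x) n
    (fun y => by
      rw [hn, ← card_box R y]
      refine Finset.card_le_card fun x hx => ?_
      rcases Finset.mem_insert.1 (Finset.mem_filter.1 hx).2 with rfl | h
      · exact self_mem_box _ _
      · exact mem_box_comm.1 (Finset.mem_filter.1 h).1)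
    (by rw [hn]; push_cast; exact hεR) o
  have hvar : variance f Q.mu =
      setAvg Q.weight B (f ^ 2) o - (setAvg Q.weight B f o) ^ 2 := by
    have hfB : DependsOn f (B : Set (Lattice d)) := hΛ.mono (by exact_mod_cast hΛB)
    have hf2 : DependsOn (f ^ 2) (B : Set (Lattice d)) := fun ω η h => by
      simp only [Pi.pow_apply]
      rw [hfB h]
    rw [variance_eq_sub (hf.memLp Q 2), Q.setAvg_eq_integral hfB, Q.setAvg_eq_integral hf2]
  have hlocal : ∀ x ∈ Λ, setAvg Q.weight B (c x * (f - siteAvg Q.weight x f) ^ 2) o ≤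
      K * ∑ y ∈ box R x, ∑ h : G, setAvg Q.weight B (edgeEnergy Q h y f) o := by
    intro x hx
    have h1 : c x * (f - siteAvg Q.weight x f) ^ 2 ≤
        K • setAvg Q.weight (box R x) (∑ y ∈ box R x, ∑ h : G, edgeEnergy Q h y f) := by
      intro ω
      have h0 : 0 ≤ setAvg Q.weight (box R x) (∑ y ∈ box R x, ∑ h : G, edgeEnergy Q h y f) ω :=
        setAvg_nonneg Q.weight_nonneg _ (Finset.sum_nonneg fun y _ => Finset.sum_nonneg
          fun h _ => edgeEnergy_nonneg Q h y f) ω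
      by_cases h : ω ∈ A x
      · have h2 := sq_sub_siteAvg_le Q hδ hw f (hr x ω h)
        rw [card_box] at h2
        simpa [c, h] using h2
      · simpa [c, h] using mul_nonneg hK0.le h0
    have h2 := setAvg_mono Q.weight_nonneg B h1 o
    rw [map_smul, setAvg_setAvg_of_subset Q.sum_weight (hboxB x hx)] at h2
    simpa only [map_sum, Finset.sum_apply, Pi.smul_apply, smul_eq_mul] using h2
  have hcount : ∑ x ∈ Λ, ∑ y ∈ box R x, ∑ h : G, setAvg Q.weight B (edgeEnergy Q h y f) o ≤
      n * ∑ y ∈ Λ, ∑ h : G, setAvg Q.weight B (edgeEnergy Q h y f) o := by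
    set a : Lattice d → ℝ := fun y => ∑ h : G, setAvg Q.weight B (edgeEnergy Q h y f) o
    have ha0 : ∀ y, 0 ≤ a y := fun y => Finset.sum_nonneg fun h _ =>
      setAvg_nonneg Q.weight_nonneg B (edgeEnergy_nonneg Q h y f) o
    have haΛ : ∀ y, y ∉ Λ → a y = 0 := fun y hy => Finset.sum_eq_zero fun h _ => by
      rw [edgeEnergy_eq_zero Q hΛ h (by simpa using hy), map_zero, Pi.zero_apply]
    calc ∑ x ∈ Λ, ∑ y ∈ box R x, a y
        = ∑ x ∈ Λ, ∑ y ∈ Λ, if y ∈ box R x then a y else 0 := by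
          refine Finset.sum_congr rfl fun x _ => ?_
          rw [← Finset.sum_filter, Finset.filter_mem_eq_inter, Finset.inter_comm,
            ← Finset.filter_mem_eq_inter, Finset.sum_filter]
          refine Finset.sum_congr rfl fun y _ => ?_
          split_ifs with h
          · rfl
          · exact haΛ y h
      _ = ∑ y ∈ Λ, ((Λ.filter fun x => y ∈ box R x).card : ℝ) * a y := by
          rw [Finset.sum_comm]
          refine Finset.sum_congr rfl fun y _ => ?_
          rw [← Finset.sum_filter, Finset.sum_const, nsmul_eq_mul]
      _ ≤ ∑ y ∈ Λ, (n : ℝ) * a y := Finset.sum_le_sum fun y _ => by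
          refine mul_le_mul_of_nonneg_right ?_ (ha0 y)
          rw [hn, ← card_box R y]
          exact_mod_cast Finset.card_le_card fun x hx => mem_box_comm.1 (Finset.mem_filter.1 hx).2
      _ = _ := by rw [Finset.mul_sum]
  have hdir : ∑ y ∈ Λ, ∑ h : G, setAvg Q.weight B (edgeEnergy Q h y f) o =
      dirichlet Q f (generator Q f) := by
    rw [dirichlet_generator_eq Q hΛ, Finset.sum_comm]
    refine Finset.sum_congr rfl fun h _ => Finset.sum_congr rfl fun y hy => ?_
    refine Q.setAvg_eq_integral ((dependsOn_edgeEnergy Q hΛ h y).mono ?_) o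
    refine Set.union_subset (by exact_mod_cast hΛB) fun z hz => ?_
    refine Finset.mem_coe.2 (Finset.mem_union_right _ (Finset.mem_biUnion.2 ⟨y, hy, ?_⟩))
    rw [mem_box]
    intro i
    have h1 := hz.1 i
    have h2 := hz.2 i
    simp only [Pi.sub_apply, Pi.add_apply, Pi.one_apply] at h1 h2
    rw [abs_le]
    push_cast
    constructor <;> linarith [(Nat.cast_nonneg R : (0 : ℤ) ≤ R)]
  rw [hvar, ← hdir]
  refine hcp.trans ?_
  have h1 := Finset.sum_le_sum hlocal
  rw [← Finset.mul_sum] at h1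
  have h2 := mul_le_mul_of_nonneg_left hcount hK0.le
  linarith

end Paths

/-! ### Rich environments -/

section Events

variable {d : ℕ} {G : Finset (Lattice d)}

/-- Union bound: the probability that for some `j ∈ F` none of the independent events
`E j t`, `t ∈ I j`, occurs. -/
lemma setAvg_compl_le (Q : ParameterSet G) {δ : ℝ} (hδ : 0 ≤ δ) (hδ1 : δ ≤ 1)
    (hw : ∀ s, δ ≤ Q.weight s) {κ : Type} (B : Finset (Lattice d)) (k M : ℕ)
    (F : Finset κ) (I : κ → Finset ℕ) (D : κ → ℕ → Finset (Lattice d))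
    (E : κ → ℕ → Set (Config G)) (hM : ∀ j ∈ F, M ≤ (I j).card)
    (hDB : ∀ j ∈ F, ∀ t ∈ I j, D j t ⊆ B)
    (hD : ∀ j ∈ F, ∀ t ∈ I j, ∀ t' ∈ I j, t ≠ t' → Disjoint (D j t) (D j t'))
    (hk : ∀ j ∈ F, ∀ t ∈ I j, (D j t).card ≤ k)
    (hE : ∀ j ∈ F, ∀ t ∈ I j, ∀ ω η : Config G, (∀ y ∈ D j t, ω y = η y) → ω ∈ E j t → η ∈ E j t)
    (hex : ∀ j ∈ F, ∀ t ∈ I j, ∀ ω : Config G, ∃ η : Config G,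
      (∀ i ∉ D j t, η i = ω i) ∧ η ∈ E j t) :
    setAvg Q.weight B ({ω | ∀ j ∈ F, ∃ t ∈ I j, ω ∈ E j t}ᶜ.indicator 1) ≤
      fun _ => F.card * (1 - δ ^ k) ^ M := by
  classical
  have hρ : 0 ≤ 1 - δ ^ k := sub_nonneg.2 (pow_le_one₀ hδ hδ1)
  have hρ1 : 1 - δ ^ k ≤ 1 := sub_le_self _ (pow_nonneg hδ k)
  have h01 : ∀ j t, ∀ ω : Config G, (1 - (E j t).indicator (1 : Config G → ℝ)) ω =
      if ω ∈ E j t then 0 else 1 := by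
    intro j t ω
    by_cases h : ω ∈ E j t <;> simp [h]
  have h1 : ({ω : Config G | ∀ j ∈ F, ∃ t ∈ I j, ω ∈ E j t}ᶜ.indicator (1 : Config G → ℝ)) ≤
      ∑ j ∈ F, ∏ t ∈ I j, (1 - (E j t).indicator (1 : Config G → ℝ)) := by
    intro ω
    rw [Finset.sum_apply]
    have hnn : ∀ j ∈ F, 0 ≤ (∏ t ∈ I j, (1 - (E j t).indicator (1 : Config G → ℝ))) ω := by
      intro j _
      rw [Finset.prod_apply]
      refine Finset.prod_nonneg fun t _ => ?_
      rw [h01]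
      split_ifs <;> norm_num
    by_cases h : ∀ j ∈ F, ∃ t ∈ I j, ω ∈ E j t
    · rw [Set.indicator_of_notMem (by simpa using h)]
      exact Finset.sum_nonneg hnn
    · rw [Set.indicator_of_mem (by simpa using h)]
      push Not at h
      obtain ⟨j, hj, hjt⟩ := h
      refine le_trans (le_of_eq ?_) (Finset.single_le_sum hnn hj)
      rw [Finset.prod_apply, Pi.one_apply]
      refine (Finset.prod_eq_one fun t ht => ?_).symm
      rw [h01, if_neg (hjt t ht)]
  refine (setAvg_mono Q.weight_nonneg B h1).trans ?_
  rw [map_sum]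
  intro ω
  rw [Finset.sum_apply, ← nsmul_eq_mul, ← Finset.sum_const]
  refine Finset.sum_le_sum fun j hj => ?_
  have h2 := setAvg_prod_not_le hδ hδ1 hw Q.sum_weight (I j) (D j)
    (fun t => (E j t).indicator (1 : Config G → ℝ)) k B (hDB j hj) (hD j hj)
    (fun t ht ω η h => by
      by_cases h' : ω ∈ E j t
      · simp [h', hE j hj t ht ω η h h']
      · have h'' : η ∉ E j t := fun h'' => h' (hE j hj t ht η ω (fun y hy => (h y hy).symm) h'')
        simp [h', h''])
    (hk j hj)
    (fun t _ ω => Set.indicator_nonneg (fun _ _ => zero_le_one) ω)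
    (fun t _ ω => Set.indicator_le_self' (fun _ _ => zero_le_one) ω)
    (fun t ht ω => by
      obtain ⟨η, h1, h2⟩ := hex j hj t ht ω
      exact ⟨η, h1, by simp [h2]⟩) ω
  exact h2.trans (pow_le_pow_of_le_one hρ hρ1 (hM j hj))

lemma exists_poly_mul_pow_le {ρ : ℝ} (h0 : 0 ≤ ρ) (h1 : ρ < 1) (c d : ℕ) :
    ∃ M : ℕ,
      4 * (((c * (M + 1) ^ 2 : ℕ) : ℝ) * ρ ^ M) * (2 * (c * (M + 1) ^ 2 : ℕ) + 1) ^ d ≤ 1 := by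
  set k := 2 + 2 * d with hk
  have ht := (tendsto_pow_const_mul_const_pow_of_abs_lt_one k
    (r := ρ) (by rwa [abs_of_nonneg h0]))
  have ht' := ((tendsto_add_atTop_iff_nat 1).2 ht).const_mul
    (4 * (c : ℝ) * (2 * c + 1) ^ d)
  rw [mul_zero] at ht'
  rcases h0.eq_or_lt with rfl | hpos
  · exact ⟨1, by simp⟩
  obtain ⟨M, hM⟩ := (ht'.eventually (gt_mem_nhds hpos)).exists
  refine ⟨M, ?_⟩
  have hM1 : (1 : ℝ) ≤ ((M : ℝ) + 1) ^ 2 :=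
    one_le_pow₀ (by linarith [(Nat.cast_nonneg M : (0 : ℝ) ≤ M)])
  have h2 : ((2 : ℝ) * (c * (M + 1) ^ 2 : ℕ) + 1) ^ d ≤ ((2 * c + 1) * ((M : ℝ) + 1) ^ 2) ^ d := by
    refine pow_le_pow_left₀ (by positivity) ?_ d
    push_cast
    nlinarith
  have h3 : 4 * (((c * (M + 1) ^ 2 : ℕ) : ℝ) * ρ ^ M) * (2 * (c * (M + 1) ^ 2 : ℕ) + 1) ^ d * ρ ≤
      4 * (c : ℝ) * (2 * c + 1) ^ d * (((M + 1 : ℕ) : ℝ) ^ k * ρ ^ (M + 1)) := by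
    calc _ ≤ 4 * (((c * (M + 1) ^ 2 : ℕ) : ℝ) * ρ ^ M) *
          ((2 * c + 1) * ((M : ℝ) + 1) ^ 2) ^ d * ρ := by gcongr
      _ = _ := by
        rw [hk, mul_pow, ← pow_mul, pow_add, pow_succ ρ]
        push_cast
        ring
  exact le_of_mul_le_mul_right ((h3.trans hM.le).trans_eq (one_mul ρ).symm) hpos

/-- A criterion for a positive spectral gap. For every `M` there are polynomially many families of
at least `M` independent local events in the past of each site `x`, such that the state of `x` can
be changed by legal transitions as soon as one event of each family occurs. -/
theorem spectralGap_pos_of_events (Q : ParameterSet G) (ℓ : Lattice d → ℤ) {κ : Type} (c k : ℕ)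
    (H : ∀ M : ℕ, ∃ (F : Finset κ) (I : κ → Finset ℕ) (D : Lattice d → κ → ℕ → Finset (Lattice d))
      (E : Lattice d → κ → ℕ → Set (Config G)), F.card ≤ c * (M + 1) ^ 2 ∧
      (∀ j ∈ F, M ≤ (I j).card) ∧
      (∀ x, ∀ j ∈ F, ∀ t ∈ I j, D x j t ⊆ pastBox ℓ (c * (M + 1) ^ 2) x) ∧
      (∀ x, ∀ j ∈ F, ∀ t ∈ I j, ∀ t' ∈ I j, t ≠ t' → Disjoint (D x j t) (D x j t')) ∧
      (∀ x, ∀ j ∈ F, ∀ t ∈ I j, (D x j t).card ≤ k) ∧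
      (∀ x, ∀ j ∈ F, ∀ t ∈ I j, ∀ ω η : Config G, (∀ y ∈ D x j t, ω y = η y) →
        ω ∈ E x j t → η ∈ E x j t) ∧
      (∀ x, ∀ j ∈ F, ∀ t ∈ I j, ∀ ω : Config G, ∃ η : Config G,
        (∀ i ∉ D x j t, η i = ω i) ∧ η ∈ E x j t) ∧
      (∀ x (ω : Config G), (∀ j ∈ F, ∃ t ∈ I j, ω ∈ E x j t) → ∀ s,
        Reach (box (c * (M + 1) ^ 2) x : Set (Lattice d)) ω (Function.update ω x s))) :
    0 < spectralGap Q := by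
  obtain ⟨δ, hδ, hδ1, hw⟩ := Q.exists_weight_le
  have hρ : 0 ≤ 1 - δ ^ k := sub_nonneg.2 (pow_le_one₀ hδ.le hδ1)
  have hρ1 : 1 - δ ^ k < 1 := sub_lt_self _ (pow_pos hδ k)
  obtain ⟨M, hM⟩ := exists_poly_mul_pow_le hρ hρ1 c d
  obtain ⟨F, I, D, E, hF, hI, hDB, hD, hk, hE, hex, hr⟩ := H M
  refine spectralGap_pos_of_reach Q ℓ (c * (M + 1) ^ 2)
    (fun x => {ω | ∀ j ∈ F, ∃ t ∈ I j, ω ∈ E x j t}) ?_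
    (((c * (M + 1) ^ 2 : ℕ) : ℝ) * (1 - δ ^ k) ^ M) ?_ hM hr
  · intro x ω η h
    have key : ∀ ω η : Config G, (∀ y ∈ pastBox ℓ (c * (M + 1) ^ 2) x, ω y = η y) →
        (∀ j ∈ F, ∃ t ∈ I j, ω ∈ E x j t) → ∀ j ∈ F, ∃ t ∈ I j, η ∈ E x j t := by
      intro ω η h hω j hj
      obtain ⟨t, ht, hωt⟩ := hω j hj
      exact ⟨t, ht, hE x j hj t ht ω η (fun y hy => h y (hDB x j hj t ht hy)) hωt⟩
    exact ⟨key ω η h, key η ω fun y hy => (h y hy).symm⟩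
  · intro x
    refine (setAvg_compl_le Q hδ.le hδ1 hw _ k M F I (D x) (E x) hI (hDB x) (hD x) (hk x) (hE x)
      (hex x)).trans ?_
    intro _
    exact mul_le_mul_of_nonneg_right (Nat.cast_le.2 hF) (pow_nonneg hρ M)

end Events

/-! ### Supplying vacancies through neutral regions -/

section Supply

variable {d : ℕ} {G : Finset (Lattice d)}

lemma mem_hypercube {h : Lattice d} : h ∈ hypercube d ↔ ∀ i, h i = 0 ∨ h i = 1 := by
  simp [hypercube, Fintype.mem_piFinset]

/-- The sign of the propagation direction of `h` along the `i`-th axis. -/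
def dirSign (h : Lattice d) (i : Fin d) : ℤ := 1 - 2 * h i

lemma dirSign_eq {h : Lattice d} (hh : h ∈ hypercube d) (i : Fin d) :
    dirSign h i = 1 ∨ dirSign h i = -1 := by
  unfold dirSign
  rcases mem_hypercube.1 hh i with e | e <;> simp [e]

/-- Each propagation step of an `h`-vacancy increases this linear function by one, so that legal
propagation paths of `h` never return. -/
def potential (h y : Lattice d) : ℤ := ∑ i, dirSign h i * y i

lemma IsPropagation.potential_eq {h v : Lattice d} (hh : h ∈ hypercube d)
    (hv : IsPropagation h v) : potential h v = 1 := by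
  rw [← hv.1]
  refine Finset.sum_congr rfl fun i _ => ?_
  have h1 := mem_hypercube.1 hh i
  have h2 := mem_hypercube.1 hv.2 i
  have h3 := abs_le.1 (hv.abs_le_one i)
  simp only [Pi.add_apply, dirSign] at h2 ⊢
  rcases h1 with e | e <;> rw [e] at h2 ⊢
  · rw [abs_of_nonneg (by omega)]
    ring
  · rw [abs_of_nonpos (by omega)]
    ring

lemma isPropagation_single {h : Lattice d} (hh : h ∈ hypercube d) (i : Fin d) :
    IsPropagation h (Pi.single i (dirSign h i)) := by
  constructor
  · rw [Finset.sum_eq_single i]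
    · rcases dirSign_eq hh i with e | e <;> simp [e]
    · intro j _ hj
      simp [hj]
    · simp
  · rw [mem_hypercube]
    intro j
    have := mem_hypercube.1 hh j
    rcases eq_or_ne j i with rfl | hj
    · simp only [Pi.add_apply, Pi.single_eq_same, dirSign]
      omega
    · simpa [hj] using this

/-- An `h`-vacancy can be brought to a vertex: there is a path in the propagation directions of `h`
through sites of `C`, which are meant to be neutral, from an `h`-vacancy of `ω` outside of `T`. -/
inductive Supply (ω : Config G) (T : Finset (Lattice d)) (C : Set (Lattice d)) (h : G) :
    Lattice d → Prop
  | source {z : Lattice d} (hz : z ∉ T) (hω : ω z = vacancy h) : Supply ω T C h z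
  | step {y z : Lattice d} (hy : Supply ω T C h y) (hz : z ∈ C)
      (hv : IsPropagation (h : Lattice d) (z - y)) : Supply ω T C h z

lemma Supply.mono {ω : Config G} {T : Finset (Lattice d)} {C C' : Set (Lattice d)} (hC : C ⊆ C')
    {h : G} {z : Lattice d} (hz : Supply ω T C h z) : Supply ω T C' h z := by
  induction hz with
  | source hz hω => exact .source hz hω
  | step _ hz hv ih => exact .step ih (hC hz) hv

lemma Supply.reach {ω : Config G} {T : Finset (Lattice d)} {C : Set (Lattice d)}
    (hC : C ⊆ (T : Set (Lattice d))) {h : G} (hh : (h : Lattice d) ∈ hypercube d) {z : Lattice d}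
    (hz : Supply ω T C h z) : ∀ η : Config G,
      (∀ y ∈ C, potential h y ≤ potential h z → η y = neutral) → (∀ y ∉ T, η y = ω y) →
      Reach (T : Set (Lattice d)) η (Function.update η z (vacancy h)) := by
  induction hz with
  | @source z hz hω =>
    intro η _ hT
    rw [← hω, ← hT z hz, Function.update_eq_self]
    exact Reach.refl _
  | @step y z hy hz hv ih =>
    intro η hη hT
    have hpot : potential h z = potential h y + 1 := by
      have h1 := hv.potential_eq hh
      simp only [potential, Pi.sub_apply, mul_sub, Finset.sum_sub_distrib] at h1 ⊢
      linarith
    have hzy : y ≠ z := by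
      rintro rfl
      omega
    have h1 := ih η (fun x hx hxy => hη x hx (by omega)) hT
    have h2 : LegalStep (T : Set (Lattice d)) (Function.update η y (vacancy h))
        (Function.update (Function.update η y (vacancy h)) z (vacancy h)) :=
      .create (hC hz) hv (by simp) (by rw [Function.update_of_ne hzy.symm, hη z hz le_rfl])
    have h3 := ih (Function.update η z (vacancy h))
      (fun x hx hxy => by
        rw [Function.update_of_ne, hη x hx (by omega)]
        rintro rfl
        omega)
      (fun x hx => by
        rw [Function.update_of_ne, hT x hx]
        rintro rfl
        exact hx (hC hz))
    rw [Function.update_comm hzy] at h2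
    exact h1.trans (h2.reach.trans h3.symm)

/-- **Clearing lemma.** Let the sites of `T` be ranked, with `x` on top. If each vacancy in `T`, and
each vacancy type at `x`, can be supplied next to its site through the sites of smaller rank, then
these sites can be made neutral one after the other, and the state of `x` can be changed. -/
theorem reach_update_of_supply (hG : G ⊆ hypercube d) {α : Type*} [LinearOrder α]
    (r : Lattice d → α) (ω : Config G) (T : Finset (Lattice d)) {x : Lattice d} (hx : x ∈ T)
    (hrx : ∀ t ∈ T, t ≠ x → r t < r x)
    (H : ∀ z ∈ T, ∀ h : G, (ω z = vacancy h ∨ z = x) →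
      ∃ y, Supply ω T {t | t ∈ T ∧ r t < r z} h y ∧ IsPropagation (h : Lattice d) (z - y))
    (s : State G) : Reach (T : Set (Lattice d)) ω (Function.update ω x s) := by
  have toggle : ∀ z ∈ T, ∀ h : G, (ω z = vacancy h ∨ z = x) → ∀ η : Config G,
      (∀ t ∈ T, r t < r z → η t = neutral) → (∀ y ∉ T, η y = ω y) → ∀ a b : State G,
      (a = neutral ∧ b = vacancy h ∨ a = vacancy h ∧ b = neutral) → η z = a →
      Reach (T : Set (Lattice d)) η (Function.update η z b) := by
    intro z hz h hzh η hη hT a b hab hηz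
    obtain ⟨y, hy, hv⟩ := H z hz h hzh
    have hzy : y ≠ z := by
      rintro rfl
      exact hv.ne_zero (sub_self _)
    have hCT : {t | t ∈ T ∧ r t < r z} ⊆ (T : Set (Lattice d)) := fun t ht => ht.1
    have h1 := hy.reach hCT (hG h.2) η (fun t ht _ => hη t ht.1 ht.2) hT
    have h3 := hy.reach hCT (hG h.2) (Function.update η z b)
      (fun t ht _ => by
        rw [Function.update_of_ne, hη t ht.1 ht.2]
        rintro rfl
        exact lt_irrefl _ ht.2)
      (fun t ht => by
        rw [Function.update_of_ne, hT t ht]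
        rintro rfl
        exact ht hz)
    have h2 : LegalStep (T : Set (Lattice d)) (Function.update η y (vacancy h))
        (Function.update (Function.update η y (vacancy h)) z b) := by
      have e : Function.update η y (vacancy h) z = a := by
        rw [Function.update_of_ne hzy.symm, hηz]
      rcases hab with ⟨rfl, rfl⟩ | ⟨rfl, rfl⟩
      · exact .create hz hv (by simp) e
      · exact .destroy hz hv (by simp) e
    rw [Function.update_comm hzy] at h2
    exact h1.trans (h2.reach.trans h3.symm)
  let clear : Finset (Lattice d) → Config G → Config G := fun A ω' i =>
    if i ∈ A then neutral else ω' i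
  have hclear : ∀ ω' : Config G, (∀ i, i ≠ x → ω' i = ω i) → ∀ A ⊆ T.erase x,
      (∀ t ∈ A, ∀ t' ∈ T, r t' < r t → t' ∈ A) →
      Reach (T : Set (Lattice d)) ω' (clear A ω') := by
    intro ω' hω' A
    induction A using Finset.induction_on_max_value r with
    | empty => exact fun _ _ => by simpa [clear] using Reach.refl ω'
    | insert a A haA hmax ih =>
      intro hsub hlow
      have ha := Finset.mem_erase.1 (hsub (Finset.mem_insert_self a A))
      have h1 := ih ((Finset.subset_insert _ _).trans hsub) fun t ht t' ht' hlt => by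
        refine Finset.mem_of_mem_insert_of_ne
          (hlow t (Finset.mem_insert_of_mem ht) t' ht' hlt) ?_
        rintro rfl
        exact not_lt.2 (hmax t ht) hlt
      have e : clear (insert a A) ω' = Function.update (clear A ω') a neutral := by
        funext i
        rcases eq_or_ne i a with rfl | hi
        · simp [clear]
        · simp [clear, hi]
      have hca : clear A ω' a = ω a := by simp [clear, haA, hω' a ha.1]
      rw [e]
      rcases (ω a).cases with h0 | ⟨h, hh⟩
      · rwa [← h0, ← hca, Function.update_eq_self]
      · refine h1.trans (toggle a ha.2 h (Or.inl hh) _ ?_ ?_ (vacancy h) neutral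
          (Or.inr ⟨rfl, rfl⟩) (hca.trans hh))
        · intro t ht hlt
          have : t ∈ A := Finset.mem_of_mem_insert_of_ne
            (hlow a (Finset.mem_insert_self _ _) t ht hlt) (by rintro rfl; exact lt_irrefl _ hlt)
          simp [clear, this]
        · intro y hy
          have hyA : y ∉ A := fun h => hy
            (Finset.mem_of_mem_erase (hsub (Finset.mem_insert_of_mem h)))
          have hyx : y ≠ x := by
            rintro rfl
            exact hy hx
          simp [clear, hyA, hω' y hyx]
  have hfull : ∀ ω' : Config G, (∀ i, i ≠ x → ω' i = ω i) →
      Reach (T : Set (Lattice d)) ω' (clear (T.erase x) ω') := fun ω' hω' =>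
    hclear ω' hω' _ subset_rfl fun t ht t' ht' hlt => by
      refine Finset.mem_erase.2 ⟨?_, ht'⟩
      rintro rfl
      have ht := Finset.mem_erase.1 ht
      exact lt_asymm hlt (hrx t ht.2 ht.1)
  -- once everything else is neutral, all states of `x` are connected to the neutral one
  have hx0 : ∀ η : Config G, (∀ t ∈ T, t ≠ x → η t = neutral) → (∀ y ∉ T, η y = ω y) →
      Reach (T : Set (Lattice d)) η (Function.update η x neutral) := by
    intro η hη hT
    rcases (η x).cases with h0 | ⟨h, hh⟩
    · rw [← h0, Function.update_eq_self]
      exact Reach.refl _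
    · exact toggle x hx h (Or.inr rfl) η
        (fun t ht hlt => hη t ht (by rintro rfl; exact lt_irrefl _ hlt)) hT _ _
        (Or.inr ⟨rfl, rfl⟩) hh
  set ω' := Function.update ω x s with hω'
  have hne : ∀ i, i ≠ x → ω' i = ω i := fun i hi => Function.update_of_ne hi _ _
  have key : ∀ ξ : Config G, (∀ i, i ≠ x → ξ i = ω i) → Reach (T : Set (Lattice d)) ξ
      (Function.update (clear (T.erase x) ξ) x neutral) := fun ξ hξ =>
    (hfull ξ hξ).trans (hx0 _ (fun t ht htx => by simp [clear, ht, htx]) fun y hy => by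
      have hyx : y ≠ x := by
        rintro rfl
        exact hy hx
      simp [clear, hy, hξ y hyx])
  have e : Function.update (clear (T.erase x) ω) x neutral =
      Function.update (clear (T.erase x) ω') x neutral := by
    funext i
    rcases eq_or_ne i x with rfl | hi
    · simp
    · simp [clear, hi, hne i hi]
  have h1 := key ω fun _ _ => rfl
  rw [e] at h1
  exact h1.trans (key ω' hne).symm

end Supply

/-! ### Source patterns, and a common propagation direction -/

section Pattern

variable {d : ℕ} {G : Finset (Lattice d)}

/-- A cube of side three around `z` that is neutral except for its corners, where the corner from
which the centre lies in the propagation directions of `h` carries an `h`-vacancy (for `h ∈ G`). -/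
def SourcePattern (ω : Config G) (z : Lattice d) : Prop :=
  (∀ h : G, ω (z - dirSign h) = vacancy h) ∧
    ∀ y ∈ box 1 z, (∀ h : G, y ≠ z - dirSign h) → ω y = neutral

lemma dirSign_injective : Function.Injective (dirSign (d := d)) := by
  intro h h' e
  funext i
  have := congrFun e i
  unfold dirSign at this
  omega

lemma sub_dirSign_mem_box (hG : G ⊆ hypercube d) (h : G) (z : Lattice d) :
    z - dirSign h ∈ box 1 z := by
  rw [mem_box]
  intro i
  rcases dirSign_eq (hG h.2) i with e | e <;> simp [e]

lemma SourcePattern.congr (hG : G ⊆ hypercube d) {ω η : Config G} {z : Lattice d}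
    (h : ∀ y ∈ box 1 z, ω y = η y) (hω : SourcePattern ω z) : SourcePattern η z :=
  ⟨fun g => by rw [← h _ (sub_dirSign_mem_box hG g z), hω.1 g],
    fun y hy hne => by rw [← h y hy, hω.2 y hy hne]⟩

lemma exists_sourcePattern (hG : G ⊆ hypercube d) (ω : Config G) (z : Lattice d) :
    ∃ η : Config G, (∀ i ∉ box 1 z, η i = ω i) ∧ SourcePattern η z := by
  classical
  let η : Config G := fun y => if y ∈ box 1 z then
    (if hy : ∃ h : G, y = z - dirSign h then vacancy hy.choose else neutral) else ω y
  refine ⟨η, fun i hi => by simp [η, hi], fun h => ?_, fun y hy hne => ?_⟩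
  · have hex : ∃ h' : G, z - dirSign h = z - dirSign h' := ⟨h, rfl⟩
    have e : hex.choose = h := Subtype.ext
      (dirSign_injective (sub_right_injective hex.choose_spec)).symm
    simp only [η, if_pos (sub_dirSign_mem_box hG h z), dif_pos hex, e]
  · have hex : ¬ ∃ h : G, y = z - dirSign h := fun ⟨h, e⟩ => hne h e
    simp only [η, if_pos hy, dif_neg hex]

lemma SourcePattern.neutral_of_exists_eq (hG : G ⊆ hypercube d) {ω : Config G} {z y : Lattice d}
    (hω : SourcePattern ω z) (hy : y ∈ box 1 z) (hi : ∃ i, y i = z i) : ω y = neutral := by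
  refine hω.2 y hy fun h e => ?_
  obtain ⟨i, hi⟩ := hi
  have := congrFun e i
  rw [hi, Pi.sub_apply] at this
  rcases dirSign_eq (hG h.2) i with e | e <;> omega

/-- In a source pattern `h`-vacancies can be supplied along the edges of the cube, starting from the
corner with the `h`-vacancy. -/
lemma SourcePattern.supply (hG : G ⊆ hypercube d) {ω : Config G} {z : Lattice d}
    (hω : SourcePattern ω z) {T : Finset (Lattice d)} {C : Set (Lattice d)} {h : G}
    (hT : z - dirSign h ∉ T) (n : ℕ) : ∀ y : Lattice d,
      (Finset.univ.filter fun i => y i = z i).card = n →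
      (∀ i, y i = z i ∨ y i = z i - dirSign h i) →
      (∀ y' : Lattice d, (∀ i, y' i = z i ∨ y' i = z i - dirSign h i) →
        (∀ i, y i ≠ z i → y' i = z i - dirSign h i) → (∃ i, y' i = z i) → y' ∈ C) →
      Supply ω T C h y := by
  induction n with
  | zero =>
    intro y hn hy _
    rw [Finset.card_eq_zero, Finset.filter_eq_empty_iff] at hn
    have e : y = z - dirSign h := funext fun i => (hy i).resolve_left (hn (Finset.mem_univ i))
    rw [e]
    exact .source hT (hω.1 h)
  | succ n ih =>
    intro y hn hy hC
    obtain ⟨i, hi⟩ : (Finset.univ.filter fun i => y i = z i).Nonempty := by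
      rw [← Finset.card_pos]
      omega
    have hiz : y i = z i := (Finset.mem_filter.1 hi).2
    have hne : dirSign h i ≠ 0 := by
      rcases dirSign_eq (hG h.2) i with e | e <;> omega
    set y' := Function.update y i (z i - dirSign h i) with hy'
    have h1 : Supply ω T C h y' := by
      refine ih y' ?_ ?_ ?_
      · have e : (Finset.univ.filter fun j => y' j = z j) =
            (Finset.univ.filter fun j => y j = z j).erase i := by
          ext j
          rcases eq_or_ne j i with rfl | hj
          · simp [hy', hne]
          · simp [hy', hj]
        rw [e, Finset.card_erase_of_mem hi, hn, Nat.add_sub_cancel]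
      · intro j
        rcases eq_or_ne j i with rfl | hj
        · simp [hy']
        · simpa [hy', hj] using hy j
      · intro y'' h1 h2 h3
        refine hC y'' h1 (fun j hj => h2 j ?_) h3
        rcases eq_or_ne j i with rfl | hji
        · exact absurd hiz hj
        · simpa [hy', hji] using hj
    refine .step h1 (hC y hy (fun i hi => (hy i).resolve_left hi) ⟨i, hiz⟩) ?_
    have e : y - y' = Pi.single i (dirSign h i) := by
      funext j
      rcases eq_or_ne j i with rfl | hj
      · simp [hy', hiz]
      · simp [hy', hj]
    rw [e]
    exact isPropagation_single (hG h.2) i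

/-- The neutral sites of a source pattern around `z` in the face with `i`-th coordinate
`z i - σ`. -/
def faceSites (i : Fin d) (σ : ℤ) (z : Lattice d) : Finset (Lattice d) :=
  (box 1 z).filter fun y => y i = z i - σ ∧ ∃ j, y j = z j

/-- All vacancies that propagate in the direction `σ e_i` can be supplied to the site before the
centre of a source pattern in this direction. -/
lemma SourcePattern.supply_face (hG : G ⊆ hypercube d) {ω : Config G} {z : Lattice d}
    (hω : SourcePattern ω z) {T : Finset (Lattice d)} {C : Set (Lattice d)} {h : G}
    (hT : z - dirSign h ∉ T) (i : Fin d) (y : Lattice d) (hyi : y i = z i - dirSign h i)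
    (hy : ∀ j, y j = z j ∨ y j = z j - dirSign h j)
    (hC : (faceSites i (dirSign h i) z : Set (Lattice d)) ⊆ C) :
    Supply ω T C h y := by
  refine hω.supply hG hT _ y rfl hy ?_
  intro y' h1 h2 h3
  refine hC (Finset.mem_coe.2 (Finset.mem_filter.2 ⟨?_, h2 i ?_, h3⟩))
  · rw [mem_box]
    intro j
    rcases h1 j with e | e
    · simp [e]
    · rcases dirSign_eq (hG h.2) j with e' | e' <;> simp [e, e']
  · rw [hyi]
    rcases dirSign_eq (hG h.2) i with e | e <;> omega

lemma disjoint_box_one {z z' : Lattice d} (i : Fin d) (h : 3 ≤ |z i - z' i|) :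
    Disjoint (box 1 z) (box 1 z') := by
  refine Finset.disjoint_left.2 fun y hy hy' => ?_
  have h1 := mem_box.1 hy i
  have h2 := mem_box.1 hy' i
  rw [abs_le] at h1 h2
  rw [le_abs] at h
  push_cast at h1 h2
  omega

/-- If all vacancies propagate in a common direction, then the line that starts from a source
pattern in this direction can be cleared. -/
lemma SourcePattern.reach_line (hG : G ⊆ hypercube d) {ω : Config G} {z : Lattice d}
    (hω : SourcePattern ω z) (i : Fin d) (σ : ℤ) (hσ : σ = 1 ∨ σ = -1)
    (hi : ∀ h : G, dirSign h i = σ) (n : ℕ) (s : State G) :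
    Reach (box (n + 1) (z + Pi.single i (σ * n)) : Set (Lattice d)) ω
      (Function.update ω (z + Pi.single i (σ * n)) s) := by
  classical
  set P : ℕ → Lattice d := fun k => z + Pi.single i (σ * k) with hP
  have hPi : ∀ k, P k i = z i + σ * k := fun k => by simp [hP]
  have hPj : ∀ k j, j ≠ i → P k j = z j := fun k j hj => by simp [hP, hj]
  have hσσ : σ * σ = 1 := by rcases hσ with rfl | rfl <;> norm_num
  set r : Lattice d → ℤ := fun y => σ * (y i - z i) with hr
  have hrP : ∀ k, r (P k) = k := fun k => by
    simp only [hr, hPi]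
    linear_combination (k : ℤ) * hσσ
  set T := faceSites i σ z ∪ (Finset.range (n + 1)).image P with hT
  have hPT : ∀ k ≤ n, P k ∈ T := fun k hk =>
    Finset.mem_union_right _ (Finset.mem_image.2 ⟨k, by simpa using Nat.lt_succ_of_le hk, rfl⟩)
  have hface : ∀ y ∈ faceSites i σ z, r y = -1 := fun y hy => by
    simp only [hr, (Finset.mem_filter.1 hy).2.1]
    linear_combination -hσσ
  have hcorner : ∀ h : G, z - dirSign h ∉ T := by
    intro h hmem
    rcases Finset.mem_union.1 hmem with hm | hm
    · obtain ⟨j, hj⟩ := (Finset.mem_filter.1 hm).2.2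
      rw [Pi.sub_apply] at hj
      rcases dirSign_eq (hG h.2) j with e | e <;> omega
    · obtain ⟨k, -, hk⟩ := Finset.mem_image.1 hm
      have h1 := hrP k
      rw [hk] at h1
      simp only [hr, Pi.sub_apply, hi h] at h1
      have : (k : ℤ) = -1 := by linear_combination -h1 - hσσ
      omega
  have hsupply : ∀ (h : G) (k : ℕ), k ≤ n + 1 →
      Supply ω T {t | t ∈ T ∧ r t < k} h (z + Pi.single i (σ * (k - 1))) := by
    intro h k
    induction k with
    | zero =>
      intro _
      refine hω.supply_face hG (hcorner h) i _ ?_ ?_ ?_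
      · simp [hi h]
        ring
      · intro j
        rcases eq_or_ne j i with rfl | hj
        · right
          simp [hi h]
          ring
        · left
          simp [hj]
      · intro y hy
        rw [hi h] at hy
        refine ⟨Finset.mem_union_left _ hy, ?_⟩
        rw [hface y hy]
        norm_num
    | succ k ih =>
      intro hk
      have e : z + Pi.single i (σ * (((k + 1 : ℕ) : ℤ) - 1)) = P k := by
        simp [hP]
      rw [e]
      have hmono : {t | t ∈ T ∧ r t < (k : ℤ)} ⊆ {t | t ∈ T ∧ r t < ((k + 1 : ℕ) : ℤ)} :=
        fun t ht => ⟨ht.1, ht.2.trans (by push_cast; linarith)⟩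
      refine .step ((ih (by omega)).mono hmono) ⟨hPT k (by omega), ?_⟩ ?_
      · rw [hrP]
        push_cast
        linarith
      · have e : P k - (z + Pi.single i (σ * ((k : ℤ) - 1))) =
            Pi.single i (dirSign h i) := by
          rw [hi h]
          funext j
          rcases eq_or_ne j i with rfl | hj
          · simp [hP]
            ring
          · simp [hP, hj]
        rw [e]
        exact isPropagation_single (hG h.2) i
  have hTbox : (T : Set (Lattice d)) ⊆ box (n + 1) (P n) := by
    intro y hy
    refine Finset.mem_coe.2 (mem_box.2 fun j => ?_)
    rcases Finset.mem_union.1 (Finset.mem_coe.1 hy) with hm | hm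
    · have h1 := mem_box.1 (Finset.mem_filter.1 hm).1 j
      rcases eq_or_ne j i with rfl | hj
      · rw [hPi, (Finset.mem_filter.1 hm).2.1, abs_le]
        push_cast
        rcases hσ with rfl | rfl <;> constructor <;> linarith
      · rw [hPj n j hj]
        refine h1.trans ?_
        push_cast
        linarith
    · obtain ⟨k, hk, rfl⟩ := Finset.mem_image.1 hm
      have hk' : k ≤ n := by simpa [Nat.lt_succ_iff] using hk
      rcases eq_or_ne j i with rfl | hj
      · rw [hPi, hPi, abs_le]
        push_cast
        have : (k : ℤ) ≤ n := by exact_mod_cast hk'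
        rcases hσ with rfl | rfl <;> constructor <;> linarith
      · rw [hPj n j hj, hPj k j hj, sub_self, abs_zero]
        positivity
  refine (reach_update_of_supply hG r ω T (hPT n le_rfl) ?_ ?_ s).mono hTbox
  · intro t ht hne
    rw [hrP]
    rcases Finset.mem_union.1 ht with hm | hm
    · rw [hface t hm]
      linarith [(Nat.cast_nonneg n : (0 : ℤ) ≤ n)]
    · obtain ⟨k, hk, rfl⟩ := Finset.mem_image.1 hm
      rw [hrP]
      have hk' : k ≤ n := by simpa [Nat.lt_succ_iff] using hk
      have : k ≠ n := by
        rintro rfl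
        exact hne rfl
      exact_mod_cast lt_of_le_of_ne hk' this
  · intro t ht h hth
    rcases Finset.mem_union.1 ht with hm | hm
    · exfalso
      rcases hth with hth | rfl
      · obtain ⟨h1, -, h3⟩ := Finset.mem_filter.1 hm
        rw [hω.neutral_of_exists_eq hG h1 h3] at hth
        exact neutral_ne_vacancy h hth
      · have := hrP n
        rw [hface _ hm] at this
        omega
    · obtain ⟨k, hk, rfl⟩ := Finset.mem_image.1 hm
      have hk' : k ≤ n := by simpa [Nat.lt_succ_iff] using hk
      refine ⟨_, by rw [hrP]; exact hsupply h k (by omega), ?_⟩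
      have e : P k - (z + Pi.single i (σ * ((k : ℤ) - 1))) =
          Pi.single i (dirSign h i) := by
        rw [hi h]
        funext j
        rcases eq_or_ne j i with rfl | hj
        · simp [hP]
          ring
        · simp [hP, hj]
      rw [e]
      exact isPropagation_single (hG h.2) i

/-- **Common direction.** If a coordinate is the same for all vacancy types, then the spectral gap
is positive. -/
theorem spectralGap_pos_of_common_direction (hG : G ⊆ hypercube d) (Q : ParameterSet G) (i : Fin d)
    (hi : ∀ h ∈ G, ∀ h' ∈ G, h i = h' i) : 0 < spectralGap Q := by
  classical
  obtain ⟨σ, hσ, hiσ⟩ : ∃ σ : ℤ, (σ = 1 ∨ σ = -1) ∧ ∀ h : G, dirSign h i = σ := by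
    rcases G.eq_empty_or_nonempty with rfl | ⟨g, hg⟩
    · exact ⟨1, Or.inl rfl, fun h => absurd h.2 (Finset.notMem_empty _)⟩
    · refine ⟨dirSign g i, dirSign_eq (hG hg) i, fun h => ?_⟩
      unfold dirSign
      rw [hi h h.2 g hg]
  have hσσ : σ * σ = 1 := by rcases hσ with rfl | rfl <;> norm_num
  let z : Lattice d → ℕ → Lattice d := fun x t => x - Pi.single i (σ * (2 + 3 * t : ℕ))
  have hzi : ∀ x t, z x t i = x i - σ * (2 + 3 * t : ℕ) := fun x t => by simp [z]
  refine spectralGap_pos_of_events Q (fun y => σ * y i) (κ := Unit) 10 (3 ^ d) fun M =>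
    ⟨{()}, fun _ => Finset.range M, fun x _ t => box 1 (z x t),
      fun x _ t => {ω | SourcePattern ω (z x t)}, ?_, ?_, ?_, ?_, ?_, ?_, ?_, ?_⟩
  · simp only [Finset.card_singleton]
    nlinarith [Nat.zero_le M]
  · simp
  · intro x _ _ t ht y hy
    have ht' : t < M := Finset.mem_range.1 ht
    have hbd : 3 + 3 * (t : ℤ) ≤ ((10 * (M + 1) ^ 2 : ℕ) : ℤ) := by
      push_cast
      have : (t : ℤ) + 1 ≤ M := by exact_mod_cast ht'
      nlinarith
    refine Finset.mem_filter.2 ⟨mem_box.2 fun j => ?_, ?_⟩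
    · have h1 := mem_box.1 hy j
      rcases eq_or_ne j i with rfl | hj
      · rw [hzi, abs_le] at h1
        rw [abs_le]
        push_cast at h1 hbd ⊢
        rcases hσ with rfl | rfl <;> constructor <;> linarith
      · have e : z x t j = x j := by simp [z, hj]
        rw [e] at h1
        refine h1.trans ?_
        push_cast at hbd ⊢
        linarith [(Nat.cast_nonneg t : (0 : ℤ) ≤ t)]
    · have h1 := mem_box.1 hy i
      rw [hzi, abs_le] at h1
      push_cast at h1
      have := (Nat.cast_nonneg t : (0 : ℤ) ≤ t)
      simp only
      rcases hσ with rfl | rfl <;> linarith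
  · intro x _ _ t _ t' _ hne
    refine disjoint_box_one i ?_
    rw [hzi, hzi, le_abs]
    push_cast
    rcases hσ with rfl | rfl <;> omega
  · intro x _ _ t _
    exact (card_box 1 _).le
  · intro x _ _ t _ ω η h hω
    exact SourcePattern.congr hG h hω
  · intro x _ _ t _ ω
    exact exists_sourcePattern hG ω _
  · intro x ω h s
    obtain ⟨t, ht, hω⟩ := h () (by simp)
    have ht' : t < M := Finset.mem_range.1 ht
    have h1 := SourcePattern.reach_line hG hω i σ hσ hiσ (2 + 3 * t) s
    have e : z x t + Pi.single i (σ * (2 + 3 * t : ℕ)) = x := by simp [z]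
    rw [e] at h1
    refine h1.mono fun y hy => ?_
    rw [Finset.mem_coe, mem_box] at hy ⊢
    intro j
    refine (hy j).trans ?_
    have : 2 + 3 * t + 1 ≤ 10 * (M + 1) ^ 2 := by nlinarith
    exact_mod_cast this

end Pattern

/-! ### Staircases -/

section Staircase

/-- A staircase of hits of `A`, where `A t i` means that position `t` of line `i` is a hit: `K 0` is
the first hit at a positive position of line `0`, and `K (i + 1)` is the first hit of line `i + 1`
beyond `K i`. The staircase ends with line `m`, after which `K` is constant. -/
structure Staircase (A : ℕ → ℕ → Prop) (K : ℕ → ℕ) (m : ℕ) : Prop where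
  two_le : 2 ≤ K 0
  strict : ∀ i < m, K i < K (i + 1)
  const : ∀ i, m ≤ i → K i = K m
  hit : ∀ i ≤ m, A (K i) i
  miss_zero : ∀ t, 1 ≤ t → t < K 0 → ¬ A t 0
  miss : ∀ i < m, ∀ t, K i < t → t < K (i + 1) → ¬ A t (i + 1)

variable {A : ℕ → ℕ → Prop} {K : ℕ → ℕ} {m : ℕ}

lemma Staircase.monotone (h : Staircase A K m) : Monotone K := by
  refine monotone_nat_of_le_succ fun i => ?_
  by_cases hi : i < m
  · exact (h.strict i hi).le
  · rw [h.const i (by omega), h.const (i + 1) (by omega)]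

lemma Staircase.le_top (h : Staircase A K m) (i : ℕ) : K i ≤ K m := by
  rcases le_total i m with hi | hi
  · exact h.monotone hi
  · exact (h.const i hi).le

lemma Staircase.add_two_le (h : Staircase A K m) {i : ℕ} (hi : i ≤ m) : i + 2 ≤ K i := by
  induction i with
  | zero => simpa using h.two_le
  | succ i ih =>
    have := h.strict i (by omega)
    have := ih (by omega)
    omega

lemma Staircase.lt_pred (h : Staircase A K m) {k : ℕ} (hk : k + 1 < K m) :
    k + 1 < K k := by
  rcases le_or_gt k m with hi | hi
  · have := h.add_two_le hi
    omega
  · rw [h.const k hi.le]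
    exact hk

lemma Staircase.pos (h : Staircase A K m) (i : ℕ) : 0 < K i :=
  lt_of_lt_of_le (by have := h.two_le; omega) (h.monotone (Nat.zero_le i))

lemma Staircase.exists_start (h : Staircase A K m) {k j : ℕ} (hk : k < K j) :
    ∃ i ≤ j, i ≤ m ∧ k < K i ∧ ∀ i', k < K i' → i ≤ i' := by
  classical
  have hex : ∃ i, k < K i := ⟨j, hk⟩
  refine ⟨Nat.find hex, Nat.find_min' hex hk, ?_, Nat.find_spec hex, fun i' h' =>
    Nat.find_min' hex h'⟩
  exact Nat.find_min' hex (lt_of_lt_of_le hk (h.le_top j))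

/-- A staircase that starts at the origin passes position `n` before the line `n - M`, provided that
each of these lines contains a hit shortly after position `n`, and that on each of `M` successive
segments of `M` lines the hits do not fill the diagonal at distance `e + 1`: on each segment the
staircase moves away from the diagonal by at least one. -/
lemma exists_staircase {M n N : ℕ} (hM : 1 ≤ M) (hn : n = N + M * M + M) (A : ℕ → ℕ → Prop)
    (h0 : ¬ A 1 0) (hF : ∀ i, i + M ≤ n → ∃ t, n < t ∧ t < n + (n - i) ∧ A t i)
    (hH : ∀ e < M, ∃ i, N + e * M < i ∧ i ≤ N + e * M + M ∧ ¬ A (i + e + 1) i) :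
    ∃ K m, Staircase A K m ∧ n < K m ∧ K m < 2 * n := by
  classical
  -- the first hit of line `i` beyond position `s`, and the chosen hits; since position `1` of line
  -- `0` is not a hit, the search on this line can start beyond it
  let nxt : ℕ → ℕ → ℕ := fun i s => if h : ∃ t, s < t ∧ A t i then Nat.find h else s
  let K' : ℕ → ℕ := fun i => Nat.rec (motive := fun _ => ℕ) (nxt 0 1)
    (fun i k => nxt (i + 1) k) i
  have hK0 : K' 0 = nxt 0 1 := rfl
  have hKs : ∀ i, K' (i + 1) = nxt (i + 1) (K' i) := fun i => rfl
  have hnxt : ∀ i s, i + M ≤ n → s ≤ n → s < nxt i s ∧ A (nxt i s) i ∧ nxt i s < n + (n - i) ∧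
      ∀ t, s < t → t < nxt i s → ¬ A t i := by
    intro i s hi hs
    obtain ⟨t, ht1, ht2, ht3⟩ := hF i hi
    have hex : ∃ t, s < t ∧ A t i := ⟨t, by omega, ht3⟩
    have e : nxt i s = Nat.find hex := dif_pos hex
    rw [e]
    refine ⟨(Nat.find_spec hex).1, (Nat.find_spec hex).2, ?_, fun t' h1 h2 h3 => ?_⟩
    · exact lt_of_le_of_lt (Nat.find_min' hex ⟨by omega, ht3⟩) ht2
    · exact Nat.find_min hex h2 ⟨h1, h3⟩
  clear_value K' nxt
  have hn1 : 1 ≤ n := by omega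
  -- if the hits stayed up to position `n`, then each segment would increase the distance
  -- `K' i - i`, which does not decrease, by one, so that it would exceed the remaining `M` lines
  have hpass : ∃ i, i + M ≤ n ∧ n < K' i := by
    by_contra hcon
    push Not at hcon
    have hstep : ∀ i, i + 1 + M ≤ n → K' i + 1 ≤ K' (i + 1) := fun i hi => by
      rw [hKs]
      exact (hnxt (i + 1) (K' i) hi (hcon i (by omega))).1
    have hmono : ∀ i l, i + l + M ≤ n → K' i + l ≤ K' (i + l) := by
      intro i l
      induction l with
      | zero => intro _; simp
      | succ l ih =>
        intro h
        have h1 := ih (by omega)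
        have h2 := hstep (i + l) (by omega)
        show K' i + (l + 1) ≤ K' (i + l + 1)
        omega
    have hgap : ∀ e ≤ M, N + e * M + e + 1 ≤ K' (N + e * M) := by
      intro e
      induction e with
      | zero =>
        intro _
        have h1 := (hnxt 0 1 (by omega) hn1).1
        have h2 := hmono 0 N (by omega)
        rw [hK0] at h2
        simp only [zero_mul, add_zero, zero_add] at h2 ⊢
        omega
      | succ e ih =>
        intro he
        have h1 := ih (by omega)
        have hle : (e + 1) * M ≤ M * M := Nat.mul_le_mul_right M he
        rw [Nat.succ_mul] at hle
        have e1 : N + (e + 1) * M = N + e * M + M := by ring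
        rw [e1]
        refine le_of_not_gt fun hlt => ?_
        obtain ⟨i, hi1, hi2, hi3⟩ := hH e (by omega)
        obtain ⟨l, rfl⟩ : ∃ l, i = N + e * M + l + 1 := ⟨i - (N + e * M) - 1, by omega⟩
        have h2 := hmono (N + e * M) l (by omega)
        have h3 := hmono (N + e * M + l + 1) (M - l - 1) (by omega)
        rw [show N + e * M + l + 1 + (M - l - 1) = N + e * M + M by omega] at h3
        obtain ⟨g1, g2, -, g4⟩ :=
          hnxt (N + e * M + l + 1) (K' (N + e * M + l)) (by omega) (hcon _ (by omega))
        rw [← hKs] at g1 g2 g4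
        have h4 : K' (N + e * M + l + 1) = N + e * M + l + 1 + e + 1 := by omega
        rw [h4] at g2
        exact hi3 g2
    have h1 := hgap M le_rfl
    have h2 := hcon (N + M * M) (by omega)
    omega
  obtain ⟨m, ⟨hm1, hm2⟩, hmin'⟩ : ∃ m, (m + M ≤ n ∧ n < K' m) ∧
      ∀ i < m, ¬ (i + M ≤ n ∧ n < K' i) :=
    ⟨Nat.find hpass, Nat.find_spec hpass, fun i hi => Nat.find_min hpass hi⟩
  have hlt : ∀ i, i < m → K' i ≤ n := fun i hi => by
    by_contra h
    exact hmin' i hi ⟨by omega, by omega⟩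
  have hfirst := hnxt 0 1 (by omega) hn1
  rw [← hK0] at hfirst
  have hnext : ∀ i, i + 1 ≤ m → K' i < K' (i + 1) ∧ A (K' (i + 1)) (i + 1) ∧
      K' (i + 1) < n + (n - (i + 1)) ∧ ∀ t, K' i < t → t < K' (i + 1) → ¬ A t (i + 1) :=
    fun i hi => by
      rw [hKs]
      exact hnxt (i + 1) (K' i) (by omega) (hlt i (by omega))
  have hmin : ∀ i ≤ m, K' (min i m) = K' i := fun i hi => by rw [min_eq_left hi]
  refine ⟨fun i => K' (min i m), m, ⟨?_, ?_, ?_, ?_, ?_, ?_⟩, ?_, ?_⟩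
  · have := hfirst.1
    simp only [Nat.zero_min]
    omega
  · intro i hi
    simp only [hmin i hi.le, hmin (i + 1) hi]
    exact (hnext i hi).1
  · intro i hi
    simp only [min_eq_right hi, min_self]
  · intro i hi
    simp only [hmin i hi]
    cases i with
    | zero => exact hfirst.2.1
    | succ i => exact (hnext i hi).2.1
  · intro t ht ht'
    rcases ht.eq_or_lt with rfl | ht
    · exact h0
    · exact hfirst.2.2.2 t ht (by simpa using ht')
  · intro i hi t h1 h2
    simp only [hmin i hi.le] at h1
    simp only [hmin (i + 1) hi] at h2
    exact (hnext i hi).2.2.2 t h1 h2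
  · simpa using hm2
  · simp only [min_self]
    cases m with
    | zero => omega
    | succ i =>
      have := (hnext i le_rfl).2.2.1
      omega

end Staircase

/-! ### Crossing staircases -/

section Crossing

variable {d : ℕ} {G : Finset (Lattice d)}

/-- The vertex with coordinates `k` and `j` in the plane through `z` that is spanned by the
directions `σ e_i` and `τ e_j`. -/
def planePt (z : Lattice d) (i₀ i₁ : Fin d) (σ τ k j : ℤ) : Lattice d :=
  z + Pi.single i₀ (σ * k) + Pi.single i₁ (τ * j)

lemma planePt_swap (z : Lattice d) (i₀ i₁ : Fin d) (σ τ k j : ℤ) :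
    planePt z i₁ i₀ τ σ j k = planePt z i₀ i₁ σ τ k j := by
  unfold planePt
  abel

/-- Two vacancy types `a` and `b` and two signed axes `σ e_{i₀}` and `τ e_{i₁}` such that all types
but `a` propagate along the first and all types but `b` along the second one. -/
structure Crossing (a b : G) (i₀ i₁ : Fin d) (σ τ : ℤ) : Prop where
  axis_ne : i₀ ≠ i₁
  type_ne : a ≠ b
  sign_fst : σ = 1 ∨ σ = -1
  sign_snd : τ = 1 ∨ τ = -1
  fst : ∀ h : G, h ≠ a → dirSign (h : Lattice d) i₀ = σ
  snd : ∀ h : G, h ≠ b → dirSign (h : Lattice d) i₁ = τ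
  fst_neg : dirSign (a : Lattice d) i₀ = -σ
  snd_neg : dirSign (b : Lattice d) i₁ = -τ

variable {a b : G} {i₀ i₁ : Fin d} {σ τ : ℤ}

lemma Crossing.symm (hc : Crossing a b i₀ i₁ σ τ) : Crossing b a i₁ i₀ τ σ :=
  ⟨hc.axis_ne.symm, hc.type_ne.symm, hc.sign_snd, hc.sign_fst, hc.snd, hc.fst, hc.snd_neg,
    hc.fst_neg⟩

lemma Crossing.planePt_fst (hc : Crossing a b i₀ i₁ σ τ) (z : Lattice d) (k j : ℤ) :
    planePt z i₀ i₁ σ τ k j i₀ = z i₀ + σ * k := by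
  simp [planePt, hc.axis_ne]

lemma Crossing.planePt_snd (hc : Crossing a b i₀ i₁ σ τ) (z : Lattice d) (k j : ℤ) :
    planePt z i₀ i₁ σ τ k j i₁ = z i₁ + τ * j := by
  simp [planePt, hc.axis_ne.symm]

lemma planePt_of_ne (z : Lattice d) (k j : ℤ) {i : Fin d} (h₀ : i ≠ i₀) (h₁ : i ≠ i₁) :
    planePt z i₀ i₁ σ τ k j i = z i := by
  simp [planePt, h₀, h₁]

lemma planePt_add_fst (z : Lattice d) (k j l : ℤ) :
    planePt z i₀ i₁ σ τ k j + Pi.single i₀ (σ * l) = planePt z i₀ i₁ σ τ (k + l) j := by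
  simp only [planePt, mul_add, Pi.single_add]
  abel

lemma planePt_add_snd (z : Lattice d) (k j l : ℤ) :
    planePt z i₀ i₁ σ τ k j + Pi.single i₁ (τ * l) = planePt z i₀ i₁ σ τ k (j + l) := by
  simp only [planePt, mul_add, Pi.single_add]
  abel

lemma planePt_sub_snd (z : Lattice d) (k j : ℤ) :
    planePt z i₀ i₁ σ τ k (j + 1) - planePt z i₀ i₁ σ τ k j = Pi.single i₁ τ := by
  rw [← planePt_add_snd, mul_one, add_sub_cancel_left]

lemma planePt_sub_fst (z : Lattice d) (k j : ℤ) :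
    planePt z i₀ i₁ σ τ (k + 1) j - planePt z i₀ i₁ σ τ k j = Pi.single i₀ σ := by
  rw [← planePt_add_fst, mul_one, add_sub_cancel_left]

lemma Supply.line (hG : G ⊆ hypercube d) {ω : Config G} {T : Finset (Lattice d)}
    {C : Set (Lattice d)} {h : G} {y : Lattice d} (hy : Supply ω T C h y) (i : Fin d) (n : ℕ)
    (hC : ∀ l : ℕ, 1 ≤ l → l ≤ n → y + Pi.single i (dirSign (h : Lattice d) i * l) ∈ C) :
    Supply ω T C h (y + Pi.single i (dirSign (h : Lattice d) i * n)) := by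
  induction n with
  | zero => simpa using hy
  | succ n ih =>
    refine .step (ih fun l h1 h2 => hC l h1 (by omega)) (hC (n + 1) (by omega) le_rfl) ?_
    have e : y + Pi.single i (dirSign (h : Lattice d) i * ((n + 1 : ℕ) : ℤ)) -
        (y + Pi.single i (dirSign (h : Lattice d) i * n)) =
          Pi.single i (dirSign (h : Lattice d) i) := by
      push_cast
      rw [mul_add, Pi.single_add, mul_one]
      abel
    rw [e]
    exact isPropagation_single (hG h.2) i

lemma Crossing.supply_up (hc : Crossing a b i₀ i₁ σ τ) (hG : G ⊆ hypercube d) {ω : Config G}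
    {z : Lattice d} {T : Finset (Lattice d)} {C : Set (Lattice d)} {k j : ℤ}
    (hy : Supply ω T C a (planePt z i₀ i₁ σ τ k j)) (n : ℕ)
    (hC : ∀ l : ℕ, 1 ≤ l → l ≤ n → planePt z i₀ i₁ σ τ k (j + l) ∈ C) :
    Supply ω T C a (planePt z i₀ i₁ σ τ k (j + n)) := by
  have h := hy.line hG i₁ n
  rw [hc.snd a hc.type_ne, planePt_add_snd] at h
  refine h fun l h1 h2 => ?_
  rw [planePt_add_snd]
  exact hC l h1 h2

lemma Crossing.supply_left (hc : Crossing a b i₀ i₁ σ τ) (hG : G ⊆ hypercube d) {ω : Config G}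
    {z : Lattice d} {T : Finset (Lattice d)} {C : Set (Lattice d)} {k j : ℤ}
    (hy : Supply ω T C a (planePt z i₀ i₁ σ τ k j)) (n : ℕ)
    (hC : ∀ l : ℕ, 1 ≤ l → l ≤ n → planePt z i₀ i₁ σ τ (k - l) j ∈ C) :
    Supply ω T C a (planePt z i₀ i₁ σ τ (k - n) j) := by
  have e : ∀ l : ℕ, planePt z i₀ i₁ σ τ k j + Pi.single i₀ (dirSign (a : Lattice d) i₀ * l) =
      planePt z i₀ i₁ σ τ (k - l) j := fun l => by
    rw [hc.fst_neg, neg_mul_comm, planePt_add_fst, sub_eq_add_neg]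
  have h := hy.line hG i₀ n
  rw [e] at h
  refine h fun l h1 h2 => ?_
  rw [e]
  exact hC l h1 h2

/-- Below the staircases `K` and `J`, an `a`-vacancy can be supplied below each `a`-vacancy: either
it is directly above a step of `K`, or an `a`-vacancy can be brought there from a step of `K` to the
right of it, or from the boundary. -/
lemma Crossing.supply_below (hc : Crossing a b i₀ i₁ σ τ) (hG : G ⊆ hypercube d) {ω : Config G}
    {z : Lattice d} {K J : ℕ → ℕ} {m : ℕ}
    (hK : Staircase (fun t i => ω (planePt z i₀ i₁ σ τ t i) = vacancy a) K m) (hJ : Monotone J)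
    {T : Finset (Lattice d)} {C : Set (Lattice d)}
    (hT : ∀ i ≤ m, planePt z i₀ i₁ σ τ (K i) i ∉ T) {k j : ℕ} (hk : k < K (j + 1))
    (hj : j + 1 < J k)
    (hC : ∀ k' j' : ℕ, k' < K j' → j' < J k' → (min k' j' < min k (j + 1) ∨
      min k' j' = min k (j + 1) ∧ max k' j' < max k (j + 1)) → planePt z i₀ i₁ σ τ k' j' ∈ C)
    (hz : Supply ω T C a (planePt z i₀ i₁ σ τ 0 (-1)))
    (hω : ω (planePt z i₀ i₁ σ τ k (j + 1)) = vacancy a ∨ j + 1 = k) :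
    Supply ω T C a (planePt z i₀ i₁ σ τ k j) := by
  rcases le_or_gt (K j) k with hkj | hkj
  · have hjm : j < m := by
      by_contra hcon
      rw [hK.const (j + 1) (by omega), ← hK.const j (by omega)] at hk
      omega
    rcases hkj.eq_or_lt with rfl | hlt
    · exact .source (hT j hjm.le) (hK.hit j hjm.le)
    · exfalso
      rcases hω with hω | rfl
      · exact hK.miss j hjm k hlt hk (by exact_mod_cast hω)
      · have := hK.add_two_le hjm.le
        omega
  · rcases Nat.eq_zero_or_pos k with rfl | hk0
    · have h := hc.supply_up hG hz (j + 1) fun l h1 h2 => by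
        obtain ⟨l, rfl⟩ : ∃ l', l = l' + 1 := ⟨l - 1, by omega⟩
        have := hC 0 l (hK.pos l) (by omega) (by omega)
        push_cast at this ⊢
        simpa [add_comm] using this
      push_cast at h ⊢
      simpa [add_comm] using h
    · obtain ⟨i, hij, him, hki, hmin⟩ := hK.exists_start hkj
      have hik : i < k := by
        have h1 := hK.lt_pred (k := k - 1) (by have := hK.le_top j; omega)
        have := hmin (k - 1) (by omega)
        omega
      have h1 : Supply ω T C a (planePt z i₀ i₁ σ τ (K i) i) := .source (hT i him) (hK.hit i him)
      have h2 := hc.supply_left hG h1 (K i - k) fun l hl1 hl2 => by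
        have h3 := hJ (show k ≤ K i - l by omega)
        have := hC (K i - l) i (by omega) (by omega) (by omega)
        rwa [Nat.cast_sub (by omega)] at this
      rw [Nat.cast_sub hki.le, sub_sub_cancel] at h2
      have h3 := hc.supply_up hG h2 (j - i) fun l hl1 hl2 => by
        have := hK.monotone (show i ≤ i + l by omega)
        have := hC k (i + l) (by omega) (by omega) (by omega)
        exact_mod_cast this
      rwa [Nat.cast_sub hij, add_sub_cancel] at h3

/-- The region below two crossing staircases can be left downwards or to the left. -/
lemma Staircase.pred {A B : ℕ → ℕ → Prop} {K J : ℕ → ℕ} {m m' : ℕ} (hK : Staircase A K m)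
    (hJ : Staircase B J m') {k j : ℕ} (hk : k < K j) (hj : j < J k) (hkj : ¬ (k = 0 ∧ j = 0)) :
    (∃ k', k = k' + 1 ∧ j < J k') ∨ ∃ j', j = j' + 1 ∧ k < K j' := by
  rcases k with _ | k
  · rcases j with _ | j
    · exact absurd ⟨rfl, rfl⟩ hkj
    · exact Or.inr ⟨j, rfl, hK.pos j⟩
  · rcases j with _ | j
    · exact Or.inl ⟨k, rfl, hJ.pos k⟩
    · by_contra hcon
      push Not at hcon
      have h1 := hcon.1 k rfl
      have h2 := hcon.2 j rfl
      have h3 : k < m' := by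
        by_contra h
        rw [hJ.const (k + 1) (by omega), ← hJ.const k (by omega)] at hj
        omega
      have h4 : j < m := by
        by_contra h
        rw [hK.const (j + 1) (by omega), ← hK.const j (by omega)] at hk
        omega
      have := hJ.add_two_le h3.le
      have := hK.add_two_le h4.le
      omega

/-- A vacancy that propagates along both axes can be supplied to the whole region below the
staircases, by a monotone path. -/
lemma Staircase.supply_region (hG : G ⊆ hypercube d) {A B : ℕ → ℕ → Prop} {K J : ℕ → ℕ} {m m' : ℕ}
    (hK : Staircase A K m) (hJ : Staircase B J m') {ω : Config G} {z : Lattice d}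
    {T : Finset (Lattice d)} {C : Set (Lattice d)} {h : G} (h₀ : dirSign (h : Lattice d) i₀ = σ)
    (h₁ : dirSign (h : Lattice d) i₁ = τ) (hz : Supply ω T C h (planePt z i₀ i₁ σ τ (-1) 0))
    (n : ℕ) : ∀ k j : ℕ, k + j = n → k < K j → j < J k →
    (∀ k' j' : ℕ, k' < K j' → j' < J k' → k' ≤ k → j' ≤ j → planePt z i₀ i₁ σ τ k' j' ∈ C) →
    Supply ω T C h (planePt z i₀ i₁ σ τ k j) := by
  have hu : IsPropagation (h : Lattice d) (Pi.single i₀ σ) := h₀ ▸ isPropagation_single (hG h.2) i₀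
  have hw : IsPropagation (h : Lattice d) (Pi.single i₁ τ) := h₁ ▸ isPropagation_single (hG h.2) i₁
  induction n with
  | zero =>
    intro k j hkj hk hj hC
    obtain ⟨rfl, rfl⟩ : k = 0 ∧ j = 0 := by omega
    refine .step hz (hC 0 0 hk hj le_rfl le_rfl) ?_
    have := planePt_sub_fst (σ := σ) (τ := τ) (i₀ := i₀) (i₁ := i₁) z (-1) 0
    rw [neg_add_cancel] at this
    simpa only [Nat.cast_zero, this] using hu
  | succ n ih =>
    intro k j hkj hk hj hC
    rcases hK.pred hJ hk hj (by omega) with ⟨k', rfl, h⟩ | ⟨j', rfl, h⟩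
    · refine .step (ih k' j (by omega) (by omega) h fun x y h1 h2 h3 h4 =>
        hC x y h1 h2 (by omega) h4) (hC _ _ hk hj le_rfl le_rfl) ?_
      push_cast
      rwa [planePt_sub_fst]
    · refine .step (ih k j' (by omega) h (by omega) fun x y h1 h2 h3 h4 =>
        hC x y h1 h2 h3 (by omega)) (hC _ _ hk hj le_rfl le_rfl) ?_
      push_cast
      rwa [planePt_sub_snd]

end Crossing

section CrossingReach

variable {d : ℕ} {G : Finset (Lattice d)} {a b : G} {i₀ i₁ : Fin d} {σ τ : ℤ}

lemma Crossing.sub_dirSign_ne_planePt (hc : Crossing a b i₀ i₁ σ τ) (h : G) (z : Lattice d)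
    (k j : ℕ) : z - dirSign (h : Lattice d) ≠ planePt z i₀ i₁ σ τ k j := by
  intro e
  have e₀ := congrFun e i₀
  have e₁ := congrFun e i₁
  rw [hc.planePt_fst, Pi.sub_apply] at e₀
  rw [hc.planePt_snd, Pi.sub_apply] at e₁
  by_cases ha : h = a
  · rw [hc.snd h (by rw [ha]; exact hc.type_ne)] at e₁
    rcases hc.sign_snd with rfl | rfl <;> omega
  · rw [hc.fst h ha] at e₀
    rcases hc.sign_fst with rfl | rfl <;> omega

/-- All vacancies but `b` can be supplied from a source pattern to the site before its centre in the
direction of the second axis. -/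
lemma Crossing.supply_snd (hc : Crossing a b i₀ i₁ σ τ) (hG : G ⊆ hypercube d) {ω : Config G}
    {z : Lattice d} (hω : SourcePattern ω z) {T : Finset (Lattice d)} {C : Set (Lattice d)} {h : G}
    (hb : h ≠ b) (hT : z - dirSign (h : Lattice d) ∉ T)
    (hC : (faceSites i₁ τ z : Set (Lattice d)) ⊆ C) :
    Supply ω T C h (planePt z i₀ i₁ σ τ 0 (-1)) := by
  have hs := hc.snd h hb
  refine hω.supply_face hG hT i₁ _ ?_ (fun j => ?_) (by rwa [hs])
  · rw [hc.planePt_snd, hs]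
    ring
  · rcases eq_or_ne j i₁ with rfl | h₁
    · right
      rw [hc.planePt_snd, hs]
      ring
    · left
      simp [planePt, h₁]

lemma Crossing.exists_supply (hc : Crossing a b i₀ i₁ σ τ) (hG : G ⊆ hypercube d) {ω : Config G}
    {z : Lattice d} {K J : ℕ → ℕ} {m : ℕ}
    (hK : Staircase (fun t i => ω (planePt z i₀ i₁ σ τ t i) = vacancy a) K m) (hJ : Monotone J)
    {T : Finset (Lattice d)} {C : Set (Lattice d)}
    (hT : ∀ i ≤ m, planePt z i₀ i₁ σ τ (K i) i ∉ T) {k j : ℕ} (hk : k < K j) (hj : j < J k)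
    (hC : ∀ k' j' : ℕ, k' < K j' → j' < J k' → (min k' j' < min k j ∨
      min k' j' = min k j ∧ max k' j' < max k j) → planePt z i₀ i₁ σ τ k' j' ∈ C)
    (hz : Supply ω T C a (planePt z i₀ i₁ σ τ 0 (-1)))
    (h₀ : ω (planePt z i₀ i₁ σ τ 0 0) ≠ vacancy a)
    (hω : ω (planePt z i₀ i₁ σ τ k j) = vacancy a ∨ (k = j ∧ 0 < j)) :
    ∃ y, Supply ω T C a y ∧ IsPropagation (a : Lattice d) (planePt z i₀ i₁ σ τ k j - y) := by
  rcases j with _ | j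
  · exfalso
    rcases hω with hω | hω
    · rcases Nat.eq_zero_or_pos k with rfl | hk0
      · exact h₀ (by exact_mod_cast hω)
      · exact hK.miss_zero k hk0 hk hω
    · omega
  · refine ⟨planePt z i₀ i₁ σ τ k j, hc.supply_below hG hK hJ hT hk hj hC hz ?_, ?_⟩
    · rcases hω with hω | hω
      · exact Or.inl (by exact_mod_cast hω)
      · exact Or.inr hω.1.symm
    · push_cast
      rw [planePt_sub_snd, ← hc.snd a hc.type_ne]
      exact isPropagation_single (hG a.2) i₁

/-- **Clearing below two staircases.** Start from a source pattern around `z`. If the `a`-vacancies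
beyond `K` and the `b`-vacancies beyond `J` are kept, then the region below both staircases can be
cleared up to the vertex `n` of the diagonal. -/
theorem Crossing.reach_of_staircases (hc : Crossing a b i₀ i₁ σ τ) (hG : G ⊆ hypercube d)
    {ω : Config G} {z : Lattice d} (hω : SourcePattern ω z) {K J : ℕ → ℕ} {m m' n : ℕ}
    (hK : Staircase (fun t i => ω (planePt z i₀ i₁ σ τ t i) = vacancy a) K m)
    (hJ : Staircase (fun t i => ω (planePt z i₀ i₁ σ τ i t) = vacancy b) J m')
    (hn : 1 ≤ n) (hnK : n < K m) (hKn : K m < 2 * n) (hnJ : n < J m') (hJn : J m' < 2 * n)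
    (s : State G) :
    Reach (box (n + 1) (planePt z i₀ i₁ σ τ n n) : Set (Lattice d)) ω
      (Function.update ω (planePt z i₀ i₁ σ τ n n) s) := by
  classical
  set P : ℕ → ℕ → Lattice d := fun k j => planePt z i₀ i₁ σ τ k j with hP
  have hP₀ : ∀ k j, P k j i₀ = z i₀ + σ * k := fun k j => hc.planePt_fst z k j
  have hP₁ : ∀ k j, P k j i₁ = z i₁ + τ * j := fun k j => hc.planePt_snd z k j
  have hP₂ : ∀ k j i, i ≠ i₀ → i ≠ i₁ → P k j i = z i := fun k j i h₀ h₁ =>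
    planePt_of_ne z k j h₀ h₁
  have hσσ : σ * σ = 1 := by rcases hc.sign_fst with rfl | rfl <;> norm_num
  have hττ : τ * τ = 1 := by rcases hc.sign_snd with rfl | rfl <;> norm_num
  -- the coordinates of a vertex in the plane, and the rank, which clears the region hook by hook
  set u : Lattice d → ℤ := fun y => σ * (y i₀ - z i₀) with hu
  set v : Lattice d → ℤ := fun y => τ * (y i₁ - z i₁) with hv
  have huP : ∀ k j, u (P k j) = k := fun k j => by
    simp only [hu, hP₀]
    linear_combination (k : ℤ) * hσσ
  have hvP : ∀ k j, v (P k j) = j := fun k j => by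
    simp only [hv, hP₁]
    linear_combination (j : ℤ) * hττ
  set r : Lattice d → ℤ ×ₗ ℤ := fun y => toLex (min (u y) (v y), max (u y) (v y)) with hr
  have hrlt : ∀ y y', r y < r y' ↔ min (u y) (v y) < min (u y') (v y') ∨
      min (u y) (v y) = min (u y') (v y') ∧ max (u y) (v y) < max (u y') (v y') := fun y y' =>
    Prod.Lex.toLex_lt_toLex
  -- the region below the staircases; of the lines beyond the vertex `n` of the diagonal, only this
  -- vertex is needed
  let reg : ℕ × ℕ → Prop := fun q => q.1 < K q.2 ∧ q.2 < J q.1 ∧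
    (min q.1 q.2 < n ∨ q.1 = n ∧ q.2 = n)
  set T₀ := ((Finset.range (K m) ×ˢ Finset.range (J m')).filter reg).image fun q => P q.1 q.2
    with hT₀
  set T := faceSites i₀ σ z ∪ faceSites i₁ τ z ∪ T₀ with hT
  have hregT : ∀ k j, k < K j → j < J k → (min k j < n ∨ k = n ∧ j = n) → P k j ∈ T :=
    fun k j h1 h2 h3 => Finset.mem_union_right _ (Finset.mem_image.2 ⟨(k, j), Finset.mem_filter.2
      ⟨Finset.mem_product.2 ⟨Finset.mem_range.2 (h1.trans_le (hK.le_top j)),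
        Finset.mem_range.2 (h2.trans_le (hJ.le_top k))⟩, h1, h2, h3⟩, rfl⟩)
  have hTcases : ∀ y ∈ T, (y ∈ faceSites i₀ σ z ∨ y ∈ faceSites i₁ τ z) ∨
      ∃ k j, y = P k j ∧ k < K j ∧ j < J k ∧ (min k j < n ∨ k = n ∧ j = n) := by
    intro y hy
    rcases Finset.mem_union.1 hy with hy | hy
    · exact Or.inl (Finset.mem_union.1 hy)
    · obtain ⟨⟨k, j⟩, hkj, rfl⟩ := Finset.mem_image.1 hy
      exact Or.inr ⟨k, j, rfl, (Finset.mem_filter.1 hkj).2⟩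
  have hneg : ∀ y, y ∈ faceSites i₀ σ z ∨ y ∈ faceSites i₁ τ z → min (u y) (v y) < 0 := by
    rintro y (hy | hy)
    · have : u y = -1 := by
        simp only [hu, (Finset.mem_filter.1 hy).2.1]
        linear_combination -hσσ
      omega
    · have : v y = -1 := by
        simp only [hv, (Finset.mem_filter.1 hy).2.1]
        linear_combination -hττ
      omega
  have hfacebox : ∀ y, y ∈ faceSites i₀ σ z ∨ y ∈ faceSites i₁ τ z →
      y ∈ box 1 z ∧ ∃ j, y j = z j := by
    rintro y (hy | hy) <;> exact ⟨(Finset.mem_filter.1 hy).1, (Finset.mem_filter.1 hy).2.2⟩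
  have hPT : ∀ k j, P k j ∈ T → k < K j ∧ j < J k := by
    intro k j hkj
    rcases hTcases _ hkj with h | ⟨k', j', e, h1, h2, -⟩
    · have := hneg _ h
      rw [huP, hvP] at this
      omega
    · have e1 := huP k j
      have e2 := hvP k j
      rw [e, huP] at e1
      rw [e, hvP] at e2
      obtain rfl : k' = k := by exact_mod_cast e1
      obtain rfl : j' = j := by exact_mod_cast e2
      exact ⟨h1, h2⟩
  have hcorner : ∀ h : G, z - dirSign (h : Lattice d) ∉ T := by
    intro h hmem
    rcases hTcases _ hmem with hm | ⟨k, j, e, -⟩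
    · obtain ⟨j, hj⟩ := (hfacebox _ hm).2
      rw [Pi.sub_apply] at hj
      rcases dirSign_eq (hG h.2) j with e | e <;> omega
    · exact hc.sub_dirSign_ne_planePt h z k j e
  have hrP : ∀ k j k' j', r (P k j) < r (P k' j') ↔
      (min k j < min k' j' ∨ min k j = min k' j' ∧ max k j < max k' j') := by
    intro k j k' j'
    rw [hrlt, huP, hvP, huP, hvP]
    omega
  have hKn' : n < K n := by
    rcases le_total n m with h | h
    · have := hK.add_two_le h
      omega
    · rwa [hK.const n h]
  have hJn' : n < J n := by
    rcases le_total n m' with h | h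
    · have := hJ.add_two_le h
      omega
    · rwa [hJ.const n h]
  have hTbox : (T : Set (Lattice d)) ⊆ box (n + 1) (P n n) := by
    intro y hy
    refine Finset.mem_coe.2 (mem_box.2 fun j => ?_)
    have hn0 := (Nat.cast_nonneg n : (0 : ℤ) ≤ n)
    rcases hTcases y hy with hm | ⟨k, l, rfl, hk, hl, -⟩
    · have h1 := abs_le.1 (mem_box.1 (hfacebox y hm).1 j)
      have h2 : |z j - P n n j| ≤ n := by
        rcases eq_or_ne j i₀ with rfl | h₀
        · rw [hP₀, abs_le]
          rcases hc.sign_fst with rfl | rfl <;> constructor <;> linarith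
        · rcases eq_or_ne j i₁ with rfl | h₁
          · rw [hP₁, abs_le]
            rcases hc.sign_snd with rfl | rfl <;> constructor <;> linarith
          · simp [hP₂ n n j h₀ h₁]
      rw [abs_le] at h2 ⊢
      push_cast at h1 ⊢
      constructor <;> linarith
    · have hk' := hk.trans_le (hK.le_top l)
      have hl' := hl.trans_le (hJ.le_top k)
      rw [abs_le]
      push_cast
      rcases eq_or_ne j i₀ with rfl | h₀
      · rw [hP₀, hP₀]
        rcases hc.sign_fst with rfl | rfl <;> constructor <;> omega
      · rcases eq_or_ne j i₁ with rfl | h₁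
        · rw [hP₁, hP₁]
          rcases hc.sign_snd with rfl | rfl <;> constructor <;> omega
        · rw [hP₂ _ _ j h₀ h₁, hP₂ _ _ j h₀ h₁]
          constructor <;> linarith
  refine (reach_update_of_supply hG r ω T (hregT n n hKn' hJn' (Or.inr ⟨rfl, rfl⟩)) ?_ ?_ s).mono
    hTbox
  · intro t ht hne
    rw [hrlt, huP, hvP]
    rcases hTcases t ht with hm | ⟨k, j, rfl, -, -, h | ⟨rfl, rfl⟩⟩
    · have := hneg t hm
      omega
    · rw [huP, hvP]
      omega
    · exact absurd rfl hne
  · intro t ht h hth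
    rcases hTcases t ht with hm | ⟨k, j, rfl, hk, hj, hkj⟩
    · exfalso
      rcases hth with hth | rfl
      · obtain ⟨h1, h3⟩ := hfacebox t hm
        rw [hω.neutral_of_exists_eq hG h1 h3] at hth
        exact neutral_ne_vacancy h hth
      · have := hneg _ hm
        rw [huP, hvP] at this
        omega
    · have hC : ∀ k' j' : ℕ, k' < K j' → j' < J k' → (min k' j' < min k j ∨
          min k' j' = min k j ∧ max k' j' < max k j) →
          P k' j' ∈ {t | t ∈ T ∧ r t < r (P k j)} := fun k' j' h1 h2 h3 =>
        ⟨hregT k' j' h1 h2 (by omega), (hrP _ _ _ _).2 h3⟩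
      have hface : ∀ y, y ∈ faceSites i₀ σ z ∨ y ∈ faceSites i₁ τ z →
          y ∈ {t | t ∈ T ∧ r t < r (P k j)} := fun y hy => by
        refine ⟨Finset.mem_union_left _ (Finset.mem_union.2 hy), ?_⟩
        have := hneg y hy
        rw [hrlt, huP, hvP]
        omega
      have hz₁ : ∀ h : G, h ≠ b → Supply ω T {t | t ∈ T ∧ r t < r (P k j)} h
          (planePt z i₀ i₁ σ τ 0 (-1)) := fun h hb =>
        hc.supply_snd hG hω hb (hcorner h) fun y hy => hface y (Or.inr hy)
      have hz₀ : ∀ h : G, h ≠ a → Supply ω T {t | t ∈ T ∧ r t < r (P k j)} h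
          (planePt z i₁ i₀ τ σ 0 (-1)) := fun h ha =>
        hc.symm.supply_snd hG hω ha (hcorner h) fun y hy => hface y (Or.inl hy)
      have h00 : ω (planePt z i₀ i₁ σ τ 0 0) = neutral := by
        have e : planePt z i₀ i₁ σ τ 0 0 = z := by simp [planePt]
        rw [e]
        exact hω.neutral_of_exists_eq hG (mem_box.2 fun i => by simp) ⟨i₀, rfl⟩
      have hth' : ω (P k j) = vacancy h ∨ (k = n ∧ j = n) := by
        refine hth.imp_right fun e => ?_
        have e1 := huP k j
        have e2 := hvP k j
        rw [e, huP] at e1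
        rw [e, hvP] at e2
        omega
      by_cases ha : h = a
      · subst ha
        refine hc.exists_supply hG hK hJ.monotone (fun i _ hi => ?_) hk hj hC (hz₁ _ hc.type_ne)
          (by rw [h00]; exact neutral_ne_vacancy _) (hth'.imp_right fun h => by omega)
        exact (hPT _ _ hi).1.false
      · by_cases hb : h = b
        · subst hb
          have hJ' : Staircase (fun t i => ω (planePt z i₁ i₀ τ σ t i) = vacancy h) J m' := by
            simp only [planePt_swap z i₀ i₁]
            exact hJ
          have h1 := hc.symm.exists_supply hG hJ' hK.monotone (T := T)
            (C := {t | t ∈ T ∧ r t < r (P k j)}) (k := j) (j := k) (fun i _ hi => ?_) hj hk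
            (fun k' j' h1 h2 h3 => ?_) (hz₀ _ ha) ?_ ?_
          · rwa [planePt_swap z i₀ i₁] at h1
          · rw [planePt_swap z i₀ i₁] at hi
            exact (hPT _ _ hi).2.false
          · rw [planePt_swap z i₀ i₁]
            exact hC j' k' h2 h1 (by omega)
          · rw [planePt_swap z i₀ i₁, h00]
            exact neutral_ne_vacancy _
          · rw [planePt_swap z i₀ i₁]
            exact hth'.imp_right fun h => by omega
        · have hs₀ := hc.fst h ha
          have hs₁ := hc.snd h hb
          have hz := hz₀ h ha
          rw [planePt_swap z i₀ i₁] at hz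
          have hsub : ∀ k₁ j₁ : ℕ, k₁ < K j₁ → j₁ < J k₁ → k₁ ≤ k → j₁ ≤ j → k₁ + j₁ < k + j →
              Supply ω T {t | t ∈ T ∧ r t < r (P k j)} h (P k₁ j₁) :=
            fun k₁ j₁ h1 h2 h3 h4 h5 => hK.supply_region hG hJ hs₀ hs₁ hz _ k₁ j₁ rfl h1 h2
              fun k' j' g1 g2 g3 g4 => hC k' j' g1 g2 (by omega)
          by_cases hkj0 : k = 0 ∧ j = 0
          · obtain ⟨rfl, rfl⟩ := hkj0
            refine ⟨_, hz, ?_⟩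
            have := planePt_sub_fst (σ := σ) (τ := τ) (i₀ := i₀) (i₁ := i₁) z (-1) 0
            rw [neg_add_cancel] at this
            simp only [hP, Nat.cast_zero, this]
            exact hs₀ ▸ isPropagation_single (hG h.2) i₀
          · rcases hK.pred hJ hk hj hkj0 with ⟨k', rfl, h'⟩ | ⟨j', rfl, h'⟩
            · refine ⟨_, hsub k' j (by omega) h' (by omega) le_rfl (by omega), ?_⟩
              simp only [hP]
              push_cast
              rw [planePt_sub_fst, ← hs₀]
              exact isPropagation_single (hG h.2) i₀
            · refine ⟨_, hsub k j' h' (by omega) le_rfl (by omega) (by omega), ?_⟩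
              simp only [hP]
              push_cast
              rw [planePt_sub_snd, ← hs₁]
              exact isPropagation_single (hG h.2) i₁

end CrossingReach

/-! ### Crossing axes give a spectral gap -/

section CrossingGap

variable {d : ℕ} {G : Finset (Lattice d)} {a b : G} {i₀ i₁ : Fin d} {σ τ : ℤ}

lemma planePt_planePt (x : Lattice d) (k j k' j' : ℤ) :
    planePt (planePt x i₀ i₁ σ τ k j) i₀ i₁ σ τ k' j' = planePt x i₀ i₁ σ τ (k + k') (j + j') := by
  simp only [planePt, mul_add, Pi.single_add]
  abel

/-- The staircase of `a`-vacancies around the centre `(-n, -n)` of a source pattern, seen from the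
vertex `x`. -/
lemma Crossing.exists_staircase (hc : Crossing a b i₀ i₁ σ τ) (hG : G ⊆ hypercube d) {ω : Config G}
    {x : Lattice d} {B n N : ℕ} (hB : 1 ≤ B) (hn : n = N + B * B + B)
    (hω : SourcePattern ω (planePt x i₀ i₁ σ τ (-n) (-n)))
    (hF : ∀ m : ℕ, B ≤ m → m ≤ n →
      ∃ r : ℕ, r + 1 < m ∧ ω (planePt x i₀ i₁ σ τ (r + 1) (-m)) = vacancy a)
    (hH : ∀ f < B, ∃ m : ℕ, (1 + f) * B ≤ m ∧ m < (1 + f) * B + B ∧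
      ω (planePt x i₀ i₁ σ τ (B - f - m) (-m)) ≠ vacancy a) :
    ∃ K m, Staircase (fun t i =>
      ω (planePt (planePt x i₀ i₁ σ τ (-n) (-n)) i₀ i₁ σ τ t i) = vacancy a) K m ∧
      n < K m ∧ K m < 2 * n := by
  refine MCEM.exists_staircase hB hn _ ?_ ?_ ?_
  · rw [hω.neutral_of_exists_eq hG]
    · exact neutral_ne_vacancy a
    · rw [mem_box]
      intro i
      generalize planePt x i₀ i₁ σ τ (-n) (-n) = z
      rcases eq_or_ne i i₀ with rfl | h₀
      · rw [hc.planePt_fst]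
        rcases hc.sign_fst with rfl | rfl <;> simp
      · simp [planePt, h₀]
    · exact ⟨i₁, by simp [planePt, hc.axis_ne.symm]⟩
  · intro i hi
    obtain ⟨r, hr, h⟩ := hF (n - i) (by omega) (by omega)
    refine ⟨n + r + 1, by omega, by omega, ?_⟩
    rw [planePt_planePt, ← h, Nat.cast_sub (by omega)]
    congr 2
    · push_cast
      ring
    · ring
  · intro e he
    obtain ⟨m, h1, h2, h⟩ := hH (B - 1 - e) (by omega)
    have hBB : (1 + (B - 1 - e)) * B + e * B = B * B := by
      rw [← add_mul]
      congr 1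
      omega
    refine ⟨n - m, by omega, by omega, ?_⟩
    rw [planePt_planePt]
    convert h using 3
    · congr 1
      · rw [show B - 1 - e = B - (1 + e) by omega]
        push_cast [Nat.cast_sub (show m ≤ n by omega), Nat.cast_sub (show 1 + e ≤ B by omega)]
        ring
      · rw [Nat.cast_sub (by omega)]
        ring

lemma Crossing.planePt_mem_pastBox (hc : Crossing a b i₀ i₁ σ τ) (x : Lattice d) {R : ℕ} {p q : ℤ}
    (hp : |p| ≤ R) (hq : |q| ≤ R) (hpq : p + q < 0) :
    planePt x i₀ i₁ σ τ p q ∈ pastBox (fun y => σ * y i₀ + τ * y i₁) R x := by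
  refine Finset.mem_filter.2 ⟨mem_box.2 fun j => ?_, ?_⟩
  · rcases eq_or_ne j i₀ with rfl | h₀
    · rw [hc.planePt_fst]
      rcases hc.sign_fst with rfl | rfl <;> simpa using hp
    · rcases eq_or_ne j i₁ with rfl | h₁
      · rw [hc.planePt_snd]
        rcases hc.sign_snd with rfl | rfl <;> simpa using hq
      · simp [planePt_of_ne x p q h₀ h₁]
  · simp only [hc.planePt_fst, hc.planePt_snd]
    rcases hc.sign_fst with rfl | rfl <;> rcases hc.sign_snd with rfl | rfl <;> linarith

lemma Crossing.planePt_inj (hc : Crossing a b i₀ i₁ σ τ) {x : Lattice d} {p q p' q' : ℤ}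
    (h : planePt x i₀ i₁ σ τ p q = planePt x i₀ i₁ σ τ p' q') : p = p' ∧ q = q' := by
  have h₀ := congrFun h i₀
  have h₁ := congrFun h i₁
  rw [hc.planePt_fst, hc.planePt_fst] at h₀
  rw [hc.planePt_snd, hc.planePt_snd] at h₁
  rcases hc.sign_fst with rfl | rfl <;> rcases hc.sign_snd with rfl | rfl <;> omega

/-- **Crossing axes.** If there is a crossing, then the spectral gap is positive. -/
theorem spectralGap_pos_of_crossing (hG : G ⊆ hypercube d) (Q : ParameterSet G)
    (hc : Crossing a b i₀ i₁ σ τ) : 0 < spectralGap Q := by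
  classical
  -- for each of the two vacancy types: the vertices of the plane, and the type
  let pt : Lattice d → Bool → ℤ → ℤ → Lattice d := fun x s p q =>
    bif s then planePt x i₁ i₀ τ σ p q else planePt x i₀ i₁ σ τ p q
  let ty : Bool → G := fun s => bif s then b else a
  have hpt : ∀ x s (R : ℕ) (p q : ℤ), |p| ≤ R → |q| ≤ R → p + q < 0 →
      pt x s p q ∈ pastBox (fun y => σ * y i₀ + τ * y i₁) R x := by
    rintro x (_ | _) R p q hp hq hpq
    · exact hc.planePt_mem_pastBox x hp hq hpq
    · change planePt x i₁ i₀ τ σ p q ∈ _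
      rw [planePt_swap x i₀ i₁]
      exact hc.planePt_mem_pastBox x hq hp (by omega)
  have hinj : ∀ x s p q p' q', pt x s p q = pt x s p' q' → p = p' ∧ q = q' := by
    rintro x (_ | _) p q p' q' h
    · exact hc.planePt_inj h
    · exact hc.symm.planePt_inj h
  have hset : ∀ (y : Lattice d) (s : State G) (ω : Config G),
      ∃ η : Config G, (∀ i ∉ ({y} : Finset (Lattice d)), η i = ω i) ∧ η y = s := fun y s ω =>
    ⟨Function.update ω y s, fun i hi => Function.update_of_ne (by simpa using hi) _ _, by simp⟩
  -- the constant `40` is generous: radius and number of families are quadratic in `M`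
  refine spectralGap_pos_of_events Q (fun y => σ * y i₀ + τ * y i₁)
    (κ := Unit ⊕ ((Bool × ℕ) ⊕ (Bool × ℕ))) 40 (3 ^ d) fun M => ?_
  obtain ⟨B, hB⟩ : ∃ B, B = M + 2 := ⟨_, rfl⟩
  obtain ⟨R, hR⟩ : ∃ R, R = 40 * (M + 1) ^ 2 := ⟨_, rfl⟩
  rw [← hR]
  have hRB : 1 + 2 * (B + 2) ^ 2 + 2 * B ≤ R := by
    rw [hR, hB]
    nlinarith
  have hRB' : 1 + 2 * (B * B) + 10 * B ≤ R := by nlinarith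
  -- the diagonal distance of the candidates for the source pattern
  let N : ℕ → ℕ := fun t => 3 * t + B * B + B
  -- the families of events: a source pattern on the diagonal; for each type `s` and the line at
  -- distance `B + m` from `x`, a hit shortly beyond the position of `x`; for each type `s` and the
  -- segment of `B` lines at distance at least `(1 + f) * B`, a gap on the diagonal shifted by `B - f`
  let I : Unit ⊕ ((Bool × ℕ) ⊕ (Bool × ℕ)) → Finset ℕ
    | .inl _ => Finset.range B
    | .inr (.inl (_, m)) => Finset.range (B + m - 1)
    | .inr (.inr _) => Finset.range B
  let D : Lattice d → Unit ⊕ ((Bool × ℕ) ⊕ (Bool × ℕ)) → ℕ → Finset (Lattice d) := fun x j t =>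
    match j with
    | .inl _ => box 1 (planePt x i₀ i₁ σ τ (-(N t : ℕ)) (-(N t : ℕ)))
    | .inr (.inl (s, m)) => {pt x s (t + 1) (-(B + m : ℕ))}
    | .inr (.inr (s, f)) => {pt x s (B - f - ((1 + f) * B + t : ℕ)) (-((1 + f) * B + t : ℕ))}
  let E : Lattice d → Unit ⊕ ((Bool × ℕ) ⊕ (Bool × ℕ)) → ℕ → Set (Config G) := fun x j t =>
    match j with
    | .inl _ => {ω | SourcePattern ω (planePt x i₀ i₁ σ τ (-(N t : ℕ)) (-(N t : ℕ)))}
    | .inr (.inl (s, m)) => {ω | ω (pt x s (t + 1) (-(B + m : ℕ))) = vacancy (ty s)}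
    | .inr (.inr (s, f)) =>
      {ω | ω (pt x s (B - f - ((1 + f) * B + t : ℕ)) (-((1 + f) * B + t : ℕ))) ≠ vacancy (ty s)}
  let F : Finset (Unit ⊕ ((Bool × ℕ) ⊕ (Bool × ℕ))) := Finset.disjSum {()}
    (Finset.disjSum (Finset.univ ×ˢ Finset.range ((B + 2) ^ 2)) (Finset.univ ×ˢ Finset.range B))
  have hF₁ : ∀ s m, .inr (.inl (s, m)) ∈ F ↔ m < (B + 2) ^ 2 := by simp [F]
  have hF₂ : ∀ s f, .inr (.inr (s, f)) ∈ F ↔ f < B := by simp [F]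
  refine ⟨F, I, D, E, ?_, ?_, ?_, ?_, ?_, ?_, ?_, ?_⟩
  · simp only [F, Finset.card_disjSum, Finset.card_product, Finset.card_singleton,
      Finset.card_univ, Fintype.card_bool, Finset.card_range]
    omega
  · rintro (_ | ⟨s, m⟩ | ⟨s, f⟩) hj <;> simp only [I, Finset.card_range] <;> omega
  · rintro x (_ | ⟨s, m⟩ | ⟨s, f⟩) hj t ht
    · have ht : t < B := Finset.mem_range.1 ht
      have hN : N t + 1 ≤ R := by simp only [N]; omega
      have hN' : 2 ≤ N t := by simp only [N]; omega
      obtain ⟨n, hn⟩ : ∃ n, n = N t := ⟨_, rfl⟩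
      have hD : D x (.inl ()) t = box 1 (planePt x i₀ i₁ σ τ (-n) (-n)) := by rw [hn]
      rw [← hn] at hN hN'
      intro y hy
      rw [hD] at hy
      have hy := fun j => abs_le.1 (mem_box.1 hy j)
      refine Finset.mem_filter.2 ⟨mem_box.2 fun j => ?_, ?_⟩
      · have h1 := hy j
        rw [abs_le]
        push_cast at h1
        rcases eq_or_ne j i₀ with rfl | h₀
        · rw [hc.planePt_fst] at h1
          rcases hc.sign_fst with rfl | rfl <;> omega
        · rcases eq_or_ne j i₁ with rfl | h₁
          · rw [hc.planePt_snd] at h1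
            rcases hc.sign_snd with rfl | rfl <;> omega
          · rw [planePt_of_ne x _ _ h₀ h₁] at h1
            omega
      · have h1 := hy i₀
        have h2 := hy i₁
        rw [hc.planePt_fst] at h1
        rw [hc.planePt_snd] at h2
        push_cast at h1 h2
        show σ * y i₀ + τ * y i₁ < σ * x i₀ + τ * x i₁
        rcases hc.sign_fst with rfl | rfl <;> rcases hc.sign_snd with rfl | rfl <;> omega
    · rw [hF₁] at hj
      have ht : t < B + m - 1 := Finset.mem_range.1 ht
      have e : (B + 2) ^ 2 = B * B + 4 * B + 4 := by ring
      refine Finset.singleton_subset_iff.2 (hpt x s R _ _ ?_ ?_ ?_)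
      · rw [abs_le]
        omega
      · rw [abs_le]
        omega
      · omega
    · rw [hF₂] at hj
      have ht : t < B := Finset.mem_range.1 ht
      have hfB : (1 + f) * B ≤ B * B := Nat.mul_le_mul_right B (by omega)
      have hfB' : B ≤ (1 + f) * B := Nat.le_mul_of_pos_left B (by omega)
      obtain ⟨m, hm⟩ : ∃ m, m = (1 + f) * B + t := ⟨_, rfl⟩
      have hD : D x (.inr (.inr (s, f))) t = {pt x s (B - f - m) (-m)} := by rw [hm]
      rw [hD]
      refine Finset.singleton_subset_iff.2 (hpt x s R _ _ ?_ ?_ ?_)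
      · rw [abs_le]
        omega
      · rw [abs_le]
        omega
      · omega
  · rintro x (_ | ⟨s, m⟩ | ⟨s, f⟩) hj t ht t' ht' hne
    · refine disjoint_box_one i₀ ?_
      rw [hc.planePt_fst, hc.planePt_fst, le_abs]
      rcases hc.sign_fst with rfl | rfl <;> simp only [N] <;> omega
    · refine Finset.disjoint_singleton.2 fun h => hne ?_
      have := (hinj x s _ _ _ _ h).1
      omega
    · refine Finset.disjoint_singleton.2 fun h => hne ?_
      have := (hinj x s _ _ _ _ h).2
      omega
  · rintro x (_ | ⟨s, m⟩ | ⟨s, f⟩) hj t ht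
    · exact (card_box 1 _).le
    · exact Nat.one_le_pow _ _ (by norm_num)
    · exact Nat.one_le_pow _ _ (by norm_num)
  · rintro x (_ | ⟨s, m⟩ | ⟨s, f⟩) hj t ht ω η h hω
    · exact SourcePattern.congr hG h hω
    · exact (h _ (Finset.mem_singleton_self _)).symm.trans hω
    · exact fun h' => hω ((h _ (Finset.mem_singleton_self _)).trans h')
  · rintro x (_ | ⟨s, m⟩ | ⟨s, f⟩) hj t ht ω
    · exact exists_sourcePattern hG ω _
    · exact hset _ _ ω
    · obtain ⟨η, h1, h2⟩ := hset _ neutral ω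
      exact ⟨η, h1, fun h => neutral_ne_vacancy _ (h2.symm.trans h)⟩
  · intro x ω h s
    obtain ⟨t, ht, hω⟩ := h (.inl ()) (by simp [F])
    have ht : t < B := Finset.mem_range.1 ht
    have hω : SourcePattern ω (planePt x i₀ i₁ σ τ (-(N t : ℕ)) (-(N t : ℕ))) := hω
    have hhit : ∀ s (m : ℕ), B ≤ m → m ≤ N t →
        ∃ r : ℕ, r + 1 < m ∧ ω (pt x s (r + 1) (-m)) = vacancy (ty s) := by
      intro s m h1 h2
      obtain ⟨m, rfl⟩ := Nat.exists_eq_add_of_le h1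
      have e : (B + 2) ^ 2 = B * B + 4 * B + 4 := by ring
      obtain ⟨r, hr, h⟩ := h (.inr (.inl (s, m))) ((hF₁ s m).2 (by simp only [N] at h2; omega))
      have hr : r < B + m - 1 := Finset.mem_range.1 hr
      exact ⟨r, by omega, h⟩
    have hmiss : ∀ s, ∀ f < B, ∃ m : ℕ, (1 + f) * B ≤ m ∧ m < (1 + f) * B + B ∧
        ω (pt x s (B - f - m) (-m)) ≠ vacancy (ty s) := by
      intro s f hf
      obtain ⟨r, hr, h⟩ := h (.inr (.inr (s, f))) ((hF₂ s f).2 hf)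
      have hr : r < B := Finset.mem_range.1 hr
      exact ⟨(1 + f) * B + r, by omega, by omega, h⟩
    obtain ⟨K, m, hK, hK1, hK2⟩ := hc.exists_staircase hG (by omega) rfl hω (hhit false)
      (hmiss false)
    obtain ⟨J, m', hJ, hJ1, hJ2⟩ := hc.symm.exists_staircase hG (n := N t) (by omega) rfl
      (by rwa [planePt_swap x i₀ i₁]) (hhit true) (hmiss true)
    have hJ' : Staircase (fun t' i => ω (planePt (planePt x i₀ i₁ σ τ (-(N t : ℕ)) (-(N t : ℕ)))
        i₀ i₁ σ τ i t') = vacancy b) J m' := by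
      convert hJ using 5
      rw [← planePt_swap _ i₀ i₁, ← planePt_swap _ i₀ i₁]
    have h1 := hc.reach_of_staircases (n := N t) hG hω hK hJ' (by simp only [N]; omega) hK1 hK2 hJ1
      hJ2 s
    rw [planePt_planePt, neg_add_cancel] at h1
    have e : planePt x i₀ i₁ σ τ 0 0 = x := by simp [planePt]
    rw [e] at h1
    refine h1.mono fun y hy => ?_
    rw [Finset.mem_coe, mem_box] at hy ⊢
    intro j
    have := hy j
    refine this.trans ?_
    have : N t + 1 ≤ R := by simp only [N]; omega
    exact_mod_cast this

end CrossingGap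

/-! ### Balls, stars, and the plane -/

section Ball

variable {d : ℕ} {G : Finset (Lattice d)}

/-- **Vacancy types in a ball.** If all vacancy types are at distance at most one from a vertex of
the hypercube, then the spectral gap is positive in dimension at least two. -/
theorem spectralGap_pos_of_ball (hG : G ⊆ hypercube d) (Q : ParameterSet G) (hd : 2 ≤ d)
    {c : Lattice d} (hc : c ∈ hypercube d) (hball : ∀ h ∈ G, ∑ i, |h i - c i| ≤ 1) :
    0 < spectralGap Q := by
  by_cases hcom : ∃ i, ∀ h ∈ G, h i = c i
  · obtain ⟨i, hi⟩ := hcom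
    exact spectralGap_pos_of_common_direction hG Q i fun h hh h' hh' =>
      (hi h hh).trans (hi h' hh').symm
  push Not at hcom
  have hne : ∀ h ∈ G, ∀ i j, i ≠ j → h i ≠ c i → h j = c j := by
    intro h hh i j hij hi
    by_contra hj
    have h1 : ∑ k ∈ {i, j}, |h k - c k| ≤ ∑ k, |h k - c k| :=
      Finset.sum_le_sum_of_subset_of_nonneg (Finset.subset_univ _) fun _ _ _ => abs_nonneg _
    rw [Finset.sum_pair hij] at h1
    have h2 := Int.one_le_abs (sub_ne_zero.2 hi)
    have h3 := Int.one_le_abs (sub_ne_zero.2 hj)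
    have := hball h hh
    omega
  have hval : ∀ h ∈ G, ∀ i, h i ≠ c i → h i = 1 - c i := fun h hh i hi => by
    have h1 := mem_hypercube.1 (hG hh) i
    have h2 := mem_hypercube.1 hc i
    omega
  have huniq : ∀ h ∈ G, ∀ h' ∈ G, ∀ i, h i ≠ c i → h' i ≠ c i → h = h' := by
    intro h hh h' hh' i hi hi'
    funext j
    rcases eq_or_ne i j with rfl | hij
    · rw [hval h hh i hi, hval h' hh' i hi']
    · rw [hne h hh i j hij hi, hne h' hh' i j hij hi']
  obtain ⟨a, ha, ha₀⟩ := hcom ⟨0, by omega⟩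
  obtain ⟨b, hb, hb₁⟩ := hcom ⟨1, by omega⟩
  have h01 : (⟨0, by omega⟩ : Fin d) ≠ ⟨1, by omega⟩ := by simp
  refine spectralGap_pos_of_crossing (a := ⟨a, ha⟩) (b := ⟨b, hb⟩) (i₀ := ⟨0, by omega⟩)
    (i₁ := ⟨1, by omega⟩) (σ := dirSign c ⟨0, by omega⟩) (τ := dirSign c ⟨1, by omega⟩) hG Q
    ⟨h01, ?_, dirSign_eq hc _, dirSign_eq hc _, ?_, ?_, ?_, ?_⟩
  · intro e
    obtain rfl : a = b := congrArg Subtype.val e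
    exact hb₁ (hne a ha _ _ h01 ha₀)
  · intro h hh
    unfold dirSign
    by_contra hcon
    exact hh (Subtype.ext (huniq h h.2 a ha _ (fun e => hcon (by rw [e])) ha₀))
  · intro h hh
    unfold dirSign
    by_contra hcon
    exact hh (Subtype.ext (huniq h h.2 b hb _ (fun e => hcon (by rw [e])) hb₁))
  · simp only [dirSign, hval a ha _ ha₀]
    ring
  · simp only [dirSign, hval b hb _ hb₁]
    ring

/-- A star graph in the hypercube is contained in the ball of radius one around its centre. -/
lemma IsStar.exists_centre {G' : Finset (Lattice d)} (h : IsStar G') :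
    ∃ c ∈ G', ∀ h ∈ G', ∑ i, |h i - c i| ≤ 1 := by
  obtain ⟨n, ⟨φ⟩⟩ := h
  refine ⟨(φ.symm 0).1, (φ.symm 0).2, fun h hh => ?_⟩
  by_cases e : φ ⟨h, hh⟩ = 0
  · have e' : φ.symm 0 = ⟨h, hh⟩ := φ.injective (by rw [φ.apply_symm_apply, e])
    simp [e']
  · have h1 : (SimpleGraph.starGraph (0 : Fin (n + 1))).Adj (φ ⟨h, hh⟩) (φ (φ.symm 0)) := by
      rw [φ.apply_symm_apply]
      simp [e]
    rw [φ.map_adj_iff] at h1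
    exact le_of_eq h1

theorem spectralGap_pos_of_isStar (Q : ParameterSet G) {G' : Finset (Lattice d)} (hGG' : G ⊆ G')
    (hG' : G' ⊂ hypercube d) (hs : IsStar G') : 0 < spectralGap Q := by
  obtain ⟨g, hg, hgG'⟩ := Finset.exists_of_ssubset hG'
  obtain ⟨c, hc, hball⟩ := hs.exists_centre
  have hG : G ⊆ hypercube d := hGG'.trans hG'.1
  rcases d with _ | _ | d
  · exact absurd (Subsingleton.elim c g ▸ hc) hgG'
  · -- on the line, only one of the two vacancy types is left
    refine spectralGap_pos_of_common_direction hG Q 0 fun h hh h' hh' => ?_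
    have key : ∀ h ∈ G, h 0 ≠ g 0 := fun h hh e => hgG' <| by
      have : h = g := by
        funext i
        obtain rfl : i = 0 := Fin.ext (by omega)
        exact e
      exact this ▸ hGG' hh
    have h1 := key h hh
    have h2 := key h' hh'
    have h3 := mem_hypercube.1 hg 0
    have h4 := mem_hypercube.1 (hG hh) 0
    have h5 := mem_hypercube.1 (hG hh') 0
    omega
  · exact spectralGap_pos_of_ball hG Q (by omega) (hG'.1 hc) fun h hh => hball h (hGG' hh)

end Ball

section Plane

variable {G : Finset (Lattice 2)}

lemma card_hypercube (d : ℕ) : (hypercube d).card = 2 ^ d := by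
  simp [hypercube, Fintype.card_piFinset]

theorem spectralGap_pos_of_card_le_three (hG : G ⊆ hypercube 2) (Q : ParameterSet G)
    (hcard : G.card ≤ 3) : 0 < spectralGap Q := by
  obtain ⟨g, hg, hgG⟩ : ∃ g ∈ hypercube 2, g ∉ G := by
    by_contra hcon
    push Not at hcon
    have := Finset.card_le_card (show hypercube 2 ⊆ G from hcon)
    rw [card_hypercube] at this
    omega
  have hg' := mem_hypercube.1 hg
  -- the other three types are in the ball around the vertex opposite to the missing one
  refine spectralGap_pos_of_ball hG Q le_rfl (c := 1 - g) (mem_hypercube.2 fun i => ?_)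
    fun h hh => ?_
  · have := hg' i
    simp only [Pi.sub_apply, Pi.one_apply]
    omega
  · have hne : ¬ (h 0 = g 0 ∧ h 1 = g 1) := fun e => hgG <| by
      have : h = g := by
        funext i
        fin_cases i
        · exact e.1
        · exact e.2
      exact this ▸ hh
    have h0 := mem_hypercube.1 (hG hh) 0
    have h1 := mem_hypercube.1 (hG hh) 1
    have g0 := hg' 0
    have g1 := hg' 1
    rw [Fin.sum_univ_two]
    simp only [Pi.sub_apply, Pi.one_apply]
    rcases h0 with h0 | h0 <;> rcases h1 with h1 | h1 <;> rcases g0 with g0 | g0 <;>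
      rcases g1 with g1 | g1 <;> simp_all

end Plane

/-! ### All vacancy types: blocked configurations -/

section Blocked

variable {d : ℕ} {G : Finset (Lattice d)}

lemma dependsOn_blocked :
    DependsOn ((blocked G).indicator fun _ => (1 : ℝ))
      ((Finset.univ.image fun h : G => 1 - (h : Lattice d) : Finset (Lattice d)) :
        Set (Lattice d)) := by
  classical
  intro ω η h
  have e : ω ∈ blocked G ↔ η ∈ blocked G := forall_congr' fun g => by
    rw [h _ (by simp)]
  simp only [Set.indicator_apply, e]

lemma isLocal_blocked : IsLocal ((blocked G).indicator fun _ => (1 : ℝ)) :=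
  ⟨_, dependsOn_blocked⟩

lemma measurableSet_blocked : MeasurableSet (blocked G) := by
  have h := isLocal_blocked (G := G).measurable (measurableSet_singleton 1)
  convert h using 1
  ext ω
  by_cases hω : ω ∈ blocked G <;> simp [hω]

lemma exists_mem_blocked : ∃ ω : Config G, ω ∈ blocked G := by
  classical
  refine ⟨fun y => if hy : 1 - y ∈ G then vacancy ⟨1 - y, hy⟩ else neutral, fun h => ?_⟩
  have e : 1 - (1 - (h : Lattice d)) = h := sub_sub_cancel _ _
  simp [e]

/-- Local events that are not empty have positive probability. -/
lemma ParameterSet.mu_ne_zero_of_indicator (Q : ParameterSet G) {A : Set (Config G)}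
    (hA : IsLocal (A.indicator fun _ => (1 : ℝ))) (hne : A.Nonempty) : Q.mu A ≠ 0 := by
  obtain ⟨Λ, hΛ⟩ := hA
  obtain ⟨η, hη⟩ := hne
  obtain ⟨δ, hδ, -, hw⟩ := Q.exists_weight_le
  intro h0
  have h1 := le_setAvg_of_eqOn_compl hδ.le hw Λ (f := A.indicator fun _ => (1 : ℝ))
    (Set.indicator_nonneg fun _ _ => zero_le_one) (ω := η) (η := η) fun _ _ => rfl
  rw [Q.setAvg_eq_integral hΛ, Set.indicator_of_mem hη, mul_one,
    integral_eq_zero_of_ae (indicator_meas_zero h0)] at h1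
  exact absurd (pow_pos hδ Λ.card) (not_lt.2 h1)

lemma mu_blocked_ne_zero (Q : ParameterSet G) : Q.mu (blocked G) ≠ 0 :=
  Q.mu_ne_zero_of_indicator isLocal_blocked exists_mem_blocked

lemma mu_compl_blocked_ne_zero (Q : ParameterSet G) (hG : G.Nonempty) : Q.mu (blocked G)ᶜ ≠ 0 := by
  refine Q.mu_ne_zero_of_indicator ?_ ⟨fun _ => neutral, fun h => ?_⟩
  · obtain ⟨Λ, hΛ⟩ := isLocal_blocked (G := G)
    refine ⟨Λ, fun ω η h => ?_⟩
    have := hΛ h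
    simp only [Set.indicator_compl, Pi.sub_apply, this]
  · obtain ⟨g, hg⟩ := hG
    exact neutral_ne_vacancy _ (h ⟨g, hg⟩)

/-- In a blocked configuration no vertex `1 - h` can change, since its neighbours in the propagation
directions of `h` carry other vacancies. -/
lemma update_mem_blocked (hG : G = hypercube d) {ω : Config G} (hω : ω ∈ blocked G) {h : G}
    {x : Lattice d} (hx : ω x = neutral ∨ ω x = vacancy h) (hc : constraint h x ω ≠ 0)
    (s : State G) : Function.update ω x s ∈ blocked G := by
  intro g
  rw [Function.update_of_ne, hω g]
  rintro rfl
  rw [hω g] at hx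
  obtain rfl : g = h := by simpa using hx
  unfold constraint at hc
  obtain ⟨v, hv, hωv⟩ : ∃ v, IsPropagation (g : Lattice d) v ∧ ω (1 - g - v) = vacancy g := by
    by_contra hcon
    exact hc (if_neg hcon)
  have h1 := hω ⟨g + v, hG ▸ hv.2⟩
  rw [show 1 - (g : Lattice d) - v = 1 - (g + v) by abel, h1, vacancy_inj] at hωv
  have h2 : (g : Lattice d) + v = g := congrArg Subtype.val hωv
  exact hv.ne_zero (by simpa using h2)

lemma generator_blocked (hG : G = hypercube d) (Q : ParameterSet G) :
    generator Q ((blocked G).indicator fun _ => (1 : ℝ)) = 0 := by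
  classical
  have key : ∀ (ω : Config G) (h : G) (x : Lattice d), constraint h x ω ≠ 0 →
      (ω x = neutral ∨ ω x = vacancy h) → ∀ s, (s = neutral ∨ s = vacancy h) →
      (blocked G).indicator (fun _ => (1 : ℝ)) (Function.update ω x s) =
        (blocked G).indicator (fun _ => (1 : ℝ)) ω := by
    intro ω h x hc hx s hs
    have e : Function.update ω x s ∈ blocked G ↔ ω ∈ blocked G := by
      refine ⟨fun hω => ?_, fun hω => update_mem_blocked hG hω hx hc s⟩
      have := update_mem_blocked hG hω (h := h) (x := x) (by simpa using hs)
        (by rwa [constraint_update]) (ω x)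
      rwa [Function.update_idem, Function.update_eq_self] at this
    simp only [Set.indicator_apply, e]
  funext ω
  refine Finset.sum_eq_zero fun h _ => ?_
  refine (tsum_congr fun x => ?_).trans tsum_zero
  by_cases hc : constraint h x ω = 0
  · rw [hc, zero_mul, zero_mul]
  · have hg : grad h x ((blocked G).indicator fun _ => (1 : ℝ)) ω = 0 := by
      unfold grad
      split_ifs with h1 h2
      · rw [key ω h x hc (Or.inl h1) _ (Or.inr rfl), sub_self]
      · rw [key ω h x hc (Or.inr h2) _ (Or.inl rfl), sub_self]
      · rfl
    rw [hg, mul_zero]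

lemma not_isConst_blocked (Q : ParameterSet G) (hG : G.Nonempty) :
    ¬ IsConst Q ((blocked G).indicator fun _ => (1 : ℝ)) := by
  rintro ⟨c, hc⟩
  by_cases h1 : c = 1
  · refine mu_compl_blocked_ne_zero Q hG (measure_mono_null (fun ω hω => ?_) hc)
    simpa [h1] using hω
  · refine mu_blocked_ne_zero Q (measure_mono_null (fun ω hω => ?_) hc)
    simp [Set.indicator_of_mem hω, Ne.symm h1]

lemma hypercube_nonempty (d : ℕ) : (hypercube d).Nonempty :=
  ⟨0, mem_hypercube.2 fun _ => Or.inl rfl⟩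

theorem not_zeroIsSimpleEigenvalue (hG : G = hypercube d) (Q : ParameterSet G) :
    ¬ ZeroIsSimpleEigenvalue Q := by
  intro h
  refine not_isConst_blocked Q (hG ▸ hypercube_nonempty d)
    (h _ 0 ⟨isLocal_blocked.memLp Q 2, MemLp.zero, fun _ => _, fun _ => isLocal_blocked, ?_, ?_⟩
      (ae_eq_refl _))
  · simp
  · simp [generator_blocked hG Q]

/-- Since the generator vanishes on the indicator of the blocked configurations, this indicator is a
martingale along the process, hence almost surely constant in time. -/
lemma IsProcess.blocked_symmDiff (hG : G = hypercube d) {Q : ParameterSet G} {S : Type*}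
    [MeasurableSpace S] {P : Measure S} [IsProbabilityMeasure P] {X : ℝ≥0 → S → Config G}
    (hX : IsProcess Q P X) (t : ℝ≥0) :
    P ({s | X 0 s ∈ blocked G} ∆ {s | X t s ∈ blocked G}) = 0 := by
  classical
  set f : Config G → ℝ := (blocked G).indicator fun _ => (1 : ℝ) with hf
  have hM := hX.martingale f isLocal_blocked
  have hgen : generator Q f = 0 := generator_blocked hG Q
  simp only [hgen, Pi.zero_apply, intervalIntegral.integral_zero, sub_zero] at hM
  have hB : MeasurableSet[past X hX.measurable 0] {s | X 0 s ∈ blocked G} := by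
    have h0 : MeasurableSpace.comap (X 0) inferInstance ≤ past X hX.measurable 0 :=
      le_iSup₂_of_le (0 : ℝ≥0) le_rfl le_rfl
    exact h0 _ ⟨_, measurableSet_blocked, rfl⟩
  have hB' : MeasurableSet {s | X 0 s ∈ blocked G} := hX.measurable 0 measurableSet_blocked
  have hint : Integrable (fun s => f (X t s) - f (X 0 s)) P := hM.integrable t
  have h1 := hM.setIntegral_eq (zero_le (a := t)) hB
  have h2 := hM.setIntegral_eq (zero_le (a := t)) hB.compl
  simp only [sub_self, integral_zero] at h1 h2
  have h3 : ∀ᵐ s ∂P, s ∈ {s | X 0 s ∈ blocked G} → f (X t s) - f (X 0 s) = 0 := by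
    rw [← ae_restrict_iff' hB']
    have : 0 = ∫ s in {s | X 0 s ∈ blocked G}, -(f (X t s) - f (X 0 s)) ∂P := by
      rw [integral_neg, ← h1, neg_zero]
    have h4 := (setIntegral_eq_zero_iff_of_nonneg_ae ?_ hint.neg.integrableOn).1 this.symm
    · filter_upwards [h4] with s hs
      exact neg_eq_zero.1 hs
    · filter_upwards [ae_restrict_mem hB'] with s hs
      have : f (X 0 s) = 1 := Set.indicator_of_mem hs _
      simp only [Pi.zero_apply, Pi.neg_apply, this]
      by_cases ht : X t s ∈ blocked G <;> simp [hf, ht]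
  have h5 : ∀ᵐ s ∂P, s ∈ {s | X 0 s ∈ blocked G}ᶜ → f (X t s) - f (X 0 s) = 0 := by
    rw [← ae_restrict_iff' hB'.compl]
    refine (setIntegral_eq_zero_iff_of_nonneg_ae ?_ hint.integrableOn).1 h2.symm
    filter_upwards [ae_restrict_mem hB'.compl] with s hs
    have : f (X 0 s) = 0 := Set.indicator_of_notMem (show X 0 s ∉ blocked G from hs) _
    simp only [Pi.zero_apply, this]
    by_cases ht : X t s ∈ blocked G <;> simp [hf, ht]
  refine measure_mono_null (fun s hs => ?_) (ae_iff.1 (h3.and h5))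
  rintro ⟨g1, g2⟩
  have e : f (X t s) = f (X 0 s) := by
    by_cases hs0 : X 0 s ∈ blocked G
    · exact sub_eq_zero.1 (g1 hs0)
    · exact sub_eq_zero.1 (g2 hs0)
  rcases hs with ⟨a1, a2⟩ | ⟨a1, a2⟩
  · rw [hf, Set.indicator_of_mem (show X 0 s ∈ blocked G from a1),
      Set.indicator_of_notMem (show X t s ∉ blocked G from a2)] at e
    exact zero_ne_one e
  · rw [hf, Set.indicator_of_mem (show X t s ∈ blocked G from a1),
      Set.indicator_of_notMem (show X 0 s ∉ blocked G from a2)] at e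
    exact one_ne_zero e

theorem not_isErgodic.{v} (hG : G = hypercube d) (Q : ParameterSet G) : ¬ IsErgodic.{v} Q := by
  rintro ⟨S, _, P, _, X, hX, hE⟩
  have hA : MeasurableSet {w : ℝ≥0 → Config G | w 0 ∈ blocked G} :=
    (measurable_pi_apply 0) measurableSet_blocked
  have hlaw : ∀ B : Set (Config G), MeasurableSet B → P {s | X 0 s ∈ B} = Q.mu B := fun B hB => by
    rw [← hX.initial_law, Measure.map_apply (hX.measurable 0) hB]
    rfl
  rcases hE _ hA fun t => by simpa using hX.blocked_symmDiff hG t with h | h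
  · exact mu_blocked_ne_zero Q ((hlaw _ measurableSet_blocked).symm.trans h)
  · exact mu_compl_blocked_ne_zero Q (hG ▸ hypercube_nonempty d)
      ((hlaw _ measurableSet_blocked.compl).symm.trans h)

end Blocked

end MCEM

end

theorem theorem1 :
    -- (A) all vacancy types present
    (∀ (d : ℕ) (G : Finset (MCEM.Lattice d)) (Q : MCEM.ParameterSet G), G = MCEM.hypercube d →
      ¬ MCEM.IsErgodic.{u} Q ∧
      ¬ MCEM.ZeroIsSimpleEigenvalue Q ∧
      (MCEM.IsLocal (Set.indicator (MCEM.blocked G) (fun _ => (1 : ℝ))) ∧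
        ¬ MCEM.IsConst Q (Set.indicator (MCEM.blocked G) (fun _ => (1 : ℝ))) ∧
        MCEM.dirichlet Q (Set.indicator (MCEM.blocked G) (fun _ => (1 : ℝ)))
          (MCEM.generator Q (Set.indicator (MCEM.blocked G) (fun _ => (1 : ℝ)))) = 0)) ∧
    -- (B) positive spectral gap
    (∀ (d : ℕ) (G : Finset (MCEM.Lattice d)) (Q : MCEM.ParameterSet G), G ⊂ MCEM.hypercube d →
      ((∃ i : Fin d, ∀ h ∈ G, ∀ h' ∈ G, h i = h' i) ∨
        (∃ G' : Finset (MCEM.Lattice d), G ⊆ G' ∧ G' ⊂ MCEM.hypercube d ∧ MCEM.IsStar G')) →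
      0 < MCEM.spectralGap Q) ∧
    -- the two-dimensional case
    (∀ (G : Finset (MCEM.Lattice 2)) (Q : MCEM.ParameterSet G), G ⊆ MCEM.hypercube 2 →
      (G.card ≤ 3 → 0 < MCEM.spectralGap Q) ∧
      (G.card = 4 → ¬ MCEM.IsErgodic.{u} Q ∧ ¬ MCEM.ZeroIsSimpleEigenvalue Q)) := by
  refine ⟨fun d G Q hG => ⟨MCEM.not_isErgodic hG Q, MCEM.not_zeroIsSimpleEigenvalue hG Q,
    MCEM.isLocal_blocked, MCEM.not_isConst_blocked Q (hG ▸ MCEM.hypercube_nonempty d), ?_⟩, ?_,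
    fun G Q hG => ⟨MCEM.spectralGap_pos_of_card_le_three hG Q, fun hcard => ?_⟩⟩
  · rw [MCEM.generator_blocked hG Q]
    simp [MCEM.dirichlet]
  · rintro d G Q hG (⟨i, hi⟩ | ⟨G', hGG', hG', hs⟩)
    · exact MCEM.spectralGap_pos_of_common_direction hG.1 Q i hi
    · exact MCEM.spectralGap_pos_of_isStar Q hGG' hG' hs
  · have hG' : G = MCEM.hypercube 2 :=
      Finset.eq_of_subset_of_card_le hG (by rw [MCEM.card_hypercube, hcard]; norm_num)
    exact ⟨MCEM.not_isErgodic hG' Q, MCEM.not_zeroIsSimpleEigenvalue hG' Q⟩
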